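/- There is a deterministic parallel algorithm for the PRAM, and there are constants $C,c$, such that the following holds. Let $G=(V,E)$ be a finite simple undirected graph with $n$ vertices, $m$ edges and nonnegative edge lengths $\ell(e)$, and let $f$ be a (fractional) flow on $G$ that satisfies some single-source transshipment demand $b$; that is, $b\colon V\to\mathbb{Q}$ has $\sum_{v}b(v)=0$ and $b(v)\ge 0$ for all vertices $v$ except possibly one vertex $s$, the source, and at every vertex $v$ the inflow of $f$ minus its outflow equals $b(v)$. The input consists of the list of the edges of $G$ with their lengths and flow values, given as fixed-point numbers: all lengths are integer multiples of some $1/p$ and all flow values are integer multiples of some $1/q$, where $p$ and $q$ are positive integers, and $p$, $q$ and the integer multipliers are at most $B$ in absolute value. On this input the algorithm halts after at most $C\log^{c}(n+m+B)$ parallel steps with total work at most $C\,(n+m)\log^{c}(n+m+B)$ (where $\log x$ stands for $\lfloor\log_2 x\rfloor+1$), and it outputs a flow $f'$ on $G$ that satisfies the same demand $b$, whose cost is not larger, $\sum_{e\in E}\ell(e)\,|f'(e)|\le\sum_{e\in E}\ell(e)\,|f(e)|$, and which is supported on a tree: some subgraph of $G$ that is a tree contains every edge $e$ with $f'(e)\ne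 0$. In particular, for lengths and flow values that are polynomially bounded fixed-point numbers ($B\le \mathrm{poly}(n+m)$) the work is near-linear, $\tilde O(n+m)$, and the time is polylogarithmic. -/

import Mathlib

/-! ### A deterministic parallel random access machine with work and time -/

namespace PRAM

/-- The shared memory: named arrays `0, 1, 2, …`, each with cells
indexed by integers; every cell holds an integer. A program is a finite text and so mentions only
finitely many arrays, which makes this the usual single shared memory up to interleaving. -/
abbrev Mem : Type := ℕ → ℤ → ℤ

/-- Expressions that one processor evaluates in one parallel step. A program is a finite text, so
that every expression in it stands for a constant number of elementary instructions. There is no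
multiplication: in one step the bit length of the numbers in memory grows by at most an additive
constant, so that unit cost arithmetic is a fair measure. -/
inductive Expr : Type
  /-- an integer constant -/
  | const (z : ℤ) : Expr
  /-- the index of the processor -/
  | pid : Expr
  /-- the contents of cell `i` of array `a` (indirect addressing) -/
  | read (a : ℕ) (i : Expr) : Expr
  | add (x y : Expr) : Expr
  | sub (x y : Expr) : Expr
  /-- shift to the right by one bit: `⌊x / 2⌋` -/
  | half (x : Expr) : Expr
  /-- if `x ≤ y` then `t` else `u` -/
  | ifLE (x y t u : Expr) : Expr

/-- The value of an expression for processor `i` in memory `M`. -/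
def Expr.eval (M : Mem) (i : ℕ) : Expr → ℤ
  | .const z => z
  | .pid => (i : ℤ)
  | .read a x => M a (x.eval M i)
  | .add x y => x.eval M i + y.eval M i
  | .sub x y => x.eval M i - y.eval M i
  | .half x => x.eval M i / 2
  | .ifLE x y t u => if x.eval M i ≤ y.eval M i then t.eval M i else u.eval M i

/-- Parallel programs. The expressions that control the flow of the program (`k` and `c` below)
are evaluated by processor `0`. -/
inductive Prog : Type
  /-- `for 0 ≤ i < k pardo: if g(i) ≠ 0 then a[x(i)] := v(i)` -/
  | pardo (k g : Expr) (a : ℕ) (x v : Expr) : Prog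
  /-- `P; Q` -/
  | seq (P Q : Prog) : Prog
  /-- `if c ≠ 0 then P else Q` -/
  | cond (c : Expr) (P Q : Prog) : Prog
  /-- `while c ≠ 0 do P` -/
  | loop (c : Expr) (P : Prog) : Prog

/-- The memory after the synchronous step
`for 0 ≤ i < k pardo: if g(i) ≠ 0 then a[x(i)] := v(i)`:
all processors read the old memory `M`, and then they write. If several processors write to the
same cell, then the one with the smallest index succeeds (concurrent reads, priority concurrent
writes). -/
def Mem.step (M : Mem) (k : ℕ) (g : Expr) (a : ℕ) (x v : Expr) : Mem := fun a' y =>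
  if a' = a then
    match (List.range k).find? (fun i => decide (g.eval M i ≠ 0 ∧ x.eval M i = y)) with
    | some i => v.eval M i
    | none => M a y
  else M a' y

/-- `Exec P M M' w t`: the program `P`, started in memory `M`, halts in memory `M'` after `t`
parallel steps (time), in which the processors perform `w` operations in total (work). A parallel
step with `k` processors takes one unit of time and `k + 1` units of work; a test takes one unit
of time and of work. -/
inductive Exec : Prog → Mem → Mem → ℕ → ℕ → Prop
  | pardo (k g : Expr) (a : ℕ) (x v : Expr) (M : Mem) :
      Exec (.pardo k g a x v) M (M.step (k.eval M 0).toNat g a x v) ((k.eval M 0).toNat + 1) 1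
  | seq {P Q : Prog} {M M' M'' : Mem} {w t w' t' : ℕ} :
      Exec P M M' w t → Exec Q M' M'' w' t' → Exec (.seq P Q) M M'' (w + w') (t + t')
  | cond_true {c : Expr} {P Q : Prog} {M M' : Mem} {w t : ℕ} :
      c.eval M 0 ≠ 0 → Exec P M M' w t → Exec (.cond c P Q) M M' (w + 1) (t + 1)
  | cond_false {c : Expr} {P Q : Prog} {M M' : Mem} {w t : ℕ} :
      c.eval M 0 = 0 → Exec Q M M' w t → Exec (.cond c P Q) M M' (w + 1) (t + 1)
  | loop_done {c : Expr} {P : Prog} {M : Mem} :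
      c.eval M 0 = 0 → Exec (.loop c P) M M 1 1
  | loop_step {c : Expr} {P : Prog} {M M' M'' : Mem} {w t w' t' : ℕ} :
      c.eval M 0 ≠ 0 → Exec P M M' w t → Exec (.loop c P) M' M'' w' t' →
      Exec (.loop c P) M M'' (w + w' + 1) (t + t' + 1)

/-- The machine is deterministic: the result, the work and the time of a halting run are
determined by the program and the initial memory. -/
theorem Exec.deterministic {P : Prog} {M M₁ M₂ : Mem} {w₁ t₁ w₂ t₂ : ℕ}
    (h₁ : Exec P M M₁ w₁ t₁) (h₂ : Exec P M M₂ w₂ t₂) : M₁ = M₂ ∧ w₁ = w₂ ∧ t₁ = t₂ := by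
  induction h₁ generalizing M₂ w₂ t₂ with
  | pardo k g a x v M => cases h₂; exact ⟨rfl, rfl, rfl⟩
  | seq _ _ ihP ihQ =>
    cases h₂ with
    | seq hP hQ =>
      obtain ⟨rfl, rfl, rfl⟩ := ihP hP
      obtain ⟨rfl, rfl, rfl⟩ := ihQ hQ
      exact ⟨rfl, rfl, rfl⟩
  | cond_true hc _ ih =>
    cases h₂ with
    | cond_true _ h => obtain ⟨rfl, rfl, rfl⟩ := ih h; exact ⟨rfl, rfl, rfl⟩
    | cond_false hc' _ => exact absurd hc' hc
  | cond_false hc _ ih =>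
    cases h₂ with
    | cond_true hc' _ => exact absurd hc hc'
    | cond_false _ h => obtain ⟨rfl, rfl, rfl⟩ := ih h; exact ⟨rfl, rfl, rfl⟩
  | loop_done hc =>
    cases h₂ with
    | loop_done _ => exact ⟨rfl, rfl, rfl⟩
    | loop_step hc' _ _ => exact absurd hc hc'
  | loop_step hc _ _ ihP ihL =>
    cases h₂ with
    | loop_done hc' => exact absurd hc' hc
    | loop_step _ hP hL =>
      obtain ⟨rfl, rfl, rfl⟩ := ihP hP
      obtain ⟨rfl, rfl, rfl⟩ := ihL hL
      exact ⟨rfl, rfl, rfl⟩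

end PRAM

/-! ### Flows in weighted undirected graphs -/

/-- A finite simple undirected graph with nonnegative edge lengths, given by a list of its edges.
The vertices are `0, …, n - 1`, and the edges are `{src e, dst e}` for `e = 0, …, m - 1`. The order
of the two endpoints in the list is arbitrary; it fixes the sign of a flow through the edge. -/
structure WeightedGraph where
  n : ℕ
  m : ℕ
  src : Fin m → Fin n
  dst : Fin m → Fin n
  loopless : ∀ e, src e ≠ dst e
  simple : Function.Injective fun e => s(src e, dst e)
  len : Fin m → ℚ
  len_nonneg : ∀ e, 0 ≤ len e

namespace WeightedGraph

/-- The underlying simple graph. -/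
def graph (G : WeightedGraph) : SimpleGraph (Fin G.n) :=
  SimpleGraph.fromEdgeSet (Set.range fun e => s(G.src e, G.dst e))

/-- Inflow minus outflow at the vertex `v`. Here `f e` is the amount that `f` sends through `e` from
`src e` to `dst e`; a negative value means flow from `dst e` to `src e`. -/
def netInflow (G : WeightedGraph) (f : Fin G.m → ℚ) (v : Fin G.n) : ℚ :=
  ∑ e with G.dst e = v, f e - ∑ e with G.src e = v, f e

/-- The flow `f` satisfies (routes) the demand `b`: it carries flow from the vertices with negative
demand to those with positive demand. -/
def Routes (G : WeightedGraph) (f : Fin G.m → ℚ) (b : Fin G.n → ℚ) : Prop :=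
  ∀ v, G.netInflow f v = b v

/-- The cost of a flow. -/
def cost (G : WeightedGraph) (f : Fin G.m → ℚ) : ℚ := ∑ e, G.len e * |f e|

/-- `b` is a single-source transshipment demand: its values sum up to zero, and they are
nonnegative except at one vertex, the source. -/
def IsSingleSourceDemand (G : WeightedGraph) (b : Fin G.n → ℚ) : Prop :=
  ∑ v, b v = 0 ∧ ∃ s, ∀ v, v ≠ s → 0 ≤ b v

/-- All edges with nonzero flow lie on a common tree that is a subgraph of the graph. -/
def SupportedOnTree (G : WeightedGraph) (f : Fin G.m → ℚ) : Prop :=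
  ∃ T : G.graph.Subgraph, T.coe.IsTree ∧ ∀ e, f e ≠ 0 → s(G.src e, G.dst e) ∈ T.edgeSet

/-- A representation of the lengths and of the flow `f` by fixed-point numbers: the lengths are
integer multiples of `1 / lenDen`, the flow values are integer multiples of `1 / flowDen`, and
the integers involved are at most `B` in absolute value. -/
structure FixedPoint (G : WeightedGraph) (f : Fin G.m → ℚ) (B : ℕ) where
  lenNum : Fin G.m → ℕ
  lenDen : ℕ
  flowNum : Fin G.m → ℤ
  flowDen : ℕ
  lenDen_pos : 0 < lenDen
  flowDen_pos : 0 < flowDen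
  len_eq : ∀ e, G.len e = (lenNum e : ℚ) / lenDen
  flow_eq : ∀ e, f e = (flowNum e : ℚ) / flowDen
  lenNum_le : ∀ e, lenNum e ≤ B
  lenDen_le : lenDen ≤ B
  flowNum_le : ∀ e, |flowNum e| ≤ (B : ℤ)
  flowDen_le : flowDen ≤ B

/-- The array with entries `x 0, …, x (k - 1)`, followed and preceded by zeros. -/
def toArray {k : ℕ} (x : Fin k → ℤ) (i : ℤ) : ℤ :=
  if h : 0 ≤ i ∧ i.toNat < k then x ⟨i.toNat, h.2⟩ else 0

/-- The initial memory. Array `0` holds `n`, `m` and the two denominators; arrays `1`, `2`, `3`, `4`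
hold the first endpoints, the second endpoints, the lengths and the flow values of the edges
`0, …, m - 1`. All other cells are zero. Neither the demand nor the source is given. -/
def FixedPoint.initMem {G : WeightedGraph} {f : Fin G.m → ℚ} {B : ℕ} (R : G.FixedPoint f B) :
    PRAM.Mem
  | 0 => toArray ![(G.n : ℤ), (G.m : ℤ), (R.lenDen : ℤ), (R.flowDen : ℤ)]
  | 1 => toArray fun e => ((G.src e : ℕ) : ℤ)
  | 2 => toArray fun e => ((G.dst e : ℕ) : ℤ)
  | 3 => toArray fun e => (R.lenNum e : ℤ)
  | 4 => toArray fun e => R.flowNum e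
  | _ => fun _ => 0

/-- The flow that is read off from the final memory: its values, as multiples of `1 / flowDen`,
are in the cells `0, …, m - 1` of array `5`. -/
def FixedPoint.output {G : WeightedGraph} {f : Fin G.m → ℚ} {B : ℕ} (R : G.FixedPoint f B)
    (M : PRAM.Mem) : Fin G.m → ℚ :=
  fun e => (M 5 ((e : ℕ) : ℤ) : ℚ) / R.flowDen

end WeightedGraph

/-! Orient each edge along its flow, and let `s` be the vertex with negative demand (vertex `0` if
there is none). A unit of flow that enters `v ≠ s` through `e` and leaves through `e'` may be moved
to a virtual edge from the start of `e` to the end of `e'`, of length `len e + len e'`; the cost and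
the balances stay the same. Loops and flow into `s` are discarded, which lowers no balance away from
`s`. Once all flow uses edges that start at `s`, the lengths of these edges bound distances from `s`
inside the support of the flow. For such a bound `φ`, weak duality gives `∑ b v * φ v ≤ cost`
(`Net.sum_demand_le`), and routing the demand along a tree of edges with `φ (src e) + len e ≤ φ (dst
e)` costs at most `∑ b v * φ v` (`Net.treeFlow_cost`).

Many shortcuts are made at once. A bipartition `χ` of the edges says whether an edge may be
contracted at its end or at its start. At each vertex the selected incoming edges are laid out as
consecutive intervals on one line, the selected outgoing ones on a second line, and the two lines
are overlaid. Every segment of the overlay becomes an edge, charged to the slot of an interval that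
ends with it, so the number of slots never grows. All accounting goes through one identity,
`Overlay.sum_segment`.

The potential is the flow on edges that do not start at `s`. With `2 ^ T` slots, the bits of the
slot numbers and of their complements give `2 * T` bipartitions that separate every ordered pair of
distinct edges. By `Net.pot_le_sum_gain` the best of them contracts at least a fraction `1 / (2 *
T)` of the potential, so polylogarithmically many rounds bring it to zero (`lt_of_geometric`).

All intermediate nets are kept and then unwound. An edge of a contracted net is an edge or a path of
length two of the preceding net, so one round of relaxation per net turns certified distances for
the one into certified distances for the other (`Net.WeakSuper.relax`). At the bottom each reached
vertex chooses a certifying edge as its parent, and sums of the demand over subtrees, found by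
pointer doubling, give the new flow.

The tree needs positive lengths, for otherwise parent pointers could form a cycle. So integer
lengths are multiplied by a power of two that exceeds the total flow and are increased by one;
integrality then recovers the cost inequality for the original lengths.

On the machine everything reduces to grouped reductions, prefix sums and searching in segment trees,
one tree per key, in logarithmic time on linearly many processors. `Runs` bounds the work by a fixed
multiple of the time, so that only time has to be followed. -/

/-! ### Program logic -/

namespace PRAM

/-- The arrays that a program may write to. -/
def Prog.writes : Prog → List ℕ
  | .pardo _ _ a _ _ => [a]
  | .seq P Q => P.writes ++ Q.writes
  | .cond _ P Q => P.writes ++ Q.writes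
  | .loop _ P => P.writes

theorem Mem.step_ne {M : Mem} {k : ℕ} {g : Expr} {a : ℕ} {x v : Expr} {b : ℕ} (h : b ≠ a) :
    M.step k g a x v b = M b := by
  funext y; simp [Mem.step, h]

theorem Mem.step_eq_update (M : Mem) (k : ℕ) (g : Expr) (a : ℕ) (x v : Expr) :
    M.step k g a x v = Function.update M a (M.step k g a x v a) := by
  funext b
  by_cases h : b = a
  · subst h; simp
  · rw [Mem.step_ne h, Function.update_of_ne h]

theorem Mem.step_hit {M : Mem} {k : ℕ} {g : Expr} {a : ℕ} {x v : Expr} {y z : ℤ} {i : ℕ}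
    (hi : i < k) (hg : g.eval M i ≠ 0) (hx : x.eval M i = y)
    (h : ∀ j < k, g.eval M j ≠ 0 → x.eval M j = y → v.eval M j = z) :
    M.step k g a x v a y = z := by
  simp only [Mem.step, if_true]
  cases hf : (List.range k).find? (fun i => decide (g.eval M i ≠ 0 ∧ x.eval M i = y)) with
  | none =>
    have := List.find?_eq_none.1 hf i (List.mem_range.2 hi)
    simp [hg, hx] at this
  | some j =>
    have h1 := List.find?_some hf
    have h2 := List.mem_of_find?_eq_some hf
    simp only [decide_eq_true_eq] at h1
    exact h j (List.mem_range.1 h2) h1.1 h1.2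

theorem Mem.step_miss {M : Mem} {k : ℕ} {g : Expr} {a : ℕ} {x v : Expr} {y : ℤ}
    (h : ∀ j < k, g.eval M j ≠ 0 → x.eval M j ≠ y) :
    M.step k g a x v a y = M a y := by
  simp only [Mem.step, if_true]
  cases hf : (List.range k).find? (fun i => decide (g.eval M i ≠ 0 ∧ x.eval M i = y)) with
  | none => rfl
  | some j =>
    have h1 := List.find?_some hf
    have h2 := List.mem_of_find?_eq_some hf
    simp only [decide_eq_true_eq] at h1
    exact absurd h1.2 (h j (List.mem_range.1 h2) h1.1)

/-- The priority rule enters only in the weak form that some competing write succeeds. This is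
enough for choosing a source or a parent edge, where any winner will do. -/
theorem Mem.step_cases {M : Mem} {k : ℕ} {g : Expr} {a : ℕ} {x v : Expr} {y : ℤ} :
    (∃ j < k, g.eval M j ≠ 0 ∧ x.eval M j = y ∧ M.step k g a x v a y = v.eval M j) ∨
    ((∀ j < k, g.eval M j ≠ 0 → x.eval M j ≠ y) ∧ M.step k g a x v a y = M a y) := by
  by_cases h : ∀ j < k, g.eval M j ≠ 0 → x.eval M j ≠ y
  · exact .inr ⟨h, Mem.step_miss h⟩
  · left
    simp only [Mem.step, if_true]
    cases hf : (List.range k).find? (fun i => decide (g.eval M i ≠ 0 ∧ x.eval M i = y)) with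
    | none =>
      push Not at h
      obtain ⟨j, hj, h1, h2⟩ := h
      have := List.find?_eq_none.1 hf j (List.mem_range.2 hj)
      simp [h1, h2] at this
    | some j =>
      have h1 := List.find?_some hf
      have h2 := List.mem_of_find?_eq_some hf
      simp only [decide_eq_true_eq] at h1
      exact ⟨j, List.mem_range.1 h2, h1.1, h1.2, rfl⟩

theorem Exec.frame {P : Prog} {M M' : Mem} {w t : ℕ} (h : Exec P M M' w t) :
    ∀ a ∉ P.writes, M' a = M a := by
  induction h with
  | pardo k g a x v M =>
    intro b hb
    simp only [Prog.writes, List.mem_singleton] at hb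
    exact Mem.step_ne hb
  | seq _ _ ih1 ih2 =>
    intro b hb
    simp only [Prog.writes, List.mem_append, not_or] at hb
    rw [ih2 b hb.2, ih1 b hb.1]
  | cond_true _ _ ih =>
    intro b hb
    simp only [Prog.writes, List.mem_append, not_or] at hb
    exact ih b hb.1
  | cond_false _ _ ih =>
    intro b hb
    simp only [Prog.writes, List.mem_append, not_or] at hb
    exact ih b hb.2
  | loop_done _ => intros; rfl
  | loop_step _ _ _ ih1 ih2 =>
    intro b hb
    rw [ih2 b hb, ih1 b hb]

/-- The program `P`, started in `M`, halts within time `T` in a memory that satisfies `Q`, and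
uses on the average at most `W` units of work per unit of time. -/
def Runs (W : ℕ) (P : Prog) (M : Mem) (T : ℕ) (Q : Mem → Prop) : Prop :=
  ∃ M' w t, Exec P M M' w t ∧ w ≤ W * t ∧ t ≤ T ∧ Q M'

/-- The two memories agree on all arrays outside `l`. -/
def Same (l : List ℕ) (M M' : Mem) : Prop := ∀ a ∉ l, M' a = M a

theorem Runs.mono {W : ℕ} {P : Prog} {M : Mem} {T T' : ℕ} {Q Q' : Mem → Prop}
    (h : Runs W P M T Q) (hT : T ≤ T') (hQ : ∀ M', Same P.writes M M' → Q M' → Q' M') :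
    Runs W P M T' Q' := by
  obtain ⟨M', w, t, h1, h2, h3, h4⟩ := h
  exact ⟨M', w, t, h1, h2, h3.trans hT, hQ _ h1.frame h4⟩

theorem Runs.le {W : ℕ} {P : Prog} {M : Mem} {T T' : ℕ} {Q : Mem → Prop}
    (h : Runs W P M T Q) (hT : T ≤ T') : Runs W P M T' Q :=
  h.mono hT fun _ _ h => h

/-- Since work is bounded by `W` times the time, the work bound is preserved by composition and only
the times have to be added. -/
theorem Runs.seq {W : ℕ} {P P' : Prog} {M : Mem} {T T' : ℕ} {Q Q' : Mem → Prop}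
    (h : Runs W P M T Q) (h' : ∀ M', Same P.writes M M' → Q M' → Runs W P' M' T' Q') :
    Runs W (.seq P P') M (T + T') Q' := by
  obtain ⟨M', w, t, h1, h2, h3, h4⟩ := h
  obtain ⟨M'', w', t', h1', h2', h3', h4'⟩ := h' _ h1.frame h4
  exact ⟨M'', _, _, .seq h1 h1', by nlinarith, by omega, h4'⟩

theorem Runs.loop {W : ℕ} (hW : 1 ≤ W) {c : Expr} {P : Prog} {Tb : ℕ} (I : ℕ → Mem → Prop)
    (K : ℕ) {M : Mem} (h0 : I 0 M)
    (hb : ∀ r M', Same P.writes M M' → I r M' → c.eval M' 0 ≠ 0 →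
      r < K ∧ Runs W P M' Tb (I (r + 1))) :
    Runs W (.loop c P) M (K * (Tb + 1) + 1) (fun M' => c.eval M' 0 = 0 ∧ ∃ r, I r M') := by
  -- `d` bounds the number of iterations that remain.
  have key : ∀ d r M', K ≤ r + d → Same P.writes M M' → I r M' →
      Runs W (.loop c P) M' (d * (Tb + 1) + 1) (fun M' => c.eval M' 0 = 0 ∧ ∃ r, I r M') := by
    intro d
    induction d with
    | zero =>
      intro r M' hd hs hI
      by_cases hc : c.eval M' 0 = 0
      · exact ⟨M', 1, 1, .loop_done hc, by omega, by omega, hc, r, hI⟩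
      · have := (hb r M' hs hI hc).1; omega
    | succ d ih =>
      intro r M' hd hs hI
      by_cases hc : c.eval M' 0 = 0
      · exact ⟨M', 1, 1, .loop_done hc, by omega, by omega, hc, r, hI⟩
      · obtain ⟨M1, w, t, h1, h2, h3, h4⟩ := (hb r M' hs hI hc).2
        obtain ⟨M2, w', t', h1', h2', h3', h4'⟩ := ih (r + 1) M1 (by omega)
          (fun a ha => by rw [h1.frame a ha, hs a ha]) h4
        refine ⟨M2, _, _, .loop_step hc h1 h1', by nlinarith, ?_, h4'⟩
        have : (d + 1) * (Tb + 1) = d * (Tb + 1) + Tb + 1 := by ring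
        omega
  exact key K 0 M (by omega) (fun _ _ => rfl) h0

/-! ### Elementwise assignments -/

/-- `k` entries given by `f`, and otherwise the old array. -/
def arr (k : ℕ) (f : ℕ → ℤ) (old : ℤ → ℤ) : ℤ → ℤ :=
  fun y => if 0 ≤ y ∧ y < k then f y.toNat else old y

@[simp] theorem arr_lt {k : ℕ} {f : ℕ → ℤ} {old : ℤ → ℤ} {i : ℕ} (h : i < k) :
    arr k f old (i : ℤ) = f i := by
  simp [arr, h]

@[simp] theorem arr_one_zero {f : ℕ → ℤ} {old : ℤ → ℤ} : arr 1 f old 0 = f 0 := by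
  simp [arr]

theorem arr_ge {k : ℕ} {f : ℕ → ℤ} {old : ℤ → ℤ} {i : ℕ} (h : k ≤ i) :
    arr k f old (i : ℤ) = old i := by
  simp [arr, h]

/-- The contents of cell `0` of the array `a`. -/
abbrev sc (a : ℕ) : Expr := .read a (.const 0)

/-- The cell of the array `a` that belongs to the processor. -/
abbrev rd (a : ℕ) : Expr := .read a .pid

/-- `a[i] := v(i)` for all `i < k`. -/
def pmap (k : Expr) (a : ℕ) (v : Expr) : Prog := .pardo k (.const 1) a .pid v

/-- `a[0] := v`. -/
def pset (a : ℕ) (v : Expr) : Prog := .pardo (.const 1) (.const 1) a .pid v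

/-- `a[x(i)] := v(i)` for all `i < k`. -/
def pput (k : Expr) (a : ℕ) (x v : Expr) : Prog := .pardo k (.const 1) a x v

theorem Mem.step_pid (M : Mem) (k : ℕ) (a : ℕ) (v : Expr) :
    M.step k (.const 1) a .pid v = Function.update M a (arr k (fun i => v.eval M i) (M a)) := by
  rw [Mem.step_eq_update]
  congr 1
  funext y
  by_cases h : 0 ≤ y ∧ y < k
  · lift y to ℕ using h.1
    rw [arr_lt (by omega)]
    exact Mem.step_hit (i := y) (by omega) (by simp [Expr.eval]) (by simp [Expr.eval])
      (fun j _ _ h => by simp only [Expr.eval] at h; norm_cast at h; rw [h])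
  · rw [Mem.step_miss, arr, if_neg h]
    intro j hj _ h'
    simp only [Expr.eval] at h'
    omega

theorem Runs.pardo {W : ℕ} {k g : Expr} {a : ℕ} {x v : Expr} {M : Mem} {Q : Mem → Prop} (K : ℕ)
    (hk : k.eval M 0 = K) (hW : K + 1 ≤ W)
    (hQ : Q (Function.update M a (M.step K g a x v a))) :
    Runs W (.pardo k g a x v) M 1 Q := by
  refine ⟨_, _, _, .pardo k g a x v M, ?_, le_rfl, ?_⟩
  · rw [hk]; simpa using hW
  · rw [Mem.step_eq_update, hk]; exact hQ

theorem Runs.pput {W : ℕ} {k : Expr} {a : ℕ} {x v : Expr} {M : Mem} {Q : Mem → Prop} (K : ℕ)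
    (hk : k.eval M 0 = K) (hW : K + 1 ≤ W)
    (hQ : Q (Function.update M a (M.step K (.const 1) a x v a))) :
    Runs W (pput k a x v) M 1 Q := Runs.pardo K hk hW hQ

theorem Runs.pmap {W : ℕ} {k : Expr} {a : ℕ} {v : Expr} {M : Mem} {Q : Mem → Prop} (K : ℕ)
    (hk : k.eval M 0 = K) (hW : K + 1 ≤ W)
    (hQ : Q (Function.update M a (arr K (fun i => v.eval M i) (M a)))) :
    Runs W (pmap k a v) M 1 Q := by
  refine Runs.pardo K hk hW ?_
  rw [← Mem.step_eq_update, Mem.step_pid]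
  exact hQ

theorem Runs.pset {W : ℕ} {a : ℕ} {v : Expr} {M : Mem} {Q : Mem → Prop} (hW : 2 ≤ W)
    (hQ : Q (Function.update M a (arr 1 (fun i => v.eval M i) (M a)))) :
    Runs W (pset a v) M 1 Q :=
  Runs.pmap 1 rfl hW hQ

theorem Runs.pput_seq {W : ℕ} {k : Expr} {a : ℕ} {x v : Expr} {M : Mem} {P : Prog} {T : ℕ}
    {Q : Mem → Prop} (K : ℕ) (hk : k.eval M 0 = K) (hW : K + 1 ≤ W)
    (hQ : Runs W P (Function.update M a (M.step K (.const 1) a x v a)) T Q) :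
    Runs W (.seq (PRAM.pput k a x v) P) M (1 + T) Q :=
  (Runs.pput (Q := fun M' => M' = _) K hk hW rfl).seq fun _ _ h => by rw [h]; exact hQ

theorem Runs.pmap_seq {W : ℕ} {k : Expr} {a : ℕ} {v : Expr} {M : Mem} {P : Prog} {T : ℕ}
    {Q : Mem → Prop} (K : ℕ) (hk : k.eval M 0 = K) (hW : K + 1 ≤ W)
    (hQ : Runs W P (Function.update M a (arr K (fun i => v.eval M i) (M a))) T Q) :
    Runs W (.seq (PRAM.pmap k a v) P) M (1 + T) Q :=
  (Runs.pmap (Q := fun M' => M' = _) K hk hW rfl).seq fun _ _ h => by rw [h]; exact hQ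

theorem Runs.pset_seq {W : ℕ} {a : ℕ} {v : Expr} {M : Mem} {P : Prog} {T : ℕ}
    {Q : Mem → Prop} (hW : 2 ≤ W)
    (hQ : Runs W P (Function.update M a (arr 1 (fun i => v.eval M i) (M a))) T Q) :
    Runs W (.seq (PRAM.pset a v) P) M (1 + T) Q :=
  Runs.pmap_seq 1 rfl hW hQ

/-- Repeat `P` as often as `e` can be halved until one is reached; the array `a` holds the
counter. -/
def pfor (a : ℕ) (e : Expr) (P : Prog) : Prog :=
  .seq (pset a e) (.loop (.sub (sc a) (.const 1)) (.seq P (pset a (.half (sc a)))))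

/-- The invariant is required for every content of the counter array, because the counter is set or
halved between the moments at which the invariant is used. -/
theorem Runs.pfor {W : ℕ} (hW : 2 ≤ W) {a : ℕ} {e : Expr} {P : Prog} {M : Mem} {Tb : ℕ} {K : ℕ}
    (hK : e.eval M 0 = 2 ^ K) (ha : a ∉ P.writes) (I : ℕ → Mem → Prop)
    (h0 : ∀ z, I 0 (Function.update M a z))
    (hb : ∀ r < K, ∀ M', Same (a :: P.writes) M M' → I r M' →
      Runs W P M' Tb (fun M'' => ∀ z, I (r + 1) (Function.update M'' a z))) :
    Runs W (pfor a e P) M (K * (Tb + 2) + 2) (I K) := by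
  have hpos : ∀ k : ℕ, (2 : ℤ) ^ (k + 1) / 2 = 2 ^ k := fun k => by rw [pow_succ]; simp
  have h1 : ∀ k : ℕ, (2 : ℤ) ^ k - 1 = 0 → k = 0 := by
    intro k hk
    by_contra h
    have : (2 : ℤ) ^ 1 ≤ 2 ^ k := pow_le_pow_right₀ (by norm_num) (by omega)
    omega
  refine Runs.le (T := 1 + (K * ((Tb + 1) + 1) + 1)) ?_ (by ring_nf; omega)
  refine Runs.pset_seq hW ?_
  refine (Runs.loop (by omega) (fun r M' => r ≤ K ∧ M' a 0 = 2 ^ (K - r) ∧ I r M') K ?_ ?_).mono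
    le_rfl ?_
  · refine ⟨by omega, ?_, h0 _⟩
    simp [hK]
  · rintro r M' hs ⟨hr, ha0, hI⟩ hc
    have hrK : r < K := by
      rcases Nat.lt_or_ge r K with h | h
      · exact h
      · exfalso; apply hc
        have : K - r = 0 := by omega
        simp [Expr.eval, ha0, this]
    refine ⟨hrK, ?_⟩
    have hs' : Same (a :: P.writes) M M' := by
      intro b hb'
      simp only [List.mem_cons, not_or] at hb'
      rw [hs b, Function.update_of_ne hb'.1]
      simp only [Prog.writes, PRAM.pset, List.mem_append, List.mem_singleton, not_or]
      exact ⟨hb'.2, hb'.1⟩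
    refine (hb r hrK M' hs' hI).seq fun M1 hs1 hI1 => ?_
    refine Runs.pset hW ⟨by omega, ?_, hI1 _⟩
    have : M1 a 0 = 2 ^ (K - r) := by rw [hs1 a ha, ha0]
    obtain ⟨d, hd⟩ : ∃ d, K - r = d + 1 := ⟨K - r - 1, by omega⟩
    have hd' : K - (r + 1) = d := by omega
    simp [Expr.eval, this, hd, hd', hpos]
  · rintro M' - ⟨hc, r, hr, ha0, hI⟩
    simp only [Expr.eval, ha0] at hc
    have := h1 _ hc
    have : r = K := by omega
    exact this ▸ hI

end PRAM

namespace PRAM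

/-! ### Grouped reductions in segment trees

For every key there is a binary tree over the indices below `2 ^ T`, in heap order; the node `c` of
the tree for the key `k` is stored at the address `k * (2 * 2 ^ T) + c`. -/

section TreeCombinatorics

variable (T : ℕ) (key : ℕ → ℕ)

/-- The indices with key `k` below the node `c`, which is on level `t`. -/
def nodeSet (t k c : ℕ) : Finset ℕ :=
  (Finset.range (2 ^ T)).filter fun j => key j = k ∧ (2 ^ T + j) / 2 ^ t = c

/-- The reduction over the indices with key `k` below the node `c` on level `t`. -/
def node (f : ℤ → ℤ → ℤ) [Std.Commutative f] [Std.Associative f] (z : ℤ) (val : ℕ → ℤ)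
    (t k c : ℕ) : ℤ :=
  (nodeSet T key t k c).fold f z val

/-- The indices before `i` with the same key. -/
def preSet (i : ℕ) : Finset ℕ := (Finset.range i).filter fun j => key j = key i

/-- The indices with key `k`. -/
def keySet (k : ℕ) : Finset ℕ := (Finset.range (2 ^ T)).filter fun j => key j = k

/-- The nodes whose parent has an index with key `k` below it. -/
def Relevant (t k c : ℕ) : Prop :=
  t = T ∨ ∃ j < 2 ^ T, key j = k ∧ (2 ^ T + j) / 2 ^ (t + 1) = c / 2

variable {T key}

theorem nodeSet_succ (t k c : ℕ) :
    nodeSet T key (t + 1) k c = nodeSet T key t k (2 * c) ∪ nodeSet T key t k (2 * c + 1) := by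
  ext j
  simp only [nodeSet, Finset.mem_filter, Finset.mem_union, pow_succ, ← Nat.div_div_eq_div_mul]
  have : (2 ^ T + j) / 2 ^ t / 2 = c ↔
    (2 ^ T + j) / 2 ^ t = 2 * c ∨ (2 ^ T + j) / 2 ^ t = 2 * c + 1 := by omega
  rw [this]; tauto

theorem nodeSet_disjoint (t k c : ℕ) :
    Disjoint (nodeSet T key t k (2 * c)) (nodeSet T key t k (2 * c + 1)) := by
  rw [Finset.disjoint_left]
  intro j h1 h2
  simp only [nodeSet, Finset.mem_filter] at h1 h2
  omega

/-- A fold contains its initial value once, so joining two folds produces `f z z`. Hence idempotence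
at `z` suffices; `z` need not be neutral, which matters for minima capped by a bound. -/
theorem node_succ (f : ℤ → ℤ → ℤ) [Std.Commutative f] [Std.Associative f] {z : ℤ} (hz : f z z = z)
    (val : ℕ → ℤ) (t k c : ℕ) :
    node T key f z val (t + 1) k c =
      f (node T key f z val t k (2 * c)) (node T key f z val t k (2 * c + 1)) := by
  simp only [node]
  rw [nodeSet_succ, ← Finset.disjUnion_eq_union _ _ (nodeSet_disjoint t k c)]
  conv_lhs => rw [← hz]
  exact Finset.fold_disjUnion _

theorem level_lt {i : ℕ} (hi : i < 2 ^ T) {t : ℕ} (ht : t ≤ T) :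
    2 ^ (T - t) ≤ (2 ^ T + i) / 2 ^ t ∧ (2 ^ T + i) / 2 ^ t < 2 ^ (T - t + 1) := by
  have h : 2 ^ T = 2 ^ (T - t) * 2 ^ t := by rw [← pow_add]; congr 1; omega
  constructor
  · rw [Nat.le_div_iff_mul_le (by positivity), ← h]; omega
  · rw [Nat.div_lt_iff_lt_mul (by positivity), pow_succ]
    nlinarith

/-- In heap order the level of a node is read off from its leading bit: the ranges of different
levels are disjoint. -/
theorem level_unique {t t' c : ℕ} (ht : t ≤ T) (ht' : t' ≤ T) (h1 : 2 ^ (T - t) ≤ c)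
    (h2 : c < 2 ^ (T - t + 1)) (h1' : 2 ^ (T - t') ≤ c) (h2' : c < 2 ^ (T - t' + 1)) : t = t' := by
  have a := (Nat.pow_lt_pow_iff_right (a := 2) (by norm_num)).1 (h1.trans_lt h2')
  have b := (Nat.pow_lt_pow_iff_right (a := 2) (by norm_num)).1 (h1'.trans_lt h2)
  omega

theorem level_bound {t c : ℕ} (h2 : c < 2 ^ (T - t + 1)) : c < 2 * 2 ^ T := by
  refine h2.trans_le ?_
  rw [pow_succ, mul_comm]
  exact Nat.mul_le_mul_left _ (Nat.pow_le_pow_right (by norm_num) (by omega))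

theorem nodeSet_root (k : ℕ) : nodeSet T key T k 1 = keySet T key k := by
  ext j
  simp only [nodeSet, keySet, Finset.mem_filter, Finset.mem_range, and_congr_right_iff]
  intro hj
  have := level_lt hj (le_refl T)
  rw [Nat.sub_self, pow_zero, zero_add, pow_one] at this
  constructor
  · exact fun h => h.1
  · intro h; exact ⟨h, by omega⟩

theorem addr_inj {N k k' c c' : ℕ} (hc : c < 2 * N) (hc' : c' < 2 * N)
    (h : (k : ℤ) * (2 * N) + c = k' * (2 * N) + c') : k = k' ∧ c = c' := by
  have h' : k * (2 * N) + c = k' * (2 * N) + c' := by exact_mod_cast h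
  have h1 := congrArg (· / (2 * N)) h'
  have h2 := congrArg (· % (2 * N)) h'
  have hN : 0 < 2 * N := by omega
  simp only [mul_comm _ (2 * N), Nat.mul_add_div hN, Nat.div_eq_of_lt hc, Nat.div_eq_of_lt hc',
    Nat.mul_add_mod, Nat.mod_eq_of_lt hc, Nat.mod_eq_of_lt hc'] at h1 h2
  exact ⟨by omega, h2⟩

end TreeCombinatorics

/-- Number of vertices and of edge slots, a power of two. -/
abbrev aN : ℕ := 6
/-- Addresses of the trees. -/
abbrev aVB : ℕ := 7
/-- Counter of the loops over the levels of trees. -/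
abbrev aLV : ℕ := 8
/-- Address of the tree for the key. -/
abbrev aKB : ℕ := 9
/-- Current node. -/
abbrev aH : ℕ := 10
/-- Trees. -/
abbrev aT : ℕ := 11
/-- Reductions over the preceding indices with the same key. -/
abbrev aPRE : ℕ := 12
/-- Keys. -/
abbrev aTK : ℕ := 13
/-- Values. -/
abbrev aTV : ℕ := 14
/-- Neutral element. -/
abbrev aNE : ℕ := 15

/-- Twice the value of an expression. -/
abbrev dbl (x : Expr) : Expr := .add x x

/-- Fill the relevant nodes of the trees with the neutral element. -/
def treeClear : Prog :=
  .seq (pmap (sc aN) aKB (.read aVB (rd aTK))) <|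
  .seq (pput (dbl (sc aN)) aT (.add (rd aVB) (.const 1)) (sc aNE)) <|
  .seq (pmap (sc aN) aH (.add (sc aN) .pid)) <|
  pfor aLV (sc aN) <|
    .seq (pmap (sc aN) aH (.half (rd aH))) <|
    .seq (pput (sc aN) aT (.add (rd aKB) (dbl (rd aH))) (sc aNE)) <|
    pput (sc aN) aT (.add (rd aKB) (.add (dbl (rd aH)) (.const 1))) (sc aNE)

/-- Compute the trees and the reductions over the preceding indices. -/
def treeUp (op : Expr → Expr → Expr) : Prog :=
  .seq (pmap (sc aN) aH (.add (sc aN) .pid)) <|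
  .seq (pput (sc aN) aT (.add (rd aKB) (rd aH)) (op (rd aTV) (sc aNE))) <|
  .seq (pmap (sc aN) aPRE (sc aNE)) <|
  pfor aLV (sc aN) <|
    .seq (pmap (sc aN) aPRE (.ifLE (.const 1) (.sub (rd aH) (dbl (.half (rd aH))))
      (op (rd aPRE) (.read aT (.add (rd aKB) (.sub (rd aH) (.const 1))))) (rd aPRE))) <|
    .seq (pmap (sc aN) aH (.half (rd aH))) <|
    pput (sc aN) aT (.add (rd aKB) (rd aH))
      (op (.read aT (.add (rd aKB) (dbl (rd aH))))
        (.read aT (.add (rd aKB) (.add (dbl (rd aH)) (.const 1)))))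

/-- Grouped reduction. -/
def tree (op : Expr → Expr → Expr) : Prog := .seq treeClear (treeUp op)

/-- The size and the addresses of the trees have been set up. -/
structure Base (T : ℕ) (M : Mem) : Prop where
  size : M aN 0 = 2 ^ T
  addr : ∀ i < 2 * 2 ^ T, M aVB (i : ℕ) = (i : ℤ) * (2 * 2 ^ T)

theorem Base.mono {T : ℕ} {M M' : Mem} (h : Base T M) (h1 : M' aN = M aN) (h2 : M' aVB = M aVB) :
    Base T M' :=
  ⟨by rw [h1]; exact h.size, by rw [h2]; exact h.addr⟩

theorem two_pow_succ_le {W T : ℕ} (hW : 2 * 2 ^ T + 1 ≤ W) : 2 ^ T + 1 ≤ W ∧ 2 ≤ W :=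
  ⟨by omega, by have := Nat.one_le_two_pow (n := T); omega⟩

/-- The trees contain remnants of earlier reductions, and clearing them completely would take
quadratic work. Only roots and children of nonempty nodes are ever read, so each processor clears
both children of its own ancestor on every level. -/
theorem treeClear_runs {W T : ℕ} (hW : 2 * 2 ^ T + 1 ≤ W) {M : Mem} (hB : Base T M)
    {key : ℕ → ℕ} (hk : ∀ i < 2 ^ T, M aTK (i : ℕ) = key i) (hk' : ∀ i < 2 ^ T, key i < 2 * 2 ^ T)
    {z : ℤ} (hz : M aNE 0 = z) :
    Runs W treeClear M (5 * T + 5) fun M' =>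
      (∀ i < 2 ^ T, M' aKB (i : ℕ) = (key i : ℤ) * (2 * 2 ^ T)) ∧
      ∀ t ≤ T, ∀ k < 2 * 2 ^ T, ∀ c, 2 ^ (T - t) ≤ c → c < 2 ^ (T - t + 1) →
        Relevant T key t k c → M' aT ((k : ℤ) * (2 * 2 ^ T) + c) = z := by
  obtain ⟨hW1, hW2⟩ := two_pow_succ_le hW
  refine Runs.le (T := 1 + (1 + (1 + (T * (3 + 2) + 2)))) ?_ (by ring_nf; omega)
  refine Runs.pmap_seq (2 ^ T) (by simp [Expr.eval, hB.size]) hW1 ?_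
  -- All roots are cleared, also those of empty groups, whose totals may be queried.
  refine Runs.pput_seq (2 * 2 ^ T) (by simp [Expr.eval, hB.size, two_mul]) hW ?_
  refine Runs.pmap_seq (2 ^ T) (by simp [Expr.eval, hB.size]) hW1 ?_
  set M1 := Function.update (Function.update M aKB _) aT _ with hM1
  have hKB1 : ∀ i < 2 ^ T, M1 aKB (i : ℕ) = (key i : ℤ) * (2 * 2 ^ T) := by
    intro i hi
    simp [hM1, Function.update_of_ne, Expr.eval, hi, hk i hi, hB.addr _ (hk' i hi)]
  have hroot : ∀ k : ℕ, k < 2 * 2 ^ T → M1 aT ((k : ℤ) * (2 * 2 ^ T) + 1) = z := by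
    intro k hk
    simp only [hM1, Function.update_self]
    refine Mem.step_hit (i := k) hk (by simp [Expr.eval]) ?_ ?_
    · simp [Expr.eval, hB.addr k hk]
    · intros; simp [Expr.eval, hz]
  have hN1 : M1 aN 0 = 2 ^ T := by simp [hM1, hB.size]
  have hz1 : M1 aNE 0 = z := by simp [hM1, hz]
  clear_value M1
  refine (Runs.pfor hW2 (K := T)
    (I := fun r M' => (∀ i < 2 ^ T, M' aH (i : ℕ) = ((2 ^ T + i : ℕ) : ℤ) / 2 ^ r) ∧
      ∀ t ≤ T, t < r ∨ t = T → ∀ k < 2 * 2 ^ T, ∀ c, 2 ^ (T - t) ≤ c → c < 2 ^ (T - t + 1) →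
        Relevant T key t k c → M' aT ((k : ℤ) * (2 * 2 ^ T) + c) = z)
    (by simp [Expr.eval, hN1]) (by decide) ?_ ?_).mono le_rfl ?_
  · intro y
    constructor
    · intro i hi
      simp [Expr.eval, hi, hN1]
    · intro t ht htT k hk c hc1 hc2 _
      obtain rfl : t = T := by omega
      obtain rfl : c = 1 := by simp at hc1 hc2; omega
      simpa using hroot k hk
  · intro r hr M' hs ⟨hH, hT⟩
    have hN' : M' aN 0 = 2 ^ T := by rw [hs aN (by decide)]; simp [hN1]
    have hz' : M' aNE 0 = z := by rw [hs aNE (by decide)]; simp [hz1]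
    have hKB' : ∀ i < 2 ^ T, M' aKB (i : ℕ) = (key i : ℤ) * (2 * 2 ^ T) := by
      rw [hs aKB (by decide)]; simpa using hKB1
    refine Runs.le (T := 1 + (1 + 1)) ?_ le_rfl
    refine Runs.pmap_seq (2 ^ T) (by simp [Expr.eval, hN']) hW1 ?_
    set M2 := Function.update M' aH _ with hM2
    have hH2 : ∀ i < 2 ^ T, M2 aH (i : ℕ) = ((2 ^ T + i : ℕ) : ℤ) / 2 ^ (r + 1) := by
      intro i hi
      have h2 := hH i hi
      simp only [hM2, Function.update_self, arr_lt hi, Expr.eval, h2]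
      rw [pow_succ, Int.ediv_ediv_of_nonneg (by positivity)]
    have hN2 : M2 aN 0 = 2 ^ T := by simp [hM2, hN']
    have hz2 : M2 aNE 0 = z := by simp [hM2, hz']
    have hKB2 : ∀ i < 2 ^ T, M2 aKB (i : ℕ) = (key i : ℤ) * (2 * 2 ^ T) := by
      simpa [hM2] using hKB'
    have hT2 : M2 aT = M' aT := by simp [hM2]
    clear_value M2
    refine Runs.pput_seq (2 ^ T) (by simp [Expr.eval, hN2]) hW1 ?_
    refine Runs.pput (2 ^ T) (by simp [Expr.eval, hN2]) hW1 ?_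
    intro y
    refine ⟨by simpa using hH2, ?_⟩
    intro t ht htr k hk c hc1 hc2 hrel
    rw [Function.update_of_ne (by decide), Function.update_self]
    rcases Mem.step_cases (M := Function.update M2 aT (Mem.step M2 (2 ^ T) (.const 1) aT
      (.add (rd aKB) (dbl (rd aH))) (sc aNE) aT)) (k := 2 ^ T) (g := .const 1) (a := aT)
      (x := .add (rd aKB) (.add (dbl (rd aH)) (.const 1))) (v := sc aNE)
      (y := (k : ℤ) * (2 * 2 ^ T) + c) with ⟨j, hj, -, -, h⟩ | ⟨hmiss, h⟩
    · rw [h]; simp [Expr.eval, hz2]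
    rw [h, Function.update_self]
    rcases Mem.step_cases (M := M2) (k := 2 ^ T) (g := .const 1) (a := aT)
      (x := .add (rd aKB) (dbl (rd aH))) (v := sc aNE)
      (y := (k : ℤ) * (2 * 2 ^ T) + c) with ⟨j, hj, -, -, h⟩ | ⟨hmiss', h⟩
    · rw [h]; simp [Expr.eval, hz2]
    rw [h, hT2]
    by_cases htr' : t < r ∨ t = T
    · exact hT t ht htr' k hk c hc1 hc2 hrel
    -- The remaining case is `t = r`. The index that witnesses relevance has a processor that has
    -- just written to both children of `c / 2`, and `c` is one of them.
    exfalso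
    obtain rfl : t = r := by omega
    rcases hrel with h | ⟨j, hj, hkj, hcj⟩
    · omega
    have e := hH2 j hj
    have e' : M2 aH (j : ℕ) = ((c / 2 : ℕ) : ℤ) := by
      rw [e, ← hcj]; push_cast; rfl
    have hm := hmiss j hj (by simp [Expr.eval])
    have hm' := hmiss' j hj (by simp [Expr.eval])
    simp only [Expr.eval, hKB2 j hj, e', hkj, Function.update_of_ne (show aKB ≠ aT by decide),
      Function.update_of_ne (show aH ≠ aT by decide)] at hm hm'
    have h3 : ((c / 2 : ℕ) : ℤ) + (c / 2 : ℕ) ≠ c := fun h => hm' (by rw [h])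
    have h4 : ((c / 2 : ℕ) : ℤ) + (c / 2 : ℕ) + 1 ≠ c := fun h => hm (by rw [h])
    omega
  · intro M' hs ⟨_, h⟩
    refine ⟨?_, fun t ht => h t ht (by omega)⟩
    rw [hs aKB (by decide)]; simpa using hKB1

end PRAM

/-! ### Climbing the trees: group totals and prefix reductions. -/

namespace PRAM

section TreeCombinatorics

variable {T : ℕ} {key : ℕ → ℕ}

/-- The indices before `i` with the same key and the same ancestor on level `t`. -/
def preNode (T : ℕ) (key : ℕ → ℕ) (t i : ℕ) : Finset ℕ :=
  (Finset.range i).filter fun j => key j = key i ∧ (2 ^ T + j) / 2 ^ t = (2 ^ T + i) / 2 ^ t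

theorem preNode_zero (i : ℕ) : preNode T key 0 i = ∅ := by
  ext j; simp [preNode]; omega

theorem preNode_top {i : ℕ} (hi : i < 2 ^ T) : preNode T key T i = preSet key i := by
  ext j
  simp only [preNode, preSet, Finset.mem_filter, Finset.mem_range, and_congr_right_iff]
  intro hj
  have h1 := level_lt hi (le_refl T)
  have h2 := level_lt (hj.trans hi) (le_refl T)
  rw [Nat.sub_self, pow_zero, zero_add, pow_one] at h1 h2
  constructor
  · exact fun h => h.1
  · exact fun h => ⟨h, by omega⟩

theorem preNode_even {t i : ℕ} (h : (2 ^ T + i) / 2 ^ t % 2 = 0) :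
    preNode T key (t + 1) i = preNode T key t i := by
  ext j
  simp only [preNode, Finset.mem_filter, Finset.mem_range, pow_succ, ← Nat.div_div_eq_div_mul]
  constructor
  · rintro ⟨h1, h2, h3⟩
    have := Nat.div_le_div_right (c := 2 ^ t) (show 2 ^ T + j ≤ 2 ^ T + i by omega)
    exact ⟨h1, h2, by omega⟩
  · rintro ⟨h1, h2, h3⟩
    exact ⟨h1, h2, by omega⟩

/-- Passing from a right child to its parent adds exactly the indices below the left sibling, all of
which precede `i`. From a left child nothing is added, since the sibling lies to the right. -/
theorem preNode_odd {t i : ℕ} (hi : i < 2 ^ T) (h : (2 ^ T + i) / 2 ^ t % 2 = 1) :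
    preNode T key (t + 1) i =
      preNode T key t i ∪ nodeSet T key t (key i) ((2 ^ T + i) / 2 ^ t - 1) := by
  ext j
  simp only [preNode, nodeSet, Finset.mem_filter, Finset.mem_range, Finset.mem_union, pow_succ,
    ← Nat.div_div_eq_div_mul]
  constructor
  · rintro ⟨h1, h2, h3⟩
    have := Nat.div_le_div_right (c := 2 ^ t) (show 2 ^ T + j ≤ 2 ^ T + i by omega)
    rcases Nat.eq_or_lt_of_le this with h4 | h4
    · exact .inl ⟨h1, h2, h4⟩
    · refine .inr ⟨by omega, h2, ?_⟩
      generalize (2 ^ T + i) / 2 ^ t = x at *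
      generalize (2 ^ T + j) / 2 ^ t = y at *
      omega
  · have := @Nat.div_le_div_right (2 ^ T + i) (2 ^ T + j) (2 ^ t)
    have hji : ¬ j < i → 2 ^ T + i ≤ 2 ^ T + j := by omega
    generalize (2 ^ T + i) / 2 ^ t = x at *
    generalize (2 ^ T + j) / 2 ^ t = y at *
    rintro (⟨h1, h2, h3⟩ | ⟨h1, h2, h3⟩)
    · exact ⟨h1, h2, by omega⟩
    · refine ⟨?_, h2, by omega⟩
      by_contra hc
      have := this (hji hc)
      omega

theorem preNode_disjoint {t i : ℕ} (h : (2 ^ T + i) / 2 ^ t % 2 = 1) :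
    Disjoint (preNode T key t i) (nodeSet T key t (key i) ((2 ^ T + i) / 2 ^ t - 1)) := by
  rw [Finset.disjoint_left]
  intro j h1 h2
  simp only [preNode, nodeSet, Finset.mem_filter] at h1 h2
  omega

theorem nodeSet_leaf {i : ℕ} (hi : i < 2 ^ T) : nodeSet T key 0 (key i) (2 ^ T + i) = {i} := by
  ext j
  simp only [nodeSet, Finset.mem_filter, Finset.mem_range, Finset.mem_singleton, pow_zero,
    Nat.div_one]
  constructor
  · omega
  · rintro rfl; exact ⟨hi, rfl, rfl⟩

end TreeCombinatorics

/-- The result of a grouped reduction. -/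
structure Forest (T : ℕ) (key : ℕ → ℕ) (f : ℤ → ℤ → ℤ) [Std.Commutative f] [Std.Associative f]
    (z : ℤ) (val : ℕ → ℤ) (M : Mem) : Prop where
  nodes : ∀ t ≤ T, ∀ k < 2 * 2 ^ T, ∀ c, 2 ^ (T - t) ≤ c → c < 2 ^ (T - t + 1) →
    Relevant T key t k c → M aT ((k : ℤ) * (2 * 2 ^ T) + c) = node T key f z val t k c
  pre : ∀ i < 2 ^ T, M aPRE (i : ℕ) = (preSet key i).fold f z val

theorem Forest.root {T : ℕ} {key : ℕ → ℕ} {f : ℤ → ℤ → ℤ} [Std.Commutative f] [Std.Associative f]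
    {z : ℤ} {val : ℕ → ℤ} {M : Mem} (h : Forest T key f z val M) {k : ℕ} (hk : k < 2 * 2 ^ T) :
    M aT ((k : ℤ) * (2 * 2 ^ T) + 1) = (keySet T key k).fold f z val := by
  have := h.nodes T le_rfl k hk 1 (by simp) (by simp) (.inl rfl)
  rw [← nodeSet_root]
  exact_mod_cast this

/-- Processors with the same key and the same ancestor write the same value, so concurrent writes do
not conflict. A relevant node that no processor reaches has no index below it, and the cleared value
`z` is already the fold over the empty set. -/
theorem treeUp_runs {W T : ℕ} (hW : 2 * 2 ^ T + 1 ≤ W) {M : Mem} (hB : Base T M)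
    {key : ℕ → ℕ} (hk' : ∀ i < 2 ^ T, key i < 2 * 2 ^ T)
    {f : ℤ → ℤ → ℤ} [Std.Commutative f] [Std.Associative f]
    {z : ℤ} (hf : f z z = z) (hz : M aNE 0 = z) {val : ℕ → ℤ}
    (hv : ∀ i < 2 ^ T, M aTV (i : ℕ) = val i)
    {op : Expr → Expr → Expr}
    (hop : ∀ M i x y, (op x y).eval M i = f (x.eval M i) (y.eval M i))
    (hKB : ∀ i < 2 ^ T, M aKB (i : ℕ) = (key i : ℤ) * (2 * 2 ^ T))
    (hC : ∀ t ≤ T, ∀ k < 2 * 2 ^ T, ∀ c, 2 ^ (T - t) ≤ c → c < 2 ^ (T - t + 1) →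
        Relevant T key t k c → M aT ((k : ℤ) * (2 * 2 ^ T) + c) = z) :
    Runs W (treeUp op) M (5 * T + 5) (Forest T key f z val) := by
  obtain ⟨hW1, hW2⟩ := two_pow_succ_le hW
  refine Runs.le (T := 1 + (1 + (1 + (T * (3 + 2) + 2)))) ?_ (by ring_nf; omega)
  refine Runs.pmap_seq (2 ^ T) (by simp [Expr.eval, hB.size]) hW1 ?_
  set M0 := Function.update M aH _ with hM0
  have hH0 : ∀ i < 2 ^ T, M0 aH (i : ℕ) = ((2 ^ T + i : ℕ) : ℤ) := by
    intro i hi; simp [hM0, hi, Expr.eval, hB.size]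
  have hN0 : M0 aN 0 = 2 ^ T := by simp [hM0, hB.size]
  have hz0 : M0 aNE 0 = z := by simp [hM0, hz]
  have hKB0 : ∀ i < 2 ^ T, M0 aKB (i : ℕ) = (key i : ℤ) * (2 * 2 ^ T) := by simpa [hM0] using hKB
  have hv0 : ∀ i < 2 ^ T, M0 aTV (i : ℕ) = val i := by simpa [hM0] using hv
  have hT0 : M0 aT = M aT := by simp [hM0]
  clear_value M0
  refine Runs.pput_seq (2 ^ T) (by simp [Expr.eval, hN0]) hW1 ?_
  refine Runs.pmap_seq (2 ^ T) (by simp [Expr.eval, hN0]) hW1 ?_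
  set M1 := Function.update (Function.update M0 aT _) aPRE _ with hM1
  have hH1 : ∀ i < 2 ^ T, M1 aH (i : ℕ) = ((2 ^ T + i : ℕ) : ℤ) := by simpa [hM1] using hH0
  have hN1 : M1 aN 0 = 2 ^ T := by simp [hM1, hN0]
  have hz1 : M1 aNE 0 = z := by simp [hM1, hz0]
  have hKB1 : ∀ i < 2 ^ T, M1 aKB (i : ℕ) = (key i : ℤ) * (2 * 2 ^ T) := by simpa [hM1] using hKB0
  have hP1 : ∀ i < 2 ^ T, M1 aPRE (i : ℕ) = z := by
    intro i hi; simp [hM1, hi, Expr.eval, hz0]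
  have hT1 : ∀ t ≤ T, ∀ k < 2 * 2 ^ T, ∀ c, 2 ^ (T - t) ≤ c → c < 2 ^ (T - t + 1) →
      Relevant T key t k c → M1 aT ((k : ℤ) * (2 * 2 ^ T) + c) =
        if t ≤ 0 then node T key f z val t k c else z := by
    intro t ht k hk c hc1 hc2 hrel
    rw [hM1, Function.update_of_ne (by decide), Function.update_self]
    rcases Mem.step_cases (M := M0) (k := 2 ^ T) (g := .const 1) (a := aT)
      (x := .add (rd aKB) (rd aH)) (v := op (rd aTV) (sc aNE))
      (y := (k : ℤ) * (2 * 2 ^ T) + c) with ⟨j, hj, -, hx, h⟩ | ⟨hmiss, h⟩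
    · simp only [Expr.eval, hKB0 j hj, hH0 j hj] at hx
      obtain ⟨rfl, rfl⟩ := addr_inj (N := 2 ^ T) (k := key j) (k' := k) (c := 2 ^ T + j)
        (by omega) (level_bound hc2) (by push_cast at hx ⊢; exact hx)
      obtain rfl : 0 = t := level_unique (by omega) ht (c := 2 ^ T + j) (by simp)
        (by rw [Nat.sub_zero, pow_succ]; omega) hc1 hc2
      rw [h, if_pos le_rfl, hop]
      simp only [node, nodeSet_leaf hj, Finset.fold_singleton, Expr.eval, hv0 j hj, hz0]
    · rw [h, hT0, hC t ht k hk c hc1 hc2 hrel]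
      split_ifs with ht0
      · obtain rfl : t = 0 := by omega
        have : nodeSet T key 0 k c = ∅ := by
          rw [nodeSet, Finset.filter_eq_empty_iff]
          rintro j hj ⟨hj1, hj2⟩
          rw [Finset.mem_range] at hj
          apply hmiss j hj (by simp [Expr.eval])
          simp only [Expr.eval, hKB0 j hj, hH0 j hj, hj1]
          simp at hj2
          rw [← hj2]
        rw [node, this, Finset.fold_empty]
      · rfl
  clear_value M1
  refine (Runs.pfor hW2 (K := T)
    (I := fun r M' => (∀ i < 2 ^ T, M' aH (i : ℕ) = ((2 ^ T + i : ℕ) : ℤ) / 2 ^ r) ∧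
      (∀ i < 2 ^ T, M' aPRE (i : ℕ) = (preNode T key r i).fold f z val) ∧
      ∀ t ≤ T, ∀ k < 2 * 2 ^ T, ∀ c, 2 ^ (T - t) ≤ c → c < 2 ^ (T - t + 1) →
        Relevant T key t k c → M' aT ((k : ℤ) * (2 * 2 ^ T) + c) =
          if t ≤ r then node T key f z val t k c else z)
    (by simp [Expr.eval, hN1]) (by simp [Prog.writes, pmap, pput]) ?_ ?_).mono le_rfl ?_
  · intro y
    refine ⟨by simpa using hH1, ?_, by simpa using hT1⟩
    intro i hi
    simp [preNode_zero, hP1 i hi]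
  · intro r hr M' hs ⟨hH, hP, hT⟩
    have hN' : M' aN 0 = 2 ^ T := by
      rw [hs aN (by simp [Prog.writes, pmap, pput])]; simp [hN1]
    have hKB' : ∀ i < 2 ^ T, M' aKB (i : ℕ) = (key i : ℤ) * (2 * 2 ^ T) := by
      rw [hs aKB (by simp [Prog.writes, pmap, pput])]; simpa using hKB1
    refine Runs.le (T := 1 + (1 + 1)) ?_ le_rfl
    -- The prefix is updated before the processor moves up: at an odd node the preceding address is
    -- the left sibling on level `r`, which is already complete.
    refine Runs.pmap_seq (2 ^ T) (by simp [Expr.eval, hN']) hW1 ?_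
    refine Runs.pmap_seq (2 ^ T) (by simp [Expr.eval, hN']) hW1 ?_
    set M2 := Function.update (Function.update M' aPRE _) aH _ with hM2
    have hP2 : ∀ i < 2 ^ T, M2 aPRE (i : ℕ) = (preNode T key (r + 1) i).fold f z val := by
      intro i hi
      have e : M' aH (i : ℕ) = (((2 ^ T + i) / 2 ^ r : ℕ) : ℤ) := by
        rw [hH i hi]; push_cast; rfl
      obtain ⟨hl1, hl2⟩ := level_lt hi (show r ≤ T by omega)
      have hl3 : 2 ≤ 2 ^ (T - r) := by
        calc 2 = 2 ^ 1 := rfl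
          _ ≤ 2 ^ (T - r) := Nat.pow_le_pow_right (by norm_num) (by omega)
      simp only [hM2, Function.update_of_ne (show aPRE ≠ aH by decide), Function.update_self,
        arr_lt hi, Expr.eval, hop, hKB' i hi, e, hP i hi]
      split_ifs with hodd
      · have hodd' : (2 ^ T + i) / 2 ^ r % 2 = 1 := by omega
        have hpow : 2 ^ (T - r + 1) = 2 * 2 ^ (T - r) := by ring
        have e2 : (((2 ^ T + i) / 2 ^ r : ℕ) : ℤ) - 1 = (((2 ^ T + i) / 2 ^ r - 1 : ℕ) : ℤ) := by
          omega
        have h2 : (2 ^ T + i) / 2 ^ (r + 1) = ((2 ^ T + i) / 2 ^ r - 1) / 2 := by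
          rw [pow_succ, ← Nat.div_div_eq_div_mul]; omega
        obtain ⟨d, hd⟩ : ∃ d, T - r = d + 1 := ⟨T - r - 1, by omega⟩
        have hpar : 2 ^ (T - r) % 2 = 0 := by rw [hd, pow_succ]; omega
        rw [e2, hT r (by omega) _ (hk' i hi) _ (by omega) (by omega) (.inr ⟨i, hi, rfl, h2⟩),
          if_pos le_rfl, node, preNode_odd hi hodd',
          ← Finset.disjUnion_eq_union _ _ (preNode_disjoint hodd')]
        conv_rhs => rw [← hf]
        exact (Finset.fold_disjUnion _).symm
      · rw [preNode_even (by omega)]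
    have hH2 : ∀ i < 2 ^ T, M2 aH (i : ℕ) = (((2 ^ T + i) / 2 ^ (r + 1) : ℕ) : ℤ) := by
      intro i hi
      have h2 := hH i hi
      simp only [hM2, Function.update_self, arr_lt hi, Expr.eval,
        Function.update_of_ne (show aH ≠ aPRE by decide), h2]
      rw [pow_succ, ← Nat.div_div_eq_div_mul]; push_cast; rfl
    have hN2 : M2 aN 0 = 2 ^ T := by simp [hM2, hN']
    have hKB2 : ∀ i < 2 ^ T, M2 aKB (i : ℕ) = (key i : ℤ) * (2 * 2 ^ T) := by
      simpa [hM2] using hKB'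
    have hT2 : M2 aT = M' aT := by simp [hM2]
    clear_value M2
    refine Runs.pput (2 ^ T) (by simp [Expr.eval, hN2]) hW1 ?_
    intro y
    refine ⟨?_, by simpa using hP2, ?_⟩
    · intro i hi
      have := hH2 i hi
      push_cast at this
      simpa using this
    intro t ht k hk c hc1 hc2 hrel
    rw [Function.update_of_ne (by decide), Function.update_self]
    have hold := hT t ht k hk c hc1 hc2 hrel
    rcases Mem.step_cases (M := M2) (k := 2 ^ T) (g := .const 1) (a := aT)
      (x := .add (rd aKB) (rd aH)) (v := op (.read aT (.add (rd aKB) (dbl (rd aH))))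
        (.read aT (.add (rd aKB) (.add (dbl (rd aH)) (.const 1)))))
      (y := (k : ℤ) * (2 * 2 ^ T) + c) with ⟨j, hj, -, hx, h⟩ | ⟨hmiss, h⟩
    · simp only [Expr.eval, hKB2 j hj, hH2 j hj] at hx
      obtain ⟨hl1, hl2⟩ := level_lt hj (show r + 1 ≤ T by omega)
      obtain ⟨rfl, rfl⟩ := addr_inj (N := 2 ^ T) (k := key j) (k' := k)
        (level_bound hl2) (level_bound hc2) (by push_cast at hx ⊢; exact hx)
      obtain rfl := level_unique hr ht hl1 hl2 hc1 hc2
      have hsub : T - r = T - (r + 1) + 1 := by omega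
      have hp : 2 ^ (T - r) = 2 * 2 ^ (T - (r + 1)) := by rw [hsub]; ring
      have hp' : 2 ^ (T - r + 1) = 2 * 2 ^ (T - (r + 1) + 1) := by rw [hsub]; ring
      have r1 : Relevant T key r (key j) (2 * ((2 ^ T + j) / 2 ^ (r + 1))) :=
        .inr ⟨j, hj, rfl, by omega⟩
      have r2 : Relevant T key r (key j) (2 * ((2 ^ T + j) / 2 ^ (r + 1)) + 1) :=
        .inr ⟨j, hj, rfl, by omega⟩
      have h1 := hT r (by omega) (key j) hk _ (by omega) (by omega) r1
      have h2 := hT r (by omega) (key j) hk _ (by omega) (by omega) r2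
      rw [if_pos le_rfl] at h1 h2
      rw [h, if_pos le_rfl, hop, node_succ f hf, ← h1, ← h2]
      simp only [Expr.eval, hKB2 j hj, hH2 j hj, hT2]
      push_cast
      ring_nf
    · rw [h, hT2, hold]
      by_cases ht0 : t = r + 1
      · subst ht0
        rw [if_neg (by omega), if_pos le_rfl]
        have : nodeSet T key (r + 1) k c = ∅ := by
          rw [nodeSet, Finset.filter_eq_empty_iff]
          rintro j hj ⟨hj1, hj2⟩
          rw [Finset.mem_range] at hj
          apply hmiss j hj (by simp [Expr.eval])
          simp only [Expr.eval, hKB2 j hj, hH2 j hj, hj1, hj2]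
        rw [node, this, Finset.fold_empty]
      · congr 1
        exact propext (by omega)
  · intro M' hs ⟨_, h1, h2⟩
    refine ⟨?_, ?_⟩
    · intro t ht k hk c hc1 hc2 hrel
      rw [h2 t ht k hk c hc1 hc2 hrel, if_pos ht]
    · intro i hi
      rw [h1 i hi, preNode_top hi]

theorem tree_runs {W T : ℕ} (hW : 2 * 2 ^ T + 1 ≤ W) {M : Mem} (hB : Base T M)
    {key : ℕ → ℕ} (hk : ∀ i < 2 ^ T, M aTK (i : ℕ) = key i) (hk' : ∀ i < 2 ^ T, key i < 2 * 2 ^ T)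
    {f : ℤ → ℤ → ℤ} [Std.Commutative f] [Std.Associative f]
    {z : ℤ} (hf : f z z = z) (hz : M aNE 0 = z) {val : ℕ → ℤ}
    (hv : ∀ i < 2 ^ T, M aTV (i : ℕ) = val i)
    {op : Expr → Expr → Expr}
    (hop : ∀ M i x y, (op x y).eval M i = f (x.eval M i) (y.eval M i)) :
    Runs W (tree op) M (10 * T + 10) (Forest T key f z val) := by
  refine Runs.le (T := (5 * T + 5) + (5 * T + 5)) ?_ (by omega)
  refine (treeClear_runs hW hB hk hk' hz).seq fun M' hs ⟨h1, h2⟩ => ?_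
  exact treeUp_runs hW (hB.mono (hs _ (by decide)) (hs _ (by decide))) hk' hf
    (by rw [hs _ (by decide), hz]) (by rw [hs aTV (by decide)]; exact hv) hop h1 h2

end PRAM

namespace PRAM

/-! ### Grouped sums and searching -/

/-- Addition of integers. -/
def addInt (x y : ℤ) : ℤ := x + y

instance : Std.Commutative addInt := ⟨fun x y => add_comm x y⟩

instance : Std.Associative addInt := ⟨fun x y z => add_assoc x y z⟩

/-- Sum of the values before `i` with the same key. -/
def preSum (key : ℕ → ℕ) (val : ℕ → ℤ) (i : ℕ) : ℤ := ∑ j ∈ preSet key i, val j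

/-- Sum of the values with key `k`. -/
def keySum (T : ℕ) (key : ℕ → ℕ) (val : ℕ → ℤ) (k : ℕ) : ℤ := ∑ j ∈ keySet T key k, val j

/-- The trees for grouped sums. -/
abbrev SumForest (T : ℕ) (key : ℕ → ℕ) (val : ℕ → ℤ) (M : Mem) : Prop :=
  Forest T key addInt 0 val M

theorem fold_add_eq_sum (s : Finset ℕ) (val : ℕ → ℤ) :
    s.fold addInt 0 val = ∑ j ∈ s, val j := rfl

theorem SumForest.root {T : ℕ} {key : ℕ → ℕ} {val : ℕ → ℤ} {M : Mem} (h : SumForest T key val M)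
    {k : ℕ} (hk : k < 2 * 2 ^ T) : M aT ((k : ℤ) * (2 * 2 ^ T) + 1) = keySum T key val k :=
  Forest.root h hk

theorem SumForest.pre {T : ℕ} {key : ℕ → ℕ} {val : ℕ → ℤ} {M : Mem} (h : SumForest T key val M)
    {i : ℕ} (hi : i < 2 ^ T) : M aPRE (i : ℕ) = preSum key val i :=
  Forest.pre h i hi

/-- Keys for searching. -/
abbrev aQK : ℕ := 16
/-- Addresses of the trees for searching. -/
abbrev aQB : ℕ := 17
/-- Remaining offset in the current node. -/
abbrev aREM : ℕ := 18
/-- Scratch. -/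
abbrev aTMP : ℕ := 19
/-- Results of searching. -/
abbrev aIDX : ℕ := 20

/-- For every processor find the index with the given key that covers the given position. -/
def search : Prog :=
  .seq (pmap (sc aN) aQB (.read aVB (rd aQK))) <|
  .seq (pmap (sc aN) aH (.const 1)) <|
  .seq (pfor aLV (sc aN) <|
    .seq (pmap (sc aN) aTMP (.ifLE (.read aT (.add (rd aQB) (dbl (rd aH)))) (rd aREM)
      (.const 1) (.const 0))) <|
    .seq (pmap (sc aN) aREM (.ifLE (.const 1) (rd aTMP)
      (.sub (rd aREM) (.read aT (.add (rd aQB) (dbl (rd aH))))) (rd aREM))) <|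
    pmap (sc aN) aH (.add (dbl (rd aH)) (rd aTMP)))
  (pmap (sc aN) aIDX (.sub (rd aH) (sc aN)))

/-- Sum of the values with key `k` to the left of the node `c`. -/
def leftSum (T : ℕ) (key : ℕ → ℕ) (val : ℕ → ℤ) (t k c : ℕ) : ℤ :=
  ∑ j ∈ (keySet T key k).filter (fun j => (2 ^ T + j) / 2 ^ t < c), val j

theorem leftSum_left {T : ℕ} {key : ℕ → ℕ} {val : ℕ → ℤ} (t k c : ℕ) :
    leftSum T key val t k (2 * c) = leftSum T key val (t + 1) k c := by
  unfold leftSum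
  congr 1
  ext j
  simp only [Finset.mem_filter, pow_succ, ← Nat.div_div_eq_div_mul, and_congr_right_iff]
  intro _
  generalize (2 ^ T + j) / 2 ^ t = x
  omega

theorem leftSum_right {T : ℕ} {key : ℕ → ℕ} {val : ℕ → ℤ} (t k c : ℕ) :
    leftSum T key val t k (2 * c + 1) =
      leftSum T key val (t + 1) k c + node T key addInt 0 val t k (2 * c) := by
  rw [← leftSum_left]
  simp only [leftSum, node, fold_add_eq_sum]
  rw [← Finset.sum_union]
  · congr 1
    ext j
    simp only [Finset.mem_filter, Finset.mem_union, nodeSet, keySet]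
    generalize (2 ^ T + j) / 2 ^ t = x
    rw [Nat.lt_succ_iff_lt_or_eq]
    tauto
  · rw [Finset.disjoint_left]
    intro j h1 h2
    simp only [Finset.mem_filter, nodeSet] at h1 h2
    omega

/-- Descent from the root, comparing the remaining offset with the total of the left child. The
invariant `leftSum ≤ q < leftSum + node` makes the total of the current node positive; hence the
node is nonempty, its children are relevant, and the cell that is read is valid. The signs of the
values play no role. -/
theorem search_runs {W T : ℕ} (hW : 2 * 2 ^ T + 1 ≤ W) {M : Mem} (hB : Base T M)
    {key : ℕ → ℕ} {val : ℕ → ℤ} (hF : SumForest T key val M)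
    {qk : ℕ → ℕ} (hqk : ∀ i < 2 ^ T, M aQK (i : ℕ) = qk i) (hqk' : ∀ i < 2 ^ T, qk i < 2 * 2 ^ T)
    {q : ℕ → ℤ} (hq : ∀ i < 2 ^ T, M aREM (i : ℕ) = q i) :
    Runs W search M (5 * T + 5) fun M' => ∀ i < 2 ^ T, 0 ≤ q i → q i < keySum T key val (qk i) →
      ∃ e : ℕ, e < 2 ^ T ∧ M' aIDX (i : ℕ) = e ∧ key e = qk i ∧ preSum key val e ≤ q i ∧
        q i < preSum key val e + val e := by
  obtain ⟨hW1, hW2⟩ := two_pow_succ_le hW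
  refine Runs.le (T := 1 + (1 + ((T * (3 + 2) + 2) + 1))) ?_ (by ring_nf; omega)
  refine Runs.pmap_seq (2 ^ T) (by simp [Expr.eval, hB.size]) hW1 ?_
  refine Runs.pmap_seq (2 ^ T) (by simp [Expr.eval, hB.size]) hW1 ?_
  set M1 := Function.update (Function.update M aQB _) aH _ with hM1
  have hN1 : M1 aN 0 = 2 ^ T := by simp [hM1, hB.size]
  have hH1 : ∀ i < 2 ^ T, M1 aH (i : ℕ) = 1 := by
    intro i hi; simp [hM1, hi, Expr.eval]
  have hQB1 : ∀ i < 2 ^ T, M1 aQB (i : ℕ) = (qk i : ℤ) * (2 * 2 ^ T) := by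
    intro i hi; simp [hM1, hi, Expr.eval, hqk i hi, hB.addr _ (hqk' i hi)]
  have hT1 : M1 aT = M aT := by simp [hM1]
  have hq1 : ∀ i < 2 ^ T, M1 aREM (i : ℕ) = q i := by simpa [hM1] using hq
  clear_value M1
  refine (Runs.pfor hW2 (K := T)
    (I := fun r M' => ∀ i < 2 ^ T, 0 ≤ q i → q i < keySum T key val (qk i) →
      ∃ c : ℕ, M' aH (i : ℕ) = c ∧ 2 ^ r ≤ c ∧ c < 2 ^ (r + 1) ∧
        leftSum T key val (T - r) (qk i) c ≤ q i ∧
        M' aREM (i : ℕ) = q i - leftSum T key val (T - r) (qk i) c ∧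
        q i - leftSum T key val (T - r) (qk i) c < node T key addInt 0 val (T - r) (qk i) c)
    (by simp [Expr.eval, hN1]) (by decide) ?_ ?_).seq ?_
  · intro y i hi hi0 hi1
    have : leftSum T key val T (qk i) 1 = 0 := by
      unfold leftSum
      rw [Finset.filter_eq_empty_iff.2, Finset.sum_empty]
      intro j hj
      simp only [keySet, Finset.mem_filter, Finset.mem_range] at hj
      have := (level_lt hj.1 (le_refl T)).1
      rw [Nat.sub_self, pow_zero] at this
      omega
    refine ⟨1, ?_, ?_, ?_, ?_, ?_, ?_⟩
    · simp [hH1 i hi]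
    · simp
    · simp
    · simpa [this] using hi0
    · simp [this, hq1 i hi]
    · simp only [Nat.sub_zero, this, node, nodeSet_root, sub_zero, fold_add_eq_sum]
      exact hi1
  · intro r hr M' hs hI
    have hN' : M' aN 0 = 2 ^ T := by rw [hs aN (by decide)]; simp [hN1]
    have hQB' : ∀ i < 2 ^ T, M' aQB (i : ℕ) = (qk i : ℤ) * (2 * 2 ^ T) := by
      rw [hs aQB (by decide)]; simpa using hQB1
    have hT' : M' aT = M aT := by rw [hs aT (by decide)]; simpa using hT1
    refine Runs.le (T := 1 + (1 + 1)) ?_ le_rfl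
    refine Runs.pmap_seq (2 ^ T) (by simp [Expr.eval, hN']) hW1 ?_
    refine Runs.pmap_seq (2 ^ T) (by simp [Expr.eval, hN']) hW1 ?_
    refine Runs.pmap (2 ^ T) (by simp [Expr.eval, hN']) hW1 ?_
    intro y i hi hi0 hi1
    obtain ⟨c, hc, hc1, hc2, hc3, hc4, hc5⟩ := hI i hi hi0 hi1
    obtain ⟨t, ht⟩ : ∃ t, T - r = t + 1 := ⟨T - r - 1, by omega⟩
    have ht' : T - (r + 1) = t := by omega
    have htT : T - t = r + 1 := by omega
    rw [ht] at hc3 hc4 hc5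
    have hrel : Relevant T key t (qk i) (2 * c) := by
      have : (nodeSet T key (t + 1) (qk i) c).Nonempty := by
        by_contra hne
        rw [Finset.not_nonempty_iff_eq_empty] at hne
        rw [node, hne, Finset.fold_empty] at hc5
        omega
      obtain ⟨j, hj⟩ := this
      simp only [nodeSet, Finset.mem_filter, Finset.mem_range] at hj
      exact .inr ⟨j, hj.1, hj.2.1, by omega⟩
    have hcell := hF.nodes t (by omega) (qk i) (hqk' i hi) (2 * c)
      (by rw [htT, pow_succ]; omega) (by rw [htT, pow_succ]; omega) hrel
    have hcell' : M aT ((qk i : ℤ) * (2 * 2 ^ T) + (c + c)) =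
        node T key addInt 0 val t (qk i) (2 * c) := by
      rw [← hcell]; push_cast; ring_nf
    have hsucc := node_succ (T := T) (key := key) addInt (z := 0) rfl val t (qk i) c
    simp only [addInt] at hsucc
    simp only [ht', Function.update_of_ne (show aH ≠ aLV by decide), Function.update_self,
      Function.update_of_ne (show aREM ≠ aLV by decide),
      Function.update_of_ne (show aREM ≠ aH by decide),
      Function.update_of_ne (show aREM ≠ aTMP by decide),
      Function.update_of_ne (show aT ≠ aTMP by decide),
      Function.update_of_ne (show aQB ≠ aTMP by decide),
      Function.update_of_ne (show aTMP ≠ aREM by decide),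
      Function.update_of_ne (show aH ≠ aREM by decide),
      Function.update_of_ne (show aH ≠ aTMP by decide), arr_lt hi, Expr.eval, hc, hQB' i hi,
      hT', hcell', hc4]
    by_cases hle : node T key addInt 0 val t (qk i) (2 * c) ≤
      q i - leftSum T key val (t + 1) (qk i) c
    · simp only [if_pos hle, le_refl, if_true]
      refine ⟨2 * c + 1, by push_cast; ring, by rw [pow_succ]; omega, by rw [pow_succ]; omega, ?_⟩
      rw [leftSum_right]
      refine ⟨by omega, by ring, by omega⟩
    · simp only [if_neg hle, show ¬ (1 : ℤ) ≤ 0 by norm_num, if_false]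
      refine ⟨2 * c, by push_cast; ring, by rw [pow_succ]; omega, by rw [pow_succ]; omega, ?_⟩
      rw [leftSum_left]
      exact ⟨hc3, rfl, by omega⟩
  · intro M2 hs hI
    have hN2 : M2 aN 0 = 2 ^ T := by rw [hs aN (by decide), hN1]
    refine Runs.pmap (2 ^ T) (by simp [Expr.eval, hN2]) hW1 ?_
    intro i hi hi0 hi1
    obtain ⟨c, hc, hc1, hc2, hc3, hc4, hc5⟩ := hI i hi hi0 hi1
    rw [Nat.sub_self] at hc3 hc4 hc5
    have hcN : 2 ^ T + (c - 2 ^ T) = c := by omega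
    have : (nodeSet T key 0 (qk i) c).Nonempty := by
      by_contra hne
      rw [Finset.not_nonempty_iff_eq_empty] at hne
      rw [node, hne, Finset.fold_empty] at hc5
      omega
    obtain ⟨e, he⟩ := this
    simp only [nodeSet, Finset.mem_filter, Finset.mem_range, pow_zero, Nat.div_one] at he
    obtain ⟨he1, he2, he3⟩ := he
    have hleft : leftSum T key val 0 (qk i) c = preSum key val e := by
      simp only [leftSum, preSum]
      congr 1
      ext j
      simp only [keySet, preSet, Finset.mem_filter, Finset.mem_range, pow_zero, Nat.div_one]
      constructor
      · rintro ⟨⟨h1, h2⟩, h3⟩; exact ⟨by omega, by rw [h2, he2]⟩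
      · rintro ⟨h1, h2⟩; exact ⟨⟨by omega, by rw [h2, he2]⟩, by omega⟩
    have hn : node T key addInt 0 val 0 (qk i) c = val e := by
      rw [node, ← he3, ← he2, nodeSet_leaf he1, Finset.fold_singleton, addInt, add_zero]
    rw [hleft] at hc3 hc5
    rw [hn] at hc5
    refine ⟨e, he1, ?_, he2, hc3, by omega⟩
    simp only [Function.update_self, arr_lt hi, Expr.eval, hc, hN2, ← he3]
    push_cast; ring

end PRAM

namespace PRAM

/-! ### Macros -/

/-- Grouped reduction of the values `v` with keys `k`. -/
def gred (op : Expr → Expr → Expr) (ne k v : Expr) : Prog :=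
  .seq (pmap (sc aN) aTK k) <|
  .seq (pmap (sc aN) aTV v) <|
  .seq (pset aNE ne) (tree op)

/-- Grouped sums. -/
def gsum (k v : Expr) : Prog := gred .add (.const 0) k v

/-- Store the sum of the values `v` in `a`. -/
def gtotal (a : ℕ) (v : Expr) : Prog :=
  .seq (gsum (.const 0) v) (pset a (.read aT (.const 1)))

/-- The arrays used by grouped reductions. -/
abbrev gredArrays : List ℕ :=
  [aTK, aTV, aNE, aKB, aT, aH, aLV, aH, aT, aT, aLV, aH, aT, aPRE, aLV, aPRE, aH, aT, aLV]

theorem gred_writes (op : Expr → Expr → Expr) (ne k v : Expr) :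
    (gred op ne k v).writes = gredArrays := rfl

/-- Keys are stored before values are evaluated, and both before the initial value; therefore `hv`
and `hz` allow arbitrary contents of the arrays already overwritten. -/
theorem gred_runs {W T : ℕ} (hW : 2 * 2 ^ T + 1 ≤ W) {M : Mem} (hB : Base T M)
    {key : ℕ → ℕ} {k v ne : Expr} (hk : ∀ i < 2 ^ T, k.eval M i = key i)
    (hk' : ∀ i < 2 ^ T, key i < 2 * 2 ^ T)
    {f : ℤ → ℤ → ℤ} [Std.Commutative f] [Std.Associative f]
    {z : ℤ} (hf : f z z = z) {val : ℕ → ℤ}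
    (hv : ∀ y, ∀ i < 2 ^ T, v.eval (Function.update M aTK y) i = val i)
    (hz : ∀ y y', ne.eval (Function.update (Function.update M aTK y) aTV y') 0 = z)
    {op : Expr → Expr → Expr}
    (hop : ∀ M i x y, (op x y).eval M i = f (x.eval M i) (y.eval M i)) :
    Runs W (gred op ne k v) M (10 * T + 13) (Forest T key f z val) := by
  obtain ⟨hW1, hW2⟩ := two_pow_succ_le hW
  refine Runs.le (T := 1 + (1 + (1 + (10 * T + 10)))) ?_ (by omega)
  refine Runs.pmap_seq (2 ^ T) (by simp [Expr.eval, hB.size]) hW1 ?_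
  refine Runs.pmap_seq (2 ^ T) (by simp [Expr.eval, hB.size]) hW1 ?_
  refine Runs.pset_seq hW2 ?_
  refine tree_runs hW (hB.mono (by simp) (by simp)) (key := key) (fun i hi => ?_) hk' hf
    (by simp [hz]) (val := val) (fun i hi => ?_) hop
  · simp [hi, hk]
  · simp [hi, hv]

theorem gsum_runs {W T : ℕ} (hW : 2 * 2 ^ T + 1 ≤ W) {M : Mem} (hB : Base T M)
    {key : ℕ → ℕ} {k v : Expr} (hk : ∀ i < 2 ^ T, k.eval M i = key i)
    (hk' : ∀ i < 2 ^ T, key i < 2 * 2 ^ T) {val : ℕ → ℤ}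
    (hv : ∀ y, ∀ i < 2 ^ T, v.eval (Function.update M aTK y) i = val i) :
    Runs W (gsum k v) M (10 * T + 13) (SumForest T key val) :=
  gred_runs hW hB hk hk' rfl hv (fun _ _ => rfl) (fun _ _ _ _ => rfl)

theorem gtotal_runs {W T : ℕ} (hW : 2 * 2 ^ T + 1 ≤ W) {M : Mem} (hB : Base T M) {a : ℕ}
    {v : Expr} {val : ℕ → ℤ}
    (hv : ∀ y, ∀ i < 2 ^ T, v.eval (Function.update M aTK y) i = val i) :
    Runs W (gtotal a v) M (10 * T + 14) (fun M' => M' a 0 = ∑ i ∈ Finset.range (2 ^ T), val i) := by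
  obtain ⟨hW1, hW2⟩ := two_pow_succ_le hW
  refine Runs.le (T := (10 * T + 13) + 1) ?_ (by omega)
  refine (gsum_runs hW hB (key := fun _ => 0) (fun i _ => by simp [Expr.eval])
    (fun i _ => by positivity) hv).seq fun M' _ hF => Runs.pset hW2 ?_
  have := hF.root (k := 0) (by positivity)
  simp only [Nat.cast_zero, zero_mul, zero_add] at this
  simp [Expr.eval, this, keySum, keySet]

/-- If `x = y` then `t` else `u`. -/
abbrev ifEQ (x y t u : Expr) : Expr := .ifLE x y (.ifLE y x t u) u

theorem eval_ifEQ (M : Mem) (i : ℕ) (x y t u : Expr) : (ifEQ x y t u).eval M i =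
    if x.eval M i = y.eval M i then t.eval M i else u.eval M i := by
  simp only [Expr.eval]
  split_ifs <;> first | rfl | omega

/-- The minimum. -/
abbrev emin (x y : Expr) : Expr := .ifLE x y x y

theorem eval_emin (M : Mem) (i : ℕ) (x y : Expr) :
    (emin x y).eval M i = min (x.eval M i) (y.eval M i) := by
  simp only [Expr.eval, min_def]

/-- The maximum. -/
abbrev emax (x y : Expr) : Expr := .ifLE x y y x

theorem eval_emax (M : Mem) (i : ℕ) (x y : Expr) :
    (emax x y).eval M i = max (x.eval M i) (y.eval M i) := by
  simp only [Expr.eval, max_def]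

theorem Mem.step_offset (M : Mem) (k : ℕ) (a : ℕ) (o v : Expr) (z : ℤ)
    (ho : ∀ i < k, o.eval M i = z) (i : ℕ) (hi : i < k) :
    M.step k (.const 1) a (.add o .pid) v a (z + i) = v.eval M i :=
  Mem.step_hit (i := i) hi (by simp [Expr.eval]) (by simp [Expr.eval, ho i hi])
    (fun j hj _ h => by
      simp only [Expr.eval, ho j hj] at h
      have : j = i := by omega
      rw [this])

theorem Mem.step_offset_lt (M : Mem) (k : ℕ) (a : ℕ) (o v : Expr) (z : ℤ)
    (ho : ∀ i < k, o.eval M i = z) (y : ℤ) (hy : y < z) :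
    M.step k (.const 1) a (.add o .pid) v a y = M a y :=
  Mem.step_miss (fun j hj _ h => by
    simp only [Expr.eval, ho j hj] at h
    omega)

/-! ### Setting up -/

/-- Set up the size and the addresses of the trees. -/
def setup : Prog :=
  .seq (pset aN (.const 1)) <|
  .seq (.loop (.ifLE (.add (.read 0 (.const 0)) (.read 0 (.const 1))) (sc aN) (.const 0) (.const 1))
    (pset aN (dbl (sc aN)))) <|
  .seq (pmap (dbl (sc aN)) aVB .pid) <|
  pfor aLV (dbl (sc aN)) (pmap (dbl (sc aN)) aVB (dbl (rd aVB)))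

theorem setup_runs {W k : ℕ} (hW : 2 * 2 ^ Nat.clog 2 k + 1 ≤ W) {M : Mem}
    (hk : M 0 0 + M 0 1 = k) :
    Runs W setup M (5 * Nat.clog 2 k + 8) (Base (Nat.clog 2 k)) := by
  set T := Nat.clog 2 k with hT
  obtain ⟨hW1, hW2⟩ := two_pow_succ_le hW
  refine Runs.le (T := 1 + ((T * (1 + 1) + 1) + (1 + ((T + 1) * (1 + 2) + 2)))) ?_ (by omega)
  refine Runs.pset_seq hW2 ?_
  refine (Runs.loop (by omega) (fun r M' => r ≤ T ∧ M' aN 0 = 2 ^ r) T ?_ ?_).seq ?_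
  · simp [Expr.eval]
  · rintro r M' hs ⟨hr, hN⟩ hc
    have h0 : M' 0 = M 0 := by rw [hs 0 (by decide), Function.update_of_ne (by decide)]
    have hrT : r < T := by
      rw [hT, Nat.lt_clog_iff_pow_lt (by norm_num)]
      by_contra h
      apply hc
      have : (k : ℤ) ≤ 2 ^ r := by exact_mod_cast not_lt.1 h
      simp [Expr.eval, h0, hk, hN, this]
    refine ⟨hrT, Runs.pset hW2 ⟨by omega, ?_⟩⟩
    simp [Expr.eval, hN, pow_succ, mul_two]
  · rintro M1 hs ⟨hc, r, hr, hN⟩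
    have h0 : M1 0 = M 0 := by rw [hs 0 (by decide), Function.update_of_ne (by decide)]
    obtain rfl : r = T := by
      apply le_antisymm hr
      rw [hT]
      apply Nat.clog_le_of_le_pow
      by_contra h
      have : ¬ (k : ℤ) ≤ 2 ^ r := by exact_mod_cast h
      simp [Expr.eval, h0, hk, hN, this] at hc
    refine Runs.pmap_seq (2 * 2 ^ T) (by simp [Expr.eval, hN, two_mul]) hW ?_
    -- There is no multiplication: the address of tree `i` arises from `i` by doubling it `T + 1`
    -- times.
    refine (Runs.pfor hW2 (K := T + 1) (I := fun r M' =>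
      ∀ i < 2 * 2 ^ T, M' aVB (i : ℕ) = (i : ℤ) * 2 ^ r)
      (by simp [Expr.eval, hN, pow_succ, mul_two]) (by decide) ?_ ?_).mono le_rfl ?_
    · intro z i hi
      simp only [Function.update_of_ne (show aVB ≠ aLV by decide), Function.update_self, arr_lt hi,
        Expr.eval, pow_zero, mul_one]
    · intro r _ M' hs' hI
      have hN' : M' aN 0 = 2 ^ T := by rw [hs' aN (by decide)]; simp [hN]
      refine Runs.pmap (2 * 2 ^ T) (by simp [Expr.eval, hN', two_mul]) hW ?_
      intro z i hi
      simp only [Function.update_of_ne (show aVB ≠ aLV by decide), Function.update_self, arr_lt hi,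
        Expr.eval, hI i hi]
      ring
    · intro M' hs' hI
      refine ⟨?_, fun i hi => ?_⟩
      · rw [hs' aN (by decide)]; simp [hN]
      · rw [hI i hi]; ring

end PRAM

namespace PRAM

/-! ### Overlaying two families of intervals -/

theorem preSum_eq_filter (key : ℕ → ℕ) (f : ℕ → ℤ) (i : ℕ) :
    preSum key f i = ∑ j ∈ (Finset.range i).filter (fun j => key j = key i), f j := rfl

/-- In the order of indices, each interval of a line starts where the preceding one with the same
key ends, so the increments of `G` telescope. -/
theorem sum_telescope (T : ℕ) (key : ℕ → ℕ) (f : ℕ → ℤ) (G : ℤ → ℤ) (k : ℕ) :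
    ∑ x ∈ keySet T key k, (G (preSum key f x + f x) - G (preSum key f x)) =
      G (keySum T key f k) - G 0 := by
  unfold keySum keySet
  induction 2 ^ T with
  | zero => simp
  | succ n ih =>
    rw [Finset.range_add_one, Finset.filter_insert]
    split_ifs with h
    · rw [Finset.sum_insert (by simp), Finset.sum_insert (by simp), ih, preSum_eq_filter, h,
        add_comm (f n)]
      ring
    · exact ih

section Overlay

variable {T : ℕ} {key : ℕ → ℕ} {f : ℕ → ℤ}

theorem preSum_nonneg (hf : ∀ i < 2 ^ T, 0 ≤ f i) {i : ℕ} (hi : i < 2 ^ T) :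
    0 ≤ preSum key f i :=
  Finset.sum_nonneg fun j hj => hf j (by
    simp only [preSet, Finset.mem_filter, Finset.mem_range] at hj; omega)

theorem preSum_add_le_preSum (hf : ∀ i < 2 ^ T, 0 ≤ f i) {i j : ℕ} (hij : i < j) (hj : j < 2 ^ T)
    (h : key i = key j) : preSum key f i + f i ≤ preSum key f j := by
  unfold preSum
  rw [add_comm, ← Finset.sum_insert (by simp [preSet])]
  refine Finset.sum_le_sum_of_subset_of_nonneg ?_ fun x hx _ => hf x ?_
  · intro x hx
    simp only [preSet, Finset.mem_insert, Finset.mem_filter, Finset.mem_range] at hx ⊢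
    rcases hx with rfl | hx
    · exact ⟨hij, h⟩
    · exact ⟨by omega, by rw [hx.2, h]⟩
  · simp only [preSet, Finset.mem_filter, Finset.mem_range] at hx; omega

theorem preSum_add_le_keySum (hf : ∀ i < 2 ^ T, 0 ≤ f i) {i : ℕ} (hi : i < 2 ^ T) :
    preSum key f i + f i ≤ keySum T key f (key i) := by
  unfold preSum keySum
  rw [add_comm, ← Finset.sum_insert (by simp [preSet])]
  refine Finset.sum_le_sum_of_subset_of_nonneg ?_ fun x hx _ => hf x ?_
  · intro x hx
    simp only [preSet, keySet, Finset.mem_insert, Finset.mem_filter, Finset.mem_range] at hx ⊢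
    rcases hx with rfl | hx
    · exact ⟨hi, rfl⟩
    · exact ⟨by omega, hx.2⟩
  · simp only [keySet, Finset.mem_filter, Finset.mem_range] at hx; omega

/-- Intervals on one line are disjoint, so the interval that a search returns is the only one that
covers the point. -/
theorem cover_unique (hf : ∀ i < 2 ^ T, 0 ≤ f i) {i j : ℕ} (hi : i < 2 ^ T) (hj : j < 2 ^ T)
    (h : key i = key j) {q : ℤ} (h1 : preSum key f i ≤ q) (h2 : q < preSum key f i + f i)
    (h3 : preSum key f j ≤ q) (h4 : q < preSum key f j + f j) : i = j := by
  rcases lt_trichotomy i j with hij | hij | hij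
  · have := preSum_add_le_preSum hf hij hj h; omega
  · exact hij
  · have := preSum_add_le_preSum hf hij hi h.symm; omega

/-- Every index `e` has an interval of length `f e` in the line of its key, and there is an
opposite line `opp e`. The index `x` with `f x > 0` has a mate if the point `preSum x + f x - δ x`
is covered by an interval of the opposite line, which then is its mate. -/
structure Overlay (T : ℕ) (key opp : ℕ → ℕ) (δ f : ℕ → ℤ) (has : ℕ → Prop) (mate : ℕ → ℕ) : Prop
    where
  nonneg : ∀ i < 2 ^ T, 0 ≤ f i
  opp_comm : ∀ i j, key i = opp j → key j = opp i
  delta : ∀ i, δ i = 0 ∨ δ i = 1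
  delta_opp : ∀ i j, key i = opp j → δ i = 1 - δ j
  has_iff : ∀ i < 2 ^ T, has i ↔
    0 < f i ∧ preSum key f i + f i - δ i < keySum T key f (opp i)
  mate_lt : ∀ i < 2 ^ T, has i → mate i < 2 ^ T
  key_mate : ∀ i < 2 ^ T, has i → key (mate i) = opp i
  mate_le : ∀ i < 2 ^ T, has i → preSum key f (mate i) ≤ preSum key f i + f i - δ i
  lt_mate : ∀ i < 2 ^ T, has i →
    preSum key f i + f i - δ i < preSum key f (mate i) + f (mate i)

variable {opp : ℕ → ℕ} {δ : ℕ → ℤ} {has : ℕ → Prop} {mate : ℕ → ℕ}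

open Classical in
/-- The length of the segment of the overlay that ends at the end of the interval of `i`. -/
noncomputable def segment (T : ℕ) (key opp : ℕ → ℕ) (f : ℕ → ℤ) (has : ℕ → Prop) (mate : ℕ → ℕ)
    (i : ℕ) : ℤ :=
  if f i ≤ 0 then 0 else
    preSum key f i + f i -
      max (preSum key f i) (if has i then preSum key f (mate i) else keySum T key f (opp i))

/-- The point assigned to `i` is the last integer point of its interval if `δ i = 1`, and the first
point after it if `δ i = 0`. In both cases its mate starts no later than the interval of `i` ends.
-/
theorem Overlay.segment_nonneg (h : Overlay T key opp δ f has mate) {i : ℕ} (hi : i < 2 ^ T) :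
    0 ≤ segment T key opp f has mate i := by
  unfold segment
  split_ifs with h1 h2
  · exact le_rfl
  · have := h.mate_le i hi h2
    rcases h.delta i with hd | hd <;> omega
  · have := (h.has_iff i hi).not.1 h2
    have := h.nonneg i hi
    rcases h.delta i with hd | hd <;> omega

open Classical in
-- The overlap of `e` with an interval `x` of the opposite line ends where `e` or `x` ends, and it
-- is charged to that index. If both end together, the index with `δ = 1` is charged: its point lies
-- inside the other interval, whereas the point of the other index is already past the common end.
-- The part of `e` beyond the opposite line is charged to `e`. So the pieces charged to `e`, and
-- those whose mate is `e`, make up the whole interval.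
theorem Overlay.mass (h : Overlay T key opp δ f has mate) {e : ℕ} (he : e < 2 ^ T) :
    segment T key opp f has mate e +
      ∑ x ∈ (Finset.range (2 ^ T)).filter (fun x => has x ∧ mate x = e),
        segment T key opp f has mate x = f e := by
  have hpre := preSum_nonneg (key := key) h.nonneg he
  have hfe := h.nonneg e he
  rcases hfe.eq_or_lt with hfe | hfe
  · rw [segment, if_pos (by omega), ← hfe, zero_add]
    apply Finset.sum_eq_zero
    intro x hx
    simp only [Finset.mem_filter, Finset.mem_range] at hx
    obtain ⟨hx, hhx, rfl⟩ := hx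
    have h1 := h.mate_le x hx hhx
    have h2 := h.lt_mate x hx hhx
    omega
  set a := preSum key f e with ha
  set t := a + f e with ht
  -- Clamping to the interval of `e`: the increment of `G` across an interval `x` is the length of
  -- the overlap of `x` and `e`.
  set G : ℤ → ℤ := fun z => max a (min z t) with hG
  have htel := sum_telescope T key f G (opp e)
  have hO : 0 ≤ keySum T key f (opp e) := Finset.sum_nonneg fun j hj => h.nonneg j (by
    simp only [keySet, Finset.mem_filter, Finset.mem_range] at hj; exact hj.1)
  have hsub : (Finset.range (2 ^ T)).filter (fun x => has x ∧ mate x = e) ⊆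
      keySet T key (opp e) := by
    intro x hx
    simp only [keySet, Finset.mem_filter, Finset.mem_range] at hx ⊢
    obtain ⟨hx, hhx, rfl⟩ := hx
    exact ⟨hx, h.opp_comm _ _ (h.key_mate x hx hhx)⟩
  -- The two conditions exclude each other because `δ x = 1 - δ e`. If neither holds, the overlap is
  -- empty.
  have hterm : ∀ x ∈ keySet T key (opp e), G (preSum key f x + f x) - G (preSum key f x) =
      (if has x ∧ mate x = e then segment T key opp f has mate x else 0) +
      (if has e ∧ mate e = x then segment T key opp f has mate e else 0) := by
    intro x hx
    simp only [keySet, Finset.mem_filter, Finset.mem_range] at hx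
    obtain ⟨hx, hkx⟩ := hx
    have hkx' : key e = opp x := h.opp_comm _ _ hkx
    have hfx := h.nonneg x hx
    have hpx := preSum_nonneg (key := key) h.nonneg hx
    have hd := h.delta_opp _ _ hkx
    have hde := h.delta e
    have hte := preSum_add_le_keySum (key := key) h.nonneg he
    have htx := preSum_add_le_keySum (key := key) h.nonneg hx
    rw [hkx] at htx
    rw [hkx'] at hte
    have hmx : (has x ∧ mate x = e) ↔ 0 < f x ∧ a ≤ preSum key f x + f x - δ x ∧
        preSum key f x + f x - δ x < t := by
      constructor
      · rintro ⟨h1, rfl⟩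
        exact ⟨((h.has_iff x hx).1 h1).1, h.mate_le x hx h1, h.lt_mate x hx h1⟩
      · rintro ⟨h1, h2, h3⟩
        have h4 : has x := (h.has_iff x hx).2 ⟨h1, by omega⟩
        refine ⟨h4, cover_unique h.nonneg (h.mate_lt x hx h4) he ?_ (h.mate_le x hx h4)
          (h.lt_mate x hx h4) h2 h3⟩
        rw [h.key_mate x hx h4, hkx']
    have hme : (has e ∧ mate e = x) ↔ preSum key f x ≤ t - δ e ∧
        t - δ e < preSum key f x + f x := by
      constructor
      · rintro ⟨h1, rfl⟩
        exact ⟨h.mate_le e he h1, h.lt_mate e he h1⟩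
      · rintro ⟨h2, h3⟩
        have h4 : has e := (h.has_iff e he).2 ⟨hfe, by omega⟩
        refine ⟨h4, cover_unique h.nonneg (h.mate_lt e he h4) hx ?_ (h.mate_le e he h4)
          (h.lt_mate e he h4) h2 h3⟩
        rw [h.key_mate e he h4, hkx]
    have hsx : (has x ∧ mate x = e) → segment T key opp f has mate x =
        preSum key f x + f x - max (preSum key f x) a := by
      intro hh
      rw [segment, if_neg (by have := (hmx.1 hh).1; omega), if_pos hh.1, hh.2]
    have hse : (has e ∧ mate e = x) → segment T key opp f has mate e =
        t - max a (preSum key f x) := by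
      intro hh
      rw [segment, if_neg (by omega), if_pos hh.1, hh.2]
    simp only [hG]
    by_cases c1 : has x ∧ mate x = e <;> by_cases c2 : has e ∧ mate e = x
    · rw [if_pos c1, if_pos c2, hsx c1, hse c2]
      have := hmx.1 c1
      have := hme.1 c2
      rcases hde with h1 | h1 <;> omega
    · rw [if_pos c1, if_neg c2, hsx c1]
      have := hmx.1 c1
      have := hme.not.1 c2
      rcases hde with h1 | h1 <;> omega
    · rw [if_neg c1, if_pos c2, hse c2]
      have := hmx.not.1 c1
      have := hme.1 c2
      rcases hde with h1 | h1 <;> omega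
    · rw [if_neg c1, if_neg c2]
      have := hmx.not.1 c1
      have := hme.not.1 c2
      rcases hde with h1 | h1 <;> omega
  rw [Finset.sum_congr rfl hterm, Finset.sum_add_distrib, ← Finset.sum_filter] at htel
  have hfil : (keySet T key (opp e)).filter (fun x => has x ∧ mate x = e) =
      (Finset.range (2 ^ T)).filter (fun x => has x ∧ mate x = e) := by
    ext x
    constructor
    · intro hx
      simp only [keySet, Finset.mem_filter] at hx ⊢
      exact ⟨hx.1.1, hx.2⟩
    · intro hx
      exact Finset.mem_filter.2 ⟨hsub hx, (Finset.mem_filter.1 hx).2⟩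
  rw [hfil] at htel
  have hG0 : G 0 = a := by simp only [hG]; omega
  rw [hG0] at htel
  -- With a mate, the opposite line reaches the end of `e` and the overlaps exhaust `e`. Without
  -- one, the segment of `e` is what remains after the end of that line.
  by_cases hh : has e
  · have hmem : mate e ∈ keySet T key (opp e) := by
      simp only [keySet, Finset.mem_filter, Finset.mem_range]
      exact ⟨h.mate_lt e he hh, h.key_mate e he hh⟩
    have : ∑ x ∈ keySet T key (opp e),
        (if has e ∧ mate e = x then segment T key opp f has mate e else 0) =
        segment T key opp f has mate e := by
      rw [Finset.sum_eq_single_of_mem _ hmem]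
      · simp [hh]
      · intro b _ hb
        rw [if_neg (fun hc => hb hc.2.symm)]
    rw [this] at htel
    have hGO : G (keySum T key f (opp e)) = t := by
      have h1 := ((h.has_iff e he).1 hh).2
      simp only [hG]
      rcases h.delta e with h2 | h2 <;> omega
    rw [hGO] at htel
    omega
  · have : ∑ x ∈ keySet T key (opp e),
        (if has e ∧ mate e = x then segment T key opp f has mate e else 0) = 0 :=
      Finset.sum_eq_zero fun x _ => if_neg fun hc => hh hc.1
    rw [this] at htel
    have h1 := (h.has_iff e he).not.1 hh
    have hs : segment T key opp f has mate e = t - max a (keySum T key f (opp e)) := by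
      rw [segment, if_neg (by omega), if_neg hh]
    have hGO : G (keySum T key f (opp e)) = max a (keySum T key f (opp e)) := by
      simp only [hG]
      rcases h.delta e with h2 | h2 <;> omega
    rw [hGO] at htel
    omega

open Classical in
-- The central accounting identity. It is applied with `w` the length, the balance at a vertex, the
-- indicator of the edges away from the source, and the indicator of a group.
theorem Overlay.sum_segment (h : Overlay T key opp δ f has mate) (w : ℕ → ℤ) :
    ∑ x ∈ Finset.range (2 ^ T), segment T key opp f has mate x *
      (w x + if has x then w (mate x) else 0) = ∑ e ∈ Finset.range (2 ^ T), f e * w e := by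
  have h1 : ∑ e ∈ Finset.range (2 ^ T), f e * w e = ∑ e ∈ Finset.range (2 ^ T),
      (segment T key opp f has mate e * w e + ∑ x ∈ Finset.range (2 ^ T),
        if has x ∧ mate x = e then segment T key opp f has mate x * w e else 0) := by
    refine Finset.sum_congr rfl fun e he => ?_
    rw [← h.mass (Finset.mem_range.1 he), add_mul, Finset.sum_mul, Finset.sum_filter]
  rw [h1, Finset.sum_add_distrib, Finset.sum_comm, ← Finset.sum_add_distrib]
  refine Finset.sum_congr rfl fun x hx => ?_
  rw [mul_add]
  congr 1
  split_ifs with hh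
  · rw [Finset.sum_eq_single_of_mem (mate x)
      (Finset.mem_range.2 (h.mate_lt x (Finset.mem_range.1 hx) hh))]
    · simp [hh]
    · intro e _ he
      rw [if_neg fun hc => he hc.2.symm]
  · rw [mul_zero, Finset.sum_eq_zero]
    intro e _
    rw [if_neg fun hc => hh hc.1]

end Overlay

end PRAM

namespace PRAM

/-! ### Contraction of flow paths -/

/-- A flow in a directed multigraph with edge lengths. -/
structure Net where
  src : ℕ → ℕ
  dst : ℕ → ℕ
  len : ℕ → ℤ
  flow : ℕ → ℤ

namespace Net

variable (T s : ℕ) (A : Net)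

/-- Inflow minus outflow. -/
def excess (v : ℕ) : ℤ :=
  ∑ e ∈ Finset.range (2 ^ T), A.flow e *
    ((if A.dst e = v then 1 else 0) - if A.src e = v then 1 else 0)

/-- The cost of the flow. -/
def cost : ℤ := ∑ e ∈ Finset.range (2 ^ T), A.flow e * A.len e

/-- The amount of flow through edges that do not start at the source `s`. -/
def pot : ℤ := ∑ e ∈ Finset.range (2 ^ T), A.flow e * if A.src e = s then 0 else 1

/-- The vertices are in range, lengths and flow are nonnegative, and no flow enters the source or
goes through a loop. -/
structure Good : Prop where
  src_lt : ∀ e < 2 ^ T, A.src e < 2 ^ T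
  dst_lt : ∀ e < 2 ^ T, A.dst e < 2 ^ T
  flow_nonneg : ∀ e < 2 ^ T, 0 ≤ A.flow e
  len_nonneg : ∀ e < 2 ^ T, 0 ≤ A.len e
  ne : ∀ e < 2 ^ T, 0 < A.flow e → A.src e ≠ A.dst e
  dst_ne : ∀ e < 2 ^ T, 0 < A.flow e → A.dst e ≠ s

variable (χ : ℕ → ℕ)

/-- The endpoint of `e` at which `e` may be contracted: the end if `χ e = 1`, else the start. -/
def centre (e : ℕ) : ℕ := if χ e = 1 then A.dst e else A.src e

/-- The group of `e`. -/
def key (e : ℕ) : ℕ := 2 * A.centre χ e + χ e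

/-- The group of the edges that `e` may be contracted with. -/
def opp (e : ℕ) : ℕ := 2 * A.centre χ e + (1 - χ e)

/-- The net `A'` arises from `A` by contraction at the centres of the edges. -/
structure Contraction (A' : Net) (has : ℕ → Prop) (mate : ℕ → ℕ) : Prop where
  overlay : Overlay T (A.key χ) (A.opp χ) (fun e => χ e) A.flow has mate
  src_eq : ∀ e < 2 ^ T, A'.src e = open Classical in
    if has e ∧ χ e = 0 then A.src (mate e) else A.src e
  dst_eq : ∀ e < 2 ^ T, A'.dst e = open Classical in
    if has e ∧ χ e = 1 then A.dst (mate e) else A.dst e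
  len_eq : ∀ e < 2 ^ T, A'.len e = open Classical in
    A.len e + if has e then A.len (mate e) else 0
  flow_eq : ∀ e < 2 ^ T, A'.flow e =
    if A'.src e = A'.dst e ∨ A'.dst e = s then 0
      else segment T (A.key χ) (A.opp χ) A.flow has mate e

/-- The amount of flow that is contracted. -/
def gain : ℤ := ∑ v ∈ Finset.range (2 ^ T),
  min (keySum T (A.key χ) A.flow (2 * v + 1)) (keySum T (A.key χ) A.flow (2 * v))

variable {T s A χ}

theorem overlay_of {has : ℕ → Prop} {mate : ℕ → ℕ} (hχ : ∀ e, χ e < 2)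
    (nonneg : ∀ i < 2 ^ T, 0 ≤ A.flow i)
    (has_iff : ∀ i < 2 ^ T, has i ↔ 0 < A.flow i ∧
      preSum (A.key χ) A.flow i + A.flow i - χ i < keySum T (A.key χ) A.flow (A.opp χ i))
    (hm : ∀ i < 2 ^ T, has i → mate i < 2 ^ T ∧ A.key χ (mate i) = A.opp χ i ∧
      preSum (A.key χ) A.flow (mate i) ≤ preSum (A.key χ) A.flow i + A.flow i - χ i ∧
      preSum (A.key χ) A.flow i + A.flow i - χ i <
        preSum (A.key χ) A.flow (mate i) + A.flow (mate i)) :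
    Overlay T (A.key χ) (A.opp χ) (fun e => χ e) A.flow has mate where
  nonneg := nonneg
  opp_comm i j h := by
    have := hχ i; have := hχ j
    simp only [key, opp] at *; omega
  delta i := by have := hχ i; omega
  delta_opp i j h := by
    have := hχ i; have := hχ j
    simp only [key, opp] at *; omega
  has_iff := has_iff
  mate_lt i hi h := (hm i hi h).1
  key_mate i hi h := (hm i hi h).2.1
  mate_le i hi h := (hm i hi h).2.2.1
  lt_mate i hi h := (hm i hi h).2.2.2

section

variable {A' : Net} {has : ℕ → Prop} {mate : ℕ → ℕ}

/-- The relation between an edge of the contracted net and the edges of the original net. -/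
theorem Contraction.mate_spec (h : A.Contraction T s χ A' has mate) (hχ : ∀ e, χ e < 2) {e : ℕ}
    (he : e < 2 ^ T) (hh : has e) :
    χ (mate e) = 1 - χ e ∧ A.centre χ (mate e) = A.centre χ e ∧ 0 < A.flow e ∧
      0 < A.flow (mate e) := by
  have h1 := h.overlay.key_mate e he hh
  have h2 := ((h.overlay.has_iff e he).1 hh).1
  have h3 := h.overlay.mate_le e he hh
  have h4 := h.overlay.lt_mate e he hh
  have := hχ e; have := hχ (mate e)
  simp only [key, opp] at h1
  exact ⟨by omega, by omega, h2, by omega⟩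

theorem flow_pos_of_segment_pos {e : ℕ}
    (hp : 0 < segment T (A.key χ) (A.opp χ) A.flow has mate e) : 0 < A.flow e := by
  unfold segment at hp
  split_ifs at hp <;> omega

theorem Contraction.flow_le (h : A.Contraction T s χ A' has mate) {e : ℕ} (he : e < 2 ^ T) :
    0 ≤ A'.flow e ∧ A'.flow e ≤ segment T (A.key χ) (A.opp χ) A.flow has mate e := by
  have := h.overlay.segment_nonneg he
  rw [h.flow_eq e he]
  split_ifs <;> omega

/-- Edges of the contracted net are edges or paths of length two of the original net. -/
theorem Contraction.provenance (h : A.Contraction T s χ A' has mate) (hχ : ∀ e, χ e < 2) {e : ℕ}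
    (he : e < 2 ^ T) :
    (A'.src e = A.src e ∧ A'.dst e = A.dst e ∧ A'.len e = A.len e) ∨
    ∃ e₁ < 2 ^ T, ∃ e₂ < 2 ^ T, 0 < A.flow e₁ ∧ 0 < A.flow e₂ ∧ A.dst e₁ = A.src e₂ ∧
      A'.src e = A.src e₁ ∧ A'.dst e = A.dst e₂ ∧ A'.len e = A.len e₁ + A.len e₂ := by
  rw [h.src_eq e he, h.dst_eq e he, h.len_eq e he]
  by_cases hh : has e
  · right
    obtain ⟨h1, h2, h3, h4⟩ := h.mate_spec hχ he hh
    have hm := h.overlay.mate_lt e he hh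
    have := hχ e
    rcases (show χ e = 0 ∨ χ e = 1 by omega) with hc | hc
    · refine ⟨mate e, hm, e, he, h4, h3, ?_, ?_, ?_, ?_⟩
      · simpa [centre, h1, hc] using h2
      · simp [hh, hc]
      · simp [hc]
      · simp [hh, add_comm]
    · refine ⟨e, he, mate e, hm, h3, h4, ?_, ?_, ?_, ?_⟩
      · simpa [centre, h1, hc] using h2.symm
      · simp [hc]
      · simp [hh, hc]
      · simp [hh]
  · left; simp [hh]

theorem Contraction.good (h : A.Contraction T s χ A' has mate) (hA : A.Good T s) :
    A'.Good T s where
  src_lt e he := by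
    rw [h.src_eq e he]
    split_ifs with hh
    · exact hA.src_lt _ (h.overlay.mate_lt e he hh.1)
    · exact hA.src_lt e he
  dst_lt e he := by
    rw [h.dst_eq e he]
    split_ifs with hh
    · exact hA.dst_lt _ (h.overlay.mate_lt e he hh.1)
    · exact hA.dst_lt e he
  flow_nonneg e he := (h.flow_le he).1
  len_nonneg e he := by
    have := hA.len_nonneg e he
    rw [h.len_eq e he]
    split_ifs with hh
    · have := hA.len_nonneg _ (h.overlay.mate_lt e he hh); omega
    · omega
  ne e he hp := by
    intro hc
    rw [h.flow_eq e he, if_pos (.inl hc)] at hp; omega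
  dst_ne e he hp := by
    intro hc
    rw [h.flow_eq e he, if_pos (.inr hc)] at hp; omega

open Classical in
-- In the weights of `Overlay.sum_segment` the vertex of contraction cancels, as the end of one edge
-- and the start of the other. Of the flow discarded afterwards, loops do not affect the balance,
-- and flow into `s` can only have been outflow of `v`.
theorem Contraction.excess_le (h : A.Contraction T s χ A' has mate) (hχ : ∀ e, χ e < 2)
    {v : ℕ} (hv : v ≠ s) : A.excess T v ≤ A'.excess T v := by
  unfold excess
  rw [← h.overlay.sum_segment]
  refine Finset.sum_le_sum fun e he => ?_
  rw [Finset.mem_range] at he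
  have hseg := h.overlay.segment_nonneg he
  have hw : ((if A.dst e = v then (1 : ℤ) else 0) - (if A.src e = v then 1 else 0)) +
      (if has e then ((if A.dst (mate e) = v then (1 : ℤ) else 0) -
        if A.src (mate e) = v then 1 else 0) else 0) =
      (if A'.dst e = v then 1 else 0) - if A'.src e = v then 1 else 0 := by
    rw [h.src_eq e he, h.dst_eq e he]
    by_cases hh : has e
    · obtain ⟨h1, h2, -, -⟩ := h.mate_spec hχ he hh
      have := hχ e
      rcases (show χ e = 0 ∨ χ e = 1 by omega) with hc | hc
      · simp only [centre, h1, hc] at h2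
        simp only [if_neg (show ¬ (0 = 1) by norm_num), if_true] at h2
        simp [hh, hc, h2]
      · simp only [centre, h1, hc, if_true, Nat.sub_self] at h2
        simp only [if_neg (show ¬ (0 = 1) by norm_num)] at h2
        simp [hh, hc, h2]
    · simp [hh]
  rw [hw, h.flow_eq e he]
  by_cases h1 : A'.src e = A'.dst e
  · simp [h1]
  by_cases h2 : A'.dst e = s
  · rw [if_pos (Or.inr h2 : A'.src e = A'.dst e ∨ A'.dst e = s), zero_mul, h2,
      if_neg (Ne.symm hv)]
    split_ifs <;> nlinarith
  · rw [if_neg (show ¬ (A'.src e = A'.dst e ∨ A'.dst e = s) by tauto)]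

theorem Contraction.cost_le (h : A.Contraction T s χ A' has mate) (hA : A.Good T s) :
    A'.cost T ≤ A.cost T := by
  unfold cost
  rw [← h.overlay.sum_segment]
  refine Finset.sum_le_sum fun e he => ?_
  rw [Finset.mem_range] at he
  rw [← h.len_eq e he]
  exact mul_le_mul_of_nonneg_right (h.flow_le he).2 ((h.good hA).len_nonneg e he)

open Classical in
-- At a vertex both lines begin at `0`, so they overlap along the whole of the shorter one.
-- Formally, the total of each line is the matched amount plus its unmatched amount, and the two
-- unmatched amounts cannot both be positive.
theorem Contraction.gain_le (h : A.Contraction T s χ A' has mate) (hχ : ∀ e, χ e < 2)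
    (hA : A.Good T s) :
    A.gain T χ ≤ ∑ e ∈ Finset.range (2 ^ T),
      if has e then segment T (A.key χ) (A.opp χ) A.flow has mate e else 0 := by
  have hcen : ∀ e ∈ Finset.range (2 ^ T), A.centre χ e ∈ Finset.range (2 ^ T) := by
    intro e he
    rw [Finset.mem_range] at *
    unfold centre
    split_ifs
    · exact hA.dst_lt e he
    · exact hA.src_lt e he
  rw [← Finset.sum_fiberwise_of_maps_to hcen]
  refine Finset.sum_le_sum fun v _ => ?_
  set g := segment T (A.key χ) (A.opp χ) A.flow has mate with hg
  have hg0 : ∀ e < 2 ^ T, 0 ≤ g e := fun e he => h.overlay.segment_nonneg he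
  set S := ∑ e ∈ (Finset.range (2 ^ T)).filter (fun e => A.centre χ e = v),
    if has e then g e else 0 with hS
  -- For a contracted `e` centred at `v`, exactly one of `e` and its mate belongs to the group `2 *
  -- v + c`; so both lines contain the same matched amount `S`.
  have hL : ∀ c < 2, keySum T (A.key χ) A.flow (2 * v + c) = S +
      ∑ e ∈ Finset.range (2 ^ T), if ¬ has e ∧ A.key χ e = 2 * v + c then g e else 0 := by
    intro c hc
    have : keySum T (A.key χ) A.flow (2 * v + c) = ∑ e ∈ Finset.range (2 ^ T),
        A.flow e * if A.key χ e = 2 * v + c then 1 else 0 := by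
      simp [keySum, keySet, Finset.sum_filter]
    rw [this, ← h.overlay.sum_segment, hS, Finset.sum_filter, ← Finset.sum_add_distrib]
    refine Finset.sum_congr rfl fun e he => ?_
    rw [Finset.mem_range] at he
    rw [← hg]
    by_cases hh : has e
    · obtain ⟨h1, h2, -, -⟩ := h.mate_spec hχ he hh
      have := hχ e
      have hiff : (A.key χ e = 2 * v + c ↔ A.centre χ e = v ∧ χ e = c) := by
        simp only [key]; omega
      have hiff' : (A.key χ (mate e) = 2 * v + c ↔ A.centre χ e = v ∧ χ e = 1 - c) := by
        simp only [key, h1, h2]; omega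
      simp only [hh, hiff, hiff', not_true, false_and, if_true, if_false]
      by_cases hv : A.centre χ e = v
      · rcases (show χ e = c ∨ χ e = 1 - c by omega) with hc' | hc'
        · have : c ≠ 1 - c := by omega
          simp [hv, hc', this]
        · have : 1 - c ≠ c := by omega
          simp [hv, hc', this]
      · simp [hv]
    · simp [hh]
  have hI := hL 1 (by norm_num)
  have hO := hL 0 (by norm_num)
  rw [add_zero] at hO
  set LI := ∑ e ∈ Finset.range (2 ^ T), if ¬ has e ∧ A.key χ e = 2 * v + 1 then g e else 0 with hLI
  set LO := ∑ e ∈ Finset.range (2 ^ T), if ¬ has e ∧ A.key χ e = 2 * v then g e else 0 with hLO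
  have hex : ∀ c, (∑ e ∈ Finset.range (2 ^ T),
      if ¬ has e ∧ A.key χ e = 2 * v + c then g e else 0) ≤ 0 ∨
      ∃ e < 2 ^ T, ¬ has e ∧ A.key χ e = 2 * v + c ∧ 0 < g e := by
    intro c
    by_contra hcon
    push Not at hcon
    apply absurd hcon.1
    push Not
    refine Finset.sum_nonpos fun e he => ?_
    split_ifs with h1
    · exact hcon.2 e (Finset.mem_range.1 he) h1.1 h1.2
    · exact le_rfl
  have h1 := hex 1
  have h0 := hex 0
  rw [add_zero, ← hLO] at h0
  rw [← hLI] at h1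
  rcases h1 with h1 | ⟨e, he, hne, hke, hge⟩
  · exact (min_le_left _ _).trans (by omega)
  rcases h0 with h0 | ⟨e', he', hne', hke', hge'⟩
  · exact (min_le_right _ _).trans (by omega)
  -- An unmatched `e` forces the incoming line to be longer than the outgoing one, while a positive
  -- unmatched piece of `e'` forces the opposite.
  exfalso
  have hf := flow_pos_of_segment_pos hge
  have hf' := flow_pos_of_segment_pos hge'
  have hn := (h.overlay.has_iff e he).not.1 hne
  have hp := preSum_add_le_keySum (key := A.key χ) hA.flow_nonneg he
  have hp' := preSum_add_le_keySum (key := A.key χ) hA.flow_nonneg he'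
  have c1 := hχ e
  have c2 := hχ e'
  have o1 : A.opp χ e = 2 * v := by simp only [key, opp] at *; omega
  have o2 : A.opp χ e' = 2 * v + 1 := by simp only [key, opp] at *; omega
  have x1 : χ e = 1 := by simp only [key] at *; omega
  rw [hg, segment, if_neg (by omega), if_neg hne', o2] at hge'
  rw [o1, x1] at hn
  rw [hke] at hp
  rw [hke'] at hp'
  push_cast at hn
  omega

open Classical in
-- The middle vertex of a contracted path is the end of an edge with flow, hence not `s`, so the
-- second edge counted in the potential. The new edge starts where the first one does and counts
-- only as that one did; each contracted segment therefore saves its full length.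
theorem Contraction.pot_le (h : A.Contraction T s χ A' has mate) (hχ : ∀ e, χ e < 2)
    (hA : A.Good T s) : A'.pot T s + A.gain T χ ≤ A.pot T s := by
  have hgain := h.gain_le hχ hA
  refine (add_le_add_right hgain _).trans ?_
  unfold pot
  rw [← h.overlay.sum_segment, ← Finset.sum_add_distrib]
  refine Finset.sum_le_sum fun e he => ?_
  rw [Finset.mem_range] at he
  set g := segment T (A.key χ) (A.opp χ) A.flow has mate with hg
  have hg0 : 0 ≤ g e := h.overlay.segment_nonneg he
  have hfl := (h.flow_le he).2
  rw [← hg] at hfl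
  have h1 : A'.flow e * (if A'.src e = s then 0 else 1) ≤ g e * if A'.src e = s then 0 else 1 :=
    mul_le_mul_of_nonneg_right hfl (by split_ifs <;> norm_num)
  refine (add_le_add_left h1 _).trans ?_
  rw [h.src_eq e he]
  by_cases hh : has e
  · obtain ⟨h1, h2, h3, h4⟩ := h.mate_spec hχ he hh
    have hm := h.overlay.mate_lt e he hh
    have := hχ e
    rcases (show χ e = 0 ∨ χ e = 1 by omega) with hc | hc
    · simp only [centre, h1, hc] at h2
      simp only [if_neg (show ¬ (0 = 1) by norm_num), if_true] at h2
      have := hA.dst_ne _ hm h4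
      rw [h2] at this
      simp only [hh, hc, this, if_true, if_false, and_self]
      split_ifs <;> linarith
    · simp only [centre, h1, hc, if_true, Nat.sub_self] at h2
      simp only [if_neg (show ¬ (0 = 1) by norm_num)] at h2
      have := hA.dst_ne _ he h3
      rw [← h2] at this
      simp only [hh, hc, this, if_true, if_false, true_and, if_neg (show ¬ (1 = 0) by norm_num)]
      split_ifs <;> linarith
  · simp [hh]

end

/-! ### A family of bipartitions of the edges -/

/-- The bits of `N - 1 - e`, followed by the bits of `e`. -/
def code (T e : ℕ) : ℕ := (2 ^ T - 1 - e) * 2 ^ T + e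

/-- The `j`-th bit of the code of `e`. -/
def chi (T j e : ℕ) : ℕ := code T e / 2 ^ j % 2

theorem chi_lt (T j e : ℕ) : chi T j e < 2 := Nat.mod_lt _ (by norm_num)

theorem chi_low {j e : ℕ} (hj : j < T) : chi T j e = 1 ↔ e.testBit j := by
  obtain ⟨d, rfl⟩ : ∃ d, T = j + (d + 1) := ⟨T - j - 1, by omega⟩
  rw [Nat.testBit_eq_decide_div_mod_eq, decide_eq_true_eq, chi, code]
  have : (2 ^ (j + (d + 1)) - 1 - e) * 2 ^ (j + (d + 1)) + e =
      e + 2 ^ j * (2 * ((2 ^ (j + (d + 1)) - 1 - e) * 2 ^ d)) := by ring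
  rw [this, Nat.add_mul_div_left _ _ (by positivity)]
  omega

theorem chi_high {j e : ℕ} (he : e < 2 ^ T) (hj : j < T) :
    chi T (T + j) e = 1 ↔ e.testBit j = false := by
  have h1 : chi T (T + j) e = 1 ↔ (2 ^ T - (e + 1)).testBit j := by
    rw [Nat.testBit_eq_decide_div_mod_eq, decide_eq_true_eq, chi, code, pow_add,
      ← Nat.div_div_eq_div_mul, mul_comm, Nat.mul_add_div (by positivity), Nat.div_eq_of_lt he,
      add_zero, Nat.sub_sub, add_comm 1 e]
  rw [h1, Nat.testBit_two_pow_sub_succ he]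
  simp [hj]

/-- Two distinct slots differ in some bit. The complemented copy of the bits is what allows the
order of the pair to be prescribed. -/
theorem exists_chi {e e' : ℕ} (he : e < 2 ^ T) (he' : e' < 2 ^ T) (hne : e ≠ e') :
    ∃ j < 2 * T, chi T j e = 1 ∧ chi T j e' = 0 := by
  obtain ⟨j, hj⟩ := Nat.exists_testBit_ne_of_ne hne
  have hjT : j < T := by
    by_contra hc
    apply hj
    have hle : 2 ^ T ≤ 2 ^ j := Nat.pow_le_pow_right (by norm_num) (by omega)
    rw [Nat.testBit_lt_two_pow (by omega), Nat.testBit_lt_two_pow (by omega)]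
  cases h : e.testBit j with
  | true =>
    have h' : ¬ e'.testBit j := by rw [h] at hj; simpa using hj.symm
    refine ⟨j, by omega, (chi_low hjT).2 h, ?_⟩
    have := (chi_low (e := e') hjT).not.2 h'
    have := chi_lt T j e'
    omega
  | false =>
    have h' : ¬ e'.testBit j = false := by rw [h] at hj; simpa using hj.symm
    refine ⟨T + j, by omega, (chi_high he hjT).2 h, ?_⟩
    have := (chi_high he' hjT).not.2 h'
    have := chi_lt T (T + j) e'
    omega

theorem keySum_in (hχ : ∀ e, χ e < 2) (v : ℕ) : keySum T (A.key χ) A.flow (2 * v + 1) =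
    ∑ e ∈ (Finset.range (2 ^ T)).filter (fun e => A.dst e = v), if χ e = 1 then A.flow e else 0 := by
  rw [keySum, keySet, Finset.sum_filter, Finset.sum_filter]
  refine Finset.sum_congr rfl fun e _ => ?_
  have := hχ e
  simp only [key, centre]
  by_cases h : χ e = 1
  · simp [h]
  · have : χ e = 0 := by omega
    simp [this]; omega

theorem keySum_out (hχ : ∀ e, χ e < 2) (v : ℕ) : keySum T (A.key χ) A.flow (2 * v) =
    ∑ e ∈ (Finset.range (2 ^ T)).filter (fun e => A.src e = v), if χ e = 0 then A.flow e else 0 := by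
  rw [keySum, keySet, Finset.sum_filter, Finset.sum_filter]
  refine Finset.sum_congr rfl fun e _ => ?_
  have := hχ e
  simp only [key, centre]
  by_cases h : χ e = 1
  · simp [h]; omega
  · have : χ e = 0 := by omega
    simp [this]

/-- Let `X ≥ Y` be the inflow and the outflow, and let `a` and `c` be the amounts selected by the
`j`-th bipartition. Both are at most `X`, so `X * min a c ≥ a * c`. Summed over `j`, the products `a
* c` contain every `flow e * flow e'` at least once, hence are at least `X * Y`; then `X` cancels.
-/
theorem gain_vertex (hA : A.Good T s) {v : ℕ} (hv : 0 ≤ A.excess T v) :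
    ∑ e ∈ (Finset.range (2 ^ T)).filter (fun e => A.src e = v), A.flow e ≤
      ∑ j ∈ Finset.range (2 * T), min (keySum T (A.key (chi T j)) A.flow (2 * v + 1))
        (keySum T (A.key (chi T j)) A.flow (2 * v)) := by
  set I := (Finset.range (2 ^ T)).filter (fun e => A.dst e = v) with hI
  set O := (Finset.range (2 ^ T)).filter (fun e => A.src e = v) with hO
  have hfI : ∀ e ∈ I, 0 ≤ A.flow e := fun e he =>
    hA.flow_nonneg e (Finset.mem_range.1 (Finset.mem_filter.1 he).1)
  have hfO : ∀ e ∈ O, 0 ≤ A.flow e := fun e he =>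
    hA.flow_nonneg e (Finset.mem_range.1 (Finset.mem_filter.1 he).1)
  set X := ∑ e ∈ I, A.flow e with hX
  set Y := ∑ e ∈ O, A.flow e with hY
  have hXY : Y ≤ X := by
    have : A.excess T v = X - Y := by
      rw [hX, hY, hI, hO, Finset.sum_filter, Finset.sum_filter, ← Finset.sum_sub_distrib]
      refine Finset.sum_congr rfl fun e _ => ?_
      split_ifs <;> ring
    omega
  have hY0 : 0 ≤ Y := Finset.sum_nonneg hfO
  have ite0 : ∀ (p : Prop) [Decidable p] (x : ℤ), 0 ≤ x → 0 ≤ if p then x else 0 := by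
    intro p _ x hx; split_ifs <;> omega
  have itele : ∀ (p : Prop) [Decidable p] (x : ℤ), 0 ≤ x → (if p then x else 0) ≤ x := by
    intro p _ x hx; split_ifs <;> omega
  rcases hY0.eq_or_lt with h0 | hpos
  · rw [← h0]
    refine Finset.sum_nonneg fun j _ => le_min ?_ ?_
    · rw [keySum_in (chi_lt T j)]
      exact Finset.sum_nonneg fun e he => ite0 _ _ (hfI e he)
    · rw [keySum_out (chi_lt T j)]
      exact Finset.sum_nonneg fun e he => ite0 _ _ (hfO e he)
  refine le_of_mul_le_mul_left ?_ (hpos.trans_le hXY)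
  conv_rhs => rw [Finset.mul_sum]
  have step : ∀ j ∈ Finset.range (2 * T), (∑ e ∈ I, ∑ e' ∈ O,
      if chi T j e = 1 ∧ chi T j e' = 0 then A.flow e * A.flow e' else 0) ≤
      X * min (keySum T (A.key (chi T j)) A.flow (2 * v + 1))
        (keySum T (A.key (chi T j)) A.flow (2 * v)) := by
    intro j _
    rw [keySum_in (chi_lt T j), keySum_out (chi_lt T j), ← hI, ← hO]
    set a := ∑ e ∈ I, if chi T j e = 1 then A.flow e else 0 with ha
    set c := ∑ e ∈ O, if chi T j e = 0 then A.flow e else 0 with hc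
    have ha0 : 0 ≤ a := Finset.sum_nonneg fun e he => ite0 _ _ (hfI e he)
    have hc0 : 0 ≤ c := Finset.sum_nonneg fun e he => ite0 _ _ (hfO e he)
    have haX : a ≤ X := Finset.sum_le_sum fun e he => itele _ _ (hfI e he)
    have hcX : c ≤ X :=
      (Finset.sum_le_sum fun e he => itele _ _ (hfO e he) : c ≤ Y).trans hXY
    have : (∑ e ∈ I, ∑ e' ∈ O,
        if chi T j e = 1 ∧ chi T j e' = 0 then A.flow e * A.flow e' else 0) = a * c := by
      rw [ha, hc, Finset.sum_mul_sum]
      refine Finset.sum_congr rfl fun e _ => Finset.sum_congr rfl fun e' _ => ?_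
      by_cases h1 : chi T j e = 1 <;> by_cases h2 : chi T j e' = 0 <;> simp [h1, h2]
    rw [this]
    rcases le_total a c with h | h
    · rw [min_eq_left h]; nlinarith
    · rw [min_eq_right h]; nlinarith
  refine le_trans ?_ (Finset.sum_le_sum step)
  rw [Finset.sum_comm]
  rw [hX, hY, Finset.sum_mul_sum]
  refine Finset.sum_le_sum fun e he => ?_
  rw [Finset.sum_comm]
  refine Finset.sum_le_sum fun e' he' => ?_
  have h1 := hfI e he
  have h2 := hfO e' he'
  have m1 := Finset.mem_filter.1 he
  have m2 := Finset.mem_filter.1 he'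
  have nn : ∀ j ∈ Finset.range (2 * T),
      0 ≤ if chi T j e = 1 ∧ chi T j e' = 0 then A.flow e * A.flow e' else 0 :=
    fun j _ => ite0 _ _ (mul_nonneg h1 h2)
  -- No bit separates an edge from itself, but an edge that both enters and leaves `v` is a loop and
  -- carries no flow.
  by_cases hee : e = e'
  · subst hee
    have : A.flow e = 0 := by
      by_contra hne
      exact hA.ne e (Finset.mem_range.1 m1.1) (by omega) (by rw [m1.2, m2.2])
    simp [this]
  · obtain ⟨j, hj, hj1, hj2⟩ := exists_chi (Finset.mem_range.1 m1.1) (Finset.mem_range.1 m2.1) hee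
    refine le_trans ?_ (Finset.single_le_sum nn (Finset.mem_range.2 hj))
    rw [if_pos ⟨hj1, hj2⟩]

/-- Some bipartition contracts a large fraction of the flow. -/
theorem pot_le_sum_gain (hA : A.Good T s) (hs : ∀ v < 2 ^ T, v ≠ s → 0 ≤ A.excess T v) :
    A.pot T s ≤ ∑ j ∈ Finset.range (2 * T), A.gain T (chi T j) := by
  unfold pot gain
  rw [Finset.sum_comm]
  have hmap : ∀ e ∈ Finset.range (2 ^ T), A.src e ∈ Finset.range (2 ^ T) := fun e he =>
    Finset.mem_range.2 (hA.src_lt e (Finset.mem_range.1 he))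
  rw [← Finset.sum_fiberwise_of_maps_to hmap]
  refine Finset.sum_le_sum fun v hv => ?_
  rw [Finset.mem_range] at hv
  by_cases hvs : v = s
  · rw [Finset.sum_eq_zero]
    · refine Finset.sum_nonneg fun j _ => le_min ?_ ?_ <;>
      · refine Finset.sum_nonneg fun e he => hA.flow_nonneg e ?_
        exact Finset.mem_range.1 (Finset.mem_filter.1 he).1
    · intro e he
      rw [if_pos ((Finset.mem_filter.1 he).2.trans hvs), mul_zero]
  · refine le_trans (le_of_eq ?_) (gain_vertex hA (hs v hv hvs))
    refine Finset.sum_congr rfl fun e he => ?_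
    rw [if_neg (by rw [(Finset.mem_filter.1 he).2]; exact hvs), mul_one]

end Net

end PRAM

namespace PRAM

namespace Net

/-! ### Distances -/

section Distances

variable {T s : ℕ} {D : ℤ} {A : Net} {φ : ℕ → ℤ}

/-- `φ` is an upper bound on distances from `s`, certified by edges with positive flow; the value
`D` stands for infinity. -/
structure Super (T s : ℕ) (D : ℤ) (A : Net) (φ : ℕ → ℤ) : Prop where
  nonneg : ∀ v < 2 ^ T, 0 ≤ φ v
  source : φ s = 0
  parent : ∀ v < 2 ^ T, v ≠ s → φ v < D → ∃ e < 2 ^ T, 0 < A.flow e ∧ A.dst e = v ∧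
    φ (A.src e) + A.len e ≤ φ v

/-- As `Super`, but the certificates may be paths of length two. -/
structure WeakSuper (T s : ℕ) (D : ℤ) (A : Net) (φ : ℕ → ℤ) : Prop where
  nonneg : ∀ v < 2 ^ T, 0 ≤ φ v
  source : φ s = 0
  parent : ∀ v < 2 ^ T, v ≠ s → φ v < D →
    (∃ e < 2 ^ T, 0 < A.flow e ∧ A.dst e = v ∧ φ (A.src e) + A.len e ≤ φ v) ∨
    ∃ e₁ < 2 ^ T, ∃ e₂ < 2 ^ T, 0 < A.flow e₁ ∧ 0 < A.flow e₂ ∧ A.dst e₁ = A.src e₂ ∧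
      A.dst e₂ = v ∧ φ (A.src e₁) + (A.len e₁ + A.len e₂) ≤ φ v

/-- The candidate for the distance of the end of `e`. -/
def cand (D : ℤ) (A : Net) (φ : ℕ → ℤ) (e : ℕ) : ℤ :=
  if A.flow e ≤ 0 then D else φ (A.src e) + A.len e

/-- One round of relaxation. -/
def relax (T : ℕ) (D : ℤ) (A : Net) (φ : ℕ → ℤ) (v : ℕ) : ℤ :=
  min (φ v) ((keySet T A.dst v).fold min D (cand D A φ))

theorem relax_le (v : ℕ) : relax T D A φ v ≤ φ v := min_le_left _ _

theorem relax_le_cand {e : ℕ} (he : e < 2 ^ T) (hf : 0 < A.flow e) :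
    relax T D A φ (A.dst e) ≤ φ (A.src e) + A.len e := by
  refine (min_le_right _ _).trans ?_
  rw [Finset.fold_min_le]
  right
  refine ⟨e, ?_, ?_⟩
  · simp [keySet, he]
  · rw [cand, if_neg (by omega)]

/-- If `e₁, e₂` certify a value, the relaxation along `e₁` lowers the middle vertex enough for `e₂`
alone to certify it in the same round. A value that is lowered is certified by the edge that lowered
it, since the values at the starts of edges only decrease. -/
theorem WeakSuper.relax (h : WeakSuper T s D A φ) (hA : A.Good T s) (hD : 0 ≤ D) :
    Super T s D A (relax T D A φ) := by
  have hn : ∀ v < 2 ^ T, 0 ≤ Net.relax T D A φ v := by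
    intro v hv
    refine le_min (h.nonneg v hv) ?_
    rw [Finset.le_fold_min]
    refine ⟨hD, fun e he => ?_⟩
    simp only [keySet, Finset.mem_filter, Finset.mem_range] at he
    rw [cand]
    split_ifs
    · exact hD
    · have := h.nonneg _ (hA.src_lt e he.1)
      have := hA.len_nonneg e he.1
      omega
  refine ⟨hn, ?_, ?_⟩
  · refine le_antisymm ((relax_le s).trans h.source.le) (le_min h.source.ge ?_)
    rw [Finset.le_fold_min]
    refine ⟨hD, fun e he => ?_⟩
    simp only [keySet, Finset.mem_filter, Finset.mem_range] at he
    rw [cand]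
    split_ifs with hf
    · exact hD
    · exact absurd he.2 (hA.dst_ne e he.1 (by omega))
  · intro v hv hvs hvD
    by_cases hc : φ v ≤ (keySet T A.dst v).fold min D (cand D A φ)
    · have hv' : Net.relax T D A φ v = φ v := min_eq_left hc
      rw [hv'] at hvD ⊢
      rcases h.parent v hv hvs hvD with ⟨e, he, hf, hd, hle⟩ |
        ⟨e₁, he₁, e₂, he₂, hf₁, hf₂, h12, hd, hle⟩
      · exact ⟨e, he, hf, hd, (add_le_add_left (relax_le _) _).trans hle⟩
      · refine ⟨e₂, he₂, hf₂, hd, ?_⟩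
        have := relax_le_cand (D := D) (φ := φ) he₁ hf₁
        rw [h12] at this
        omega
    · have hv' : Net.relax T D A φ v = (keySet T A.dst v).fold min D (cand D A φ) :=
        min_eq_right (by omega)
      rw [hv'] at hvD ⊢
      have := (Finset.fold_min_le (s := keySet T A.dst v) (b := D) (f := cand D A φ) _).1 le_rfl
      rcases this with h1 | ⟨e, he, h1⟩
      · omega
      · simp only [keySet, Finset.mem_filter, Finset.mem_range] at he
        have hf : 0 < A.flow e := by
          by_contra hf
          rw [cand, if_pos (by omega)] at h1
          omega
        rw [cand, if_neg (by omega)] at h1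
        exact ⟨e, he.1, hf, he.2, (add_le_add_left (relax_le _) _).trans h1⟩

/-- A certifying edge of the contracted net unfolds to an edge, or to a path of two edges, with
positive flow in the original net. -/
theorem Super.weak {A' : Net} {χ : ℕ → ℕ} {has : ℕ → Prop} {mate : ℕ → ℕ}
    (h : Super T s D A' φ) (hc : A.Contraction T s χ A' has mate) (hχ : ∀ e, χ e < 2) :
    WeakSuper T s D A φ := by
  refine ⟨h.nonneg, h.source, fun v hv hvs hvD => ?_⟩
  obtain ⟨e, he, hf, hd, hle⟩ := h.parent v hv hvs hvD
  rcases hc.provenance hχ he with ⟨h1, h2, h3⟩ | ⟨e₁, he₁, e₂, he₂, hf₁, hf₂, h12, h1, h2, h3⟩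
  · left
    refine ⟨e, he, flow_pos_of_segment_pos (hf.trans_le (hc.flow_le he).2), ?_, ?_⟩
    · rw [← h2, hd]
    · rw [← h1, ← h3]; exact hle
  · right
    refine ⟨e₁, he₁, e₂, he₂, hf₁, hf₂, h12, ?_, ?_⟩
    · rw [← h2, hd]
    · rw [← h1, ← h3]; exact hle

/-- Exchange of the order of summation. -/
theorem sum_excess (hA : A.Good T s) (ψ : ℕ → ℤ) (F : ℕ → ℤ) :
    ∑ v ∈ Finset.range (2 ^ T), ψ v * ({ A with flow := F } : Net).excess T v =
      ∑ e ∈ Finset.range (2 ^ T), F e * (ψ (A.dst e) - ψ (A.src e)) := by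
  simp only [excess, Finset.mul_sum]
  rw [Finset.sum_comm]
  refine Finset.sum_congr rfl fun e he => ?_
  rw [Finset.mem_range] at he
  have h1 := hA.src_lt e he
  have h2 := hA.dst_lt e he
  simp only [mul_sub, mul_ite, mul_one, mul_zero, Finset.sum_sub_distrib]
  rw [Finset.sum_ite_eq, Finset.sum_ite_eq, if_pos (Finset.mem_range.2 h1),
    if_pos (Finset.mem_range.2 h2)]
  ring

section Final

variable {b : ℕ → ℤ} (hA : A.Good T s) (hpot : A.pot T s = 0)
  (hb : ∀ v < 2 ^ T, v ≠ s → b v ≤ A.excess T v)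
include hA hpot

theorem src_eq_of_pot {e : ℕ} (he : e < 2 ^ T) (hf : 0 < A.flow e) : A.src e = s := by
  by_contra hne
  have := (Finset.sum_eq_zero_iff_of_nonneg (fun i hi => ?_)).1 hpot e (Finset.mem_range.2 he)
  · rw [if_neg hne] at this; omega
  · have := hA.flow_nonneg i (Finset.mem_range.1 hi)
    split_ifs <;> omega

include hb

/-- Weak duality, in the situation where every edge with flow starts at `s` and `φ` vanishes there.
-/
theorem sum_demand_le (hφ : ∀ v < 2 ^ T, 0 ≤ φ v) (hs : φ s = 0)
    (hle : ∀ e < 2 ^ T, 0 < A.flow e → φ (A.dst e) ≤ A.len e) :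
    ∑ v ∈ Finset.range (2 ^ T), b v * φ v ≤ A.cost T := by
  calc ∑ v ∈ Finset.range (2 ^ T), b v * φ v
      ≤ ∑ v ∈ Finset.range (2 ^ T), φ v * A.excess T v := by
        refine Finset.sum_le_sum fun v hv => ?_
        rw [Finset.mem_range] at hv
        by_cases hvs : v = s
        · subst hvs; simp [hs]
        · rw [mul_comm]
          exact mul_le_mul_of_nonneg_left (hb v hv hvs) (hφ v hv)
    _ = ∑ e ∈ Finset.range (2 ^ T), A.flow e * (φ (A.dst e) - φ (A.src e)) :=
        sum_excess hA φ A.flow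
    _ ≤ A.cost T := by
        refine Finset.sum_le_sum fun e he => ?_
        rw [Finset.mem_range] at he
        rcases (hA.flow_nonneg e he).eq_or_lt with h0 | h0
        · simp [← h0]
        · rw [src_eq_of_pot hA hpot he h0, hs, sub_zero]
          exact mul_le_mul_of_nonneg_left (hle e he h0) h0.le

omit hpot in
-- A vertex with positive demand has an entering edge with flow at least one, whose length is at
-- most the cost. This keeps vertices with demand below the value that stands for infinity.
theorem reached_of_demand (hle : ∀ e < 2 ^ T, 0 < A.flow e → φ (A.dst e) ≤ A.len e)
    {v : ℕ} (hv : v < 2 ^ T) (hvs : v ≠ s) (hbv : 0 < b v) : φ v ≤ A.cost T := by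
  have hex := hbv.trans_le (hb v hv hvs)
  obtain ⟨e, he, h0⟩ := Finset.exists_lt_of_sum_lt
    (show ∑ e ∈ Finset.range (2 ^ T), (0 : ℤ) < A.excess T v by simpa using hex)
  rw [Finset.mem_range] at he
  have hf0 := hA.flow_nonneg e he
  have hd : A.dst e = v := by
    by_contra hne
    rw [if_neg hne] at h0
    split_ifs at h0 <;> nlinarith
  have hf : 0 < A.flow e := by
    rcases hf0.eq_or_lt with h | h
    · rw [← h, zero_mul] at h0; omega
    · exact h
  rw [← hd]
  refine (hle e he hf).trans ?_
  have h1 : A.len e ≤ A.flow e * A.len e := by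
    have := hA.len_nonneg e he
    nlinarith
  exact h1.trans (Finset.single_le_sum (f := fun e => A.flow e * A.len e)
    (fun i hi => mul_nonneg (hA.flow_nonneg i (Finset.mem_range.1 hi))
      (hA.len_nonneg i (Finset.mem_range.1 hi))) (Finset.mem_range.2 he))

end Final

end Distances

/-! ### Routing along a tree -/

section Tree

/-- The sum of `b` over the vertices from which less than `k` applications of `q` lead to `v`. -/
def subtreeSum (N : ℕ) (q : ℕ → ℕ) (b : ℕ → ℤ) (k v : ℕ) : ℤ :=
  ∑ u ∈ Finset.range N, b u * ∑ i ∈ Finset.range k, if q^[i] u = v then 1 else 0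

variable {N : ℕ} {q : ℕ → ℕ} {b : ℕ → ℤ}

theorem subtreeSum_one {v : ℕ} (hv : v < N) : subtreeSum N q b 1 v = b v := by
  rw [subtreeSum, Finset.sum_eq_single_of_mem v (Finset.mem_range.2 hv)]
  · rw [Finset.sum_range_one, if_pos (Function.iterate_zero_apply q v), mul_one]
  · intro u _ hu
    rw [Finset.sum_range_one, if_neg (by rwa [Function.iterate_zero_apply]), mul_zero]

theorem iterate_fix (hq : q N = N) (i : ℕ) : q^[i] N = N := Function.iterate_fixed hq i

theorem iterate_le (hN : ∀ v ≤ N, q v ≤ N) {u : ℕ} (hu : u ≤ N) (i : ℕ) : q^[i] u ≤ N := by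
  induction i with
  | zero => exact hu
  | succ i ih => rw [Function.iterate_succ_apply']; exact hN _ ih

/-- The step behind pointer doubling: `l + i` applications of `q` lead from `w` to `v` exactly if
`i` applications lead to some `u < N` with `q^[l] u = v`. The absorbing value `N` stands for a
missing parent, and no path returns from it. -/
theorem subtreeSum_add (hN : ∀ v ≤ N, q v ≤ N) (hq : q N = N) (k l : ℕ) {v : ℕ} (hv : v < N) :
    subtreeSum N q b (l + k) v = subtreeSum N q b l v +
      ∑ u ∈ (Finset.range N).filter (fun u => q^[l] u = v), subtreeSum N q b k u := by
  simp only [subtreeSum]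
  rw [Finset.sum_comm, ← Finset.sum_add_distrib]
  refine Finset.sum_congr rfl fun w hw => ?_
  rw [← Finset.mul_sum, ← mul_add, Finset.sum_range_add]
  congr 2
  rw [Finset.sum_comm]
  refine Finset.sum_congr rfl fun i _ => ?_
  rw [Finset.sum_ite_eq]
  congr 1
  rw [Finset.mem_filter, Finset.mem_range, Function.iterate_add_apply, eq_iff_iff]
  constructor
  · intro h
    refine ⟨lt_of_le_of_ne (iterate_le hN (Finset.mem_range.1 hw).le i) fun hc => ?_, h⟩
    rw [hc, iterate_fix hq] at h; omega
  · exact fun h => h.2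

/-- Once all paths have been absorbed, a further step contributes nothing, so `subtreeSum_add`
becomes the conservation law at `v`. -/
theorem subtreeSum_sub (hN : ∀ v ≤ N, q v ≤ N) (hq : q N = N) {k : ℕ}
    (hk : ∀ u < N, q^[k] u = N) {v : ℕ} (hv : v < N) :
    subtreeSum N q b k v -
      ∑ u ∈ (Finset.range N).filter (fun u => q u = v), subtreeSum N q b k u = b v := by
  have h1 := subtreeSum_add (b := b) hN hq k 1 hv
  have h2 : subtreeSum N q b (1 + k) v = subtreeSum N q b k v := by
    simp only [subtreeSum]
    refine Finset.sum_congr rfl fun u hu => ?_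
    rw [add_comm 1 k, Finset.sum_range_succ, hk u (Finset.mem_range.1 hu), if_neg (by omega),
      add_zero]
  rw [h2, subtreeSum_one hv] at h1
  simp only [Function.iterate_one] at h1
  omega

/-- Below `N` the pointers strictly decrease `φ`; by the pigeonhole principle `N + 1` successive
iterates cannot all stay below `N`. -/
theorem iterate_eq_top (hN : ∀ v ≤ N, q v ≤ N) (hq : q N = N) {φ : ℕ → ℤ}
    (hφ : ∀ v < N, q v < N → φ (q v) < φ v) {u : ℕ} (hu : u < N) : q^[N] u = N := by
  by_contra hne
  have hlt : ∀ i ≤ N, q^[i] u < N := by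
    intro i hi
    refine lt_of_le_of_ne (iterate_le hN hu.le i) fun hc => hne ?_
    have : N = (N - i) + i := by omega
    conv_lhs => rw [this]
    rw [Function.iterate_add_apply, hc, iterate_fix hq]
  have hanti : ∀ i ≤ N, ∀ j < i, φ (q^[i] u) < φ (q^[j] u) := by
    intro i
    induction i with
    | zero => intro _ j hj; omega
    | succ i ih =>
      intro hi j hj
      have h1 : φ (q^[i + 1] u) < φ (q^[i] u) := by
        rw [Function.iterate_succ_apply']
        refine hφ _ (hlt i (by omega)) ?_
        have := hlt (i + 1) hi
        rwa [Function.iterate_succ_apply'] at this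
      rcases Nat.lt_succ_iff_lt_or_eq.1 hj with h | rfl
      · exact h1.trans (ih (by omega) j h)
      · exact h1
  obtain ⟨i, hi, j, hj, hij, he⟩ := Finset.exists_ne_map_eq_of_card_lt_of_maps_to
    (s := Finset.range (N + 1)) (t := Finset.range N) (by simp) (f := fun i => q^[i] u)
    (fun i hi => by
      simp only [Finset.coe_range, Set.mem_Iio] at hi ⊢
      exact hlt i (by omega))
  simp only [Finset.mem_range] at hi hj
  rcases lt_or_gt_of_ne hij with h | h
  · have := hanti j (by omega) i h; simp only [he] at this; omega
  · have := hanti i (by omega) j h; simp only [he] at this; omega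

/-- The vertices `v` with `par v` have a parent edge `pe v`. -/
structure ParentEdges (T s : ℕ) (D : ℤ) (A : Net) (φ : ℕ → ℤ) (par : ℕ → Prop) (pe : ℕ → ℕ) :
    Prop where
  par_iff : ∀ v < 2 ^ T, par v ↔ v ≠ s ∧ φ v < D
  pe_lt : ∀ v < 2 ^ T, par v → pe v < 2 ^ T
  flow_pos : ∀ v < 2 ^ T, par v → 0 < A.flow (pe v)
  dst_pe : ∀ v < 2 ^ T, par v → A.dst (pe v) = v
  le : ∀ v < 2 ^ T, par v → φ (A.src (pe v)) + A.len (pe v) ≤ φ v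

open Classical in
/-- The parent of a vertex, or `2 ^ T` if there is none. -/
noncomputable def parentOf (T : ℕ) (A : Net) (par : ℕ → Prop) (pe : ℕ → ℕ) (v : ℕ) : ℕ :=
  if v < 2 ^ T ∧ par v then A.src (pe v) else 2 ^ T

open Classical in
/-- The flow along the parent edges. -/
noncomputable def treeFlow (T : ℕ) (A : Net) (par : ℕ → Prop) (pe : ℕ → ℕ) (b : ℕ → ℤ) (e : ℕ) :
    ℤ :=
  if par (A.dst e) ∧ pe (A.dst e) = e then
    subtreeSum (2 ^ T) (parentOf T A par pe) b (2 ^ T) (A.dst e) else 0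

variable {T s : ℕ} {D : ℤ} {A : Net} {φ : ℕ → ℤ} {par : ℕ → Prop} {pe : ℕ → ℕ}

theorem parentOf_top : parentOf T A par pe (2 ^ T) = 2 ^ T := by simp [parentOf]

variable (hA : A.Good T s) (hlen : ∀ e < 2 ^ T, 1 ≤ A.len e)
  (h : ParentEdges T s D A φ par pe)
include hA h

theorem parentOf_le (v : ℕ) (_ : v ≤ 2 ^ T) : parentOf T A par pe v ≤ 2 ^ T := by
  unfold parentOf
  split_ifs with hv
  · exact (hA.src_lt _ (h.pe_lt v hv.1 hv.2)).le
  · exact le_rfl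

include hlen

theorem parentOf_iterate {u : ℕ} (hu : u < 2 ^ T) : (parentOf T A par pe)^[2 ^ T] u = 2 ^ T := by
  refine iterate_eq_top (φ := φ) (parentOf_le hA h) parentOf_top (fun v hv hv' => ?_) hu
  unfold parentOf at hv' ⊢
  split_ifs at hv' ⊢ with hp
  · have := h.le v hv hp.2
    have := hlen _ (h.pe_lt v hv hp.2)
    omega
  · omega

/-- Lengths are positive, so the start of a parent edge has a smaller value of `φ`, which is still
below `D`. -/
theorem par_src {v : ℕ} (hv : v < 2 ^ T) (hp : par v) :
    A.src (pe v) = s ∨ par (A.src (pe v)) := by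
  have h1 := h.le v hv hp
  have h2 := hlen _ (h.pe_lt v hv hp)
  have h3 := ((h.par_iff v hv).1 hp).2
  rw [h.par_iff _ (hA.src_lt _ (h.pe_lt v hv hp))]
  by_cases hc : A.src (pe v) = s
  · exact .inl hc
  · exact .inr ⟨hc, by omega⟩

variable (hb : ∀ v < 2 ^ T, v ≠ s → 0 ≤ b v) (hbD : ∀ v < 2 ^ T, v ≠ s → 0 < b v → φ v < D)
include hb

omit hlen in
-- The possibly negative demand of `s` enters no subtree but its own, because `s` has no parent.
theorem subtreeSum_nonneg {v : ℕ} (hv : v < 2 ^ T) (hvs : v ≠ s) :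
    0 ≤ subtreeSum (2 ^ T) (parentOf T A par pe) b (2 ^ T) v := by
  refine Finset.sum_nonneg fun u hu => ?_
  rw [Finset.mem_range] at hu
  by_cases hus : u = s
  · rw [Finset.sum_eq_zero, mul_zero]
    intro i _
    apply if_neg
    subst hus
    cases i with
    | zero => exact fun hc => hvs hc.symm
    | succ i =>
      have : parentOf T A par pe u = 2 ^ T := by
        unfold parentOf
        rw [if_neg]
        rintro ⟨h1, h2⟩
        exact ((h.par_iff u h1).1 h2).1 rfl
      rw [Function.iterate_succ_apply, this, iterate_fix parentOf_top]
      omega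
  · exact mul_nonneg (hb u hu hus) (Finset.sum_nonneg fun i _ => by split_ifs <;> norm_num)

omit hlen in
theorem treeFlow_nonneg {e : ℕ} (he : e < 2 ^ T) : 0 ≤ treeFlow T A par pe b e := by
  unfold treeFlow
  split_ifs with hp
  · have hd := hA.dst_lt e he
    exact subtreeSum_nonneg hA h hb hd ((h.par_iff _ hd).1 hp.1).1
  · exact le_rfl

include hbD

/-- The inflow is the demand of the subtree of `v`, and the outflow is the sum of those of its
children. -/
theorem treeFlow_excess_of_ne {v : ℕ} (hv : v < 2 ^ T) (hvs : v ≠ s) :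
    ({ A with flow := treeFlow T A par pe b } : Net).excess T v = b v := by
  classical
  set q := parentOf T A par pe with hq
  have hin : ∑ e ∈ Finset.range (2 ^ T), treeFlow T A par pe b e *
      (if A.dst e = v then 1 else 0) =
      if par v then subtreeSum (2 ^ T) q b (2 ^ T) v else 0 := by
    split_ifs with hp
    · rw [Finset.sum_eq_single_of_mem (pe v) (Finset.mem_range.2 (h.pe_lt v hv hp))]
      · simp [treeFlow, h.dst_pe v hv hp, hp, hq]
      · intro e _ hne
        by_cases hd : A.dst e = v
        · rw [treeFlow, if_neg, zero_mul]
          rw [hd]; exact fun hc => hne hc.2.symm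
        · rw [if_neg hd, mul_zero]
    · refine Finset.sum_eq_zero fun e _ => ?_
      by_cases hd : A.dst e = v
      · rw [treeFlow, if_neg, zero_mul]
        rw [hd]; exact fun hc => hp hc.1
      · rw [if_neg hd, mul_zero]
  have hout : ∑ e ∈ Finset.range (2 ^ T), treeFlow T A par pe b e *
      (if A.src e = v then 1 else 0) =
      ∑ w ∈ (Finset.range (2 ^ T)).filter (fun w => q w = v), subtreeSum (2 ^ T) q b (2 ^ T) w := by
    have hmap : ∀ e ∈ Finset.range (2 ^ T), A.dst e ∈ Finset.range (2 ^ T) := fun e he =>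
      Finset.mem_range.2 (hA.dst_lt e (Finset.mem_range.1 he))
    rw [← Finset.sum_fiberwise_of_maps_to hmap, Finset.sum_filter]
    refine Finset.sum_congr rfl fun w hw => ?_
    rw [Finset.mem_range] at hw
    by_cases hp : par w
    · have hqw : q w = A.src (pe w) := by rw [hq, parentOf, if_pos ⟨hw, hp⟩]
      rw [Finset.sum_eq_single_of_mem (pe w)
        (Finset.mem_filter.2 ⟨Finset.mem_range.2 (h.pe_lt w hw hp), h.dst_pe w hw hp⟩)]
      · simp [treeFlow, h.dst_pe w hw hp, hp, hqw, ← hq]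
      · intro e he hne
        rw [treeFlow, if_neg, zero_mul]
        rw [(Finset.mem_filter.1 he).2]; exact fun hc => hne hc.2.symm
    · have hqw : q w = 2 ^ T := by rw [hq, parentOf, if_neg (fun hc => hp hc.2)]
      rw [if_neg (by omega)]
      refine Finset.sum_eq_zero fun e he => ?_
      rw [treeFlow, if_neg, zero_mul]
      rw [(Finset.mem_filter.1 he).2]; exact fun hc => hp hc.1
  have hsplit : ({ A with flow := treeFlow T A par pe b } : Net).excess T v =
      (if par v then subtreeSum (2 ^ T) q b (2 ^ T) v else 0) -
      ∑ w ∈ (Finset.range (2 ^ T)).filter (fun w => q w = v),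
        subtreeSum (2 ^ T) q b (2 ^ T) w := by
    rw [← hin, ← hout, ← Finset.sum_sub_distrib]
    exact Finset.sum_congr rfl fun e _ => mul_sub _ _ _
  rw [hsplit]
  have hsub := subtreeSum_sub (b := b) (parentOf_le hA h) parentOf_top
    (fun u hu => parentOf_iterate hA hlen h hu) hv
  by_cases hp : par v
  · rw [if_pos hp]; exact hsub
  -- A vertex outside the tree has zero demand, by `hbD`, and no children, by `par_src`.
  · rw [if_neg hp, Finset.filter_eq_empty_iff.2, Finset.sum_empty]
    · have h1 := (h.par_iff v hv).not.1 hp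
      have h2 := hb v hv hvs
      have h3 := hbD v hv hvs
      by_contra hne
      exact h1 ⟨hvs, h3 (by omega)⟩
    · intro w hw hqw
      rw [Finset.mem_range] at hw
      rw [hq] at hqw
      unfold parentOf at hqw
      split_ifs at hqw with hpw
      · rcases par_src hA hlen h hw hpw.2 with h1 | h1
        · exact hvs (hqw ▸ h1)
        · exact hp (hqw ▸ h1)
      · omega

variable (hsum : ∑ v ∈ Finset.range (2 ^ T), b v = 0)
include hsum

theorem treeFlow_excess {v : ℕ} (hv : v < 2 ^ T) :
    ({ A with flow := treeFlow T A par pe b } : Net).excess T v = b v := by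
  by_cases hvs : v = s
  -- At the source the balance follows from the others, since both sides sum to zero over all
  -- vertices.
  · subst hvs
    have h1 := sum_excess hA (fun _ => 1) (treeFlow T A par pe b)
    simp only [one_mul, sub_self, mul_zero, Finset.sum_const_zero] at h1
    rw [← Finset.sum_erase_add _ _ (Finset.mem_range.2 hv)] at h1 hsum
    rw [Finset.sum_congr rfl (g := b)] at h1
    · linarith
    · intro u hu
      rw [Finset.mem_erase, Finset.mem_range] at hu
      exact treeFlow_excess_of_ne hA hlen h hb hbD hu.2 hu.1
  · exact treeFlow_excess_of_ne hA hlen h hb hbD hv hvs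

/-- On a parent edge the length is at most the increase of `φ`; summation by parts turns the total
increase into `∑ b v * φ v`. -/
theorem treeFlow_cost :
    ({ A with flow := treeFlow T A par pe b } : Net).cost T ≤
      ∑ v ∈ Finset.range (2 ^ T), b v * φ v := by
  have h1 : ∑ v ∈ Finset.range (2 ^ T), b v * φ v = ∑ v ∈ Finset.range (2 ^ T),
      φ v * ({ A with flow := treeFlow T A par pe b } : Net).excess T v := by
    refine Finset.sum_congr rfl fun v hv => ?_
    rw [treeFlow_excess hA hlen h hb hbD hsum (Finset.mem_range.1 hv), mul_comm]
  rw [h1, sum_excess hA]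
  refine Finset.sum_le_sum fun e he => ?_
  rw [Finset.mem_range] at he
  by_cases hp : par (A.dst e) ∧ pe (A.dst e) = e
  · have h2 := h.le _ (hA.dst_lt e he) hp.1
    rw [hp.2] at h2
    exact mul_le_mul_of_nonneg_left (by simp only; omega) (treeFlow_nonneg hA h hb he)
  · have h0 : treeFlow T A par pe b e = 0 := if_neg hp
    simp [h0]

end Tree

end Net

end PRAM

/-! ### The machine representation of a net, and the choice of the best bipartition. -/

namespace PRAM

/-- Start points of the edges of all rounds. -/
abbrev aS : ℕ := 21
/-- End points of the edges. -/
abbrev aD : ℕ := 22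
/-- Lengths of the edges. -/
abbrev aL : ℕ := 23
/-- Flow through the edges. -/
abbrev aF : ℕ := 24
/-- Address of the first edge of the round. -/
abbrev aBASE : ℕ := 25
/-- The source. -/
abbrev aSS : ℕ := 26
/-- The demand. -/
abbrev aBV : ℕ := 27
/-- Codes of the edge slots. -/
abbrev aCODE : ℕ := 31
/-- Remaining bits of the codes. -/
abbrev aY : ℕ := 32
/-- Gain of the best bipartition. -/
abbrev aBEST : ℕ := 33
/-- The best bipartition. -/
abbrev aXB : ℕ := 34
/-- Gains at the vertices. -/
abbrev aMV : ℕ := 35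
/-- Gain of the bipartition. -/
abbrev aTOT : ℕ := 36
/-- The potential. -/
abbrev aPP : ℕ := 37
/-- Counter of outer loops. -/
abbrev aJ : ℕ := 42
/-- Whether the edge has a mate. -/
abbrev aHAS : ℕ := 43

/-- The entry of the array `a` for the processor and the current round. -/
abbrev cur (a : ℕ) : Expr := .read a (.add (sc aBASE) .pid)

/-- The reduction over the group with the key `e`. -/
abbrev rootE (e : Expr) : Expr := .read aT (.add (.read aVB e) (.const 1))

theorem Forest.eval_root {T : ℕ} {key : ℕ → ℕ} {f : ℤ → ℤ → ℤ} [Std.Commutative f]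
    [Std.Associative f] {z : ℤ} {val : ℕ → ℤ} {M : Mem} (h : Forest T key f z val M)
    (hB : Base T M) {e : Expr} {i k : ℕ} (he : e.eval M i = k) (hk : k < 2 * 2 ^ T) :
    (rootE e).eval M i = (keySet T key k).fold f z val := by
  simp only [Expr.eval, he, hB.addr k hk]
  exact h.root hk

theorem SumForest.eval_root {T : ℕ} {key : ℕ → ℕ} {val : ℕ → ℤ} {M : Mem}
    (h : SumForest T key val M) (hB : Base T M) {e : Expr} {i k : ℕ} (he : e.eval M i = k)
    (hk : k < 2 * 2 ^ T) : (rootE e).eval M i = keySum T key val k :=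
  Forest.eval_root h hB he hk

/-- The edges stored at the address `o` are those of `A`. -/
structure HasNet (T : ℕ) (o : ℤ) (A : Net) (M : Mem) : Prop where
  src : ∀ i < 2 ^ T, M aS (o + (i : ℕ)) = A.src i
  dst : ∀ i < 2 ^ T, M aD (o + (i : ℕ)) = A.dst i
  len : ∀ i < 2 ^ T, M aL (o + (i : ℕ)) = A.len i
  flow : ∀ i < 2 ^ T, M aF (o + (i : ℕ)) = A.flow i

theorem HasNet.mono {T : ℕ} {o : ℤ} {A : Net} {M M' : Mem} (h : HasNet T o A M)
    (h1 : M' aS = M aS) (h2 : M' aD = M aD) (h3 : M' aL = M aL) (h4 : M' aF = M aF) :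
    HasNet T o A M' :=
  ⟨by rw [h1]; exact h.src, by rw [h2]; exact h.dst, by rw [h3]; exact h.len,
    by rw [h4]; exact h.flow⟩

/-- The group of the edge of the processor, for the bipartition `x`. -/
def keyE (x : Expr) : Expr :=
  .ifLE (.const 1) x (.add (dbl (cur aD)) (.const 1)) (dbl (cur aS))

/-- The group of the edges that may be contracted with the edge of the processor. -/
def oppE (x : Expr) : Expr :=
  .ifLE (.const 1) x (dbl (cur aD)) (.add (dbl (cur aS)) (.const 1))

theorem HasNet.eval_keyE {T : ℕ} {o : ℤ} {A : Net} {M : Mem} (h : HasNet T o A M)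
    (ho : M aBASE 0 = o) {χ : ℕ → ℕ} (hχ : ∀ e, χ e < 2) {x : Expr} {i : ℕ} (hi : i < 2 ^ T)
    (hx : x.eval M i = χ i) : (keyE x).eval M i = A.key χ i := by
  have := hχ i
  simp only [keyE, Expr.eval, hx, ho, h.dst i hi, h.src i hi, Net.key, Net.centre]
  rcases (show χ i = 0 ∨ χ i = 1 by omega) with hc | hc
  · simp [hc]; ring
  · simp [hc]; ring

theorem HasNet.eval_oppE {T : ℕ} {o : ℤ} {A : Net} {M : Mem} (h : HasNet T o A M)
    (ho : M aBASE 0 = o) {χ : ℕ → ℕ} (hχ : ∀ e, χ e < 2) {x : Expr} {i : ℕ} (hi : i < 2 ^ T)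
    (hx : x.eval M i = χ i) : (oppE x).eval M i = A.opp χ i := by
  have := hχ i
  simp only [oppE, Expr.eval, hx, ho, h.dst i hi, h.src i hi, Net.opp, Net.centre]
  rcases (show χ i = 0 ∨ χ i = 1 by omega) with hc | hc
  · simp [hc]; ring
  · simp [hc]; ring

theorem Net.Good.key_lt {T s : ℕ} {A : Net} (hA : A.Good T s) {χ : ℕ → ℕ} (hχ : ∀ e, χ e < 2)
    {i : ℕ} (hi : i < 2 ^ T) : A.key χ i < 2 * 2 ^ T ∧ A.opp χ i < 2 * 2 ^ T := by
  have h1 := hA.src_lt i hi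
  have h2 := hA.dst_lt i hi
  have h3 := hχ i
  simp only [Net.key, Net.opp, Net.centre]
  split_ifs <;> omega

/-- The lowest remaining bit of the code. -/
def chiE : Expr := .sub (rd aY) (dbl (.half (rd aY)))

/-- Find the best bipartition. -/
def bestChi : Prog :=
  .seq (pmap (sc aN) aY (rd aCODE)) <|
  .seq (pset aBEST (.const (-1))) <|
  pfor aJ (.half (.read aVB (sc aN))) <|
    .seq (gsum (keyE chiE) (cur aF)) <|
    .seq (pmap (sc aN) aMV (emin (rootE (.add (dbl .pid) (.const 1))) (rootE (dbl .pid)))) <|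
    .seq (gtotal aTOT (rd aMV)) <|
    .seq (pmap (sc aN) aXB (.ifLE (sc aTOT) (sc aBEST) (rd aXB) chiE)) <|
    .seq (pset aBEST (emax (sc aTOT) (sc aBEST))) <|
    pmap (sc aN) aY (.half (rd aY))

theorem eval_chiE {M : Mem} {i T j : ℕ} (h : M aY (i : ℕ) = ((Net.code T i / 2 ^ j : ℕ) : ℤ)) :
    chiE.eval M i = Net.chi T j i := by
  simp only [chiE, Expr.eval, h, Net.chi]
  omega

theorem Net.Good.gain_nonneg {T s : ℕ} {A : Net} (hA : A.Good T s) (χ : ℕ → ℕ) :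
    0 ≤ A.gain T χ := by
  refine Finset.sum_nonneg fun v _ => le_min ?_ ?_ <;>
  · refine Finset.sum_nonneg fun e he => hA.flow_nonneg e ?_
    exact Finset.mem_range.1 (Finset.mem_filter.1 he).1

theorem bestChi_runs {W T : ℕ} (hW : 2 * 2 ^ T + 1 ≤ W) (hT : 0 < T) {M : Mem} (hB : Base T M)
    {s : ℕ} {o : ℤ} {A : Net} (hA : A.Good T s) (hnet : HasNet T o A M) (ho : M aBASE 0 = o)
    (hcode : ∀ i < 2 ^ T, M aCODE (i : ℕ) = (Net.code T i : ℕ)) :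
    Runs W bestChi M (2 * T * (20 * T + 33) + 4) fun M' => ∃ j,
      (∀ i < 2 ^ T, M' aXB (i : ℕ) = Net.chi T j i) ∧
      ∀ j' < 2 * T, A.gain T (Net.chi T j') ≤ A.gain T (Net.chi T j) := by
  obtain ⟨hW1, hW2⟩ := two_pow_succ_le hW
  refine Runs.le (T := 1 + (1 + ((2 * T) * ((20 * T + 31) + 2) + 2))) ?_ (by ring_nf; omega)
  refine Runs.pmap_seq (2 ^ T) (by simp [Expr.eval, hB.size]) hW1 ?_
  refine Runs.pset_seq hW2 ?_
  set M1 := Function.update (Function.update M aY _) aBEST _ with hM1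
  have hB1 : Base T M1 := hB.mono (by simp [hM1]) (by simp [hM1])
  have hnet1 : HasNet T o A M1 :=
    hnet.mono (by simp [hM1]) (by simp [hM1]) (by simp [hM1]) (by simp [hM1])
  have ho1 : M1 aBASE 0 = o := by simp [hM1, ho]
  have hY1 : ∀ i < 2 ^ T, M1 aY (i : ℕ) = (Net.code T i : ℕ) := by
    intro i hi; simp [hM1, hi, Expr.eval, hcode i hi]
  have hbest1 : M1 aBEST 0 = -1 := by simp [hM1, Expr.eval]
  clear_value M1
  -- With `N = 2 ^ T`, the tree with key `N` has address `2 * N * N`; half of it is `2 ^ (2 * T)`,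
  -- which makes the loop run once for every bit of the codes.
  have hNN : (Expr.half (.read aVB (sc aN))).eval M1 0 = 2 ^ (2 * T) := by
    have h2 := hB1.addr (2 ^ T) (by have := Nat.one_le_two_pow (n := T); omega)
    push_cast at h2
    simp only [Expr.eval, hB1.size, h2]
    rw [show (2 : ℤ) ^ T * (2 * 2 ^ T) = 2 * (2 ^ (2 * T)) by ring]
    simp
  refine (Runs.pfor hW2 (K := 2 * T) (I := fun r M' =>
    (∀ i < 2 ^ T, M' aY (i : ℕ) = ((Net.code T i / 2 ^ r : ℕ) : ℤ)) ∧
    (∀ j' < r, A.gain T (Net.chi T j') ≤ M' aBEST 0) ∧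
    ((r = 0 ∧ M' aBEST 0 = -1) ∨ ∃ j, (∀ i < 2 ^ T, M' aXB (i : ℕ) = Net.chi T j i) ∧
      M' aBEST 0 = A.gain T (Net.chi T j))) hNN (by decide) ?_ ?_).mono le_rfl ?_
  · intro z
    refine ⟨?_, fun j' hj' => by omega, .inl ⟨rfl, by simp [hbest1]⟩⟩
    simpa using hY1
  · rintro r hr M2 hs ⟨hY, hle, hbest⟩
    have hB2 : Base T M2 := hB1.mono (hs _ (by decide)) (hs _ (by decide))
    have hnet2 : HasNet T o A M2 := hnet1.mono (hs _ (by decide)) (hs _ (by decide))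
      (hs _ (by decide)) (hs _ (by decide))
    have ho2 : M2 aBASE 0 = o := by rw [hs _ (by decide), ho1]
    have hχ := Net.chi_lt T r
    refine Runs.le
      (T := (10 * T + 13) + (1 + ((10 * T + 14) + (1 + (1 + 1))))) ?_ (by omega)
    refine (gsum_runs hW hB2 (key := A.key (Net.chi T r)) (val := A.flow)
      (fun i hi => hnet2.eval_keyE ho2 hχ hi (eval_chiE (hY i hi)))
      (fun i hi => (hA.key_lt hχ hi).1)
      (fun y i hi => by simp [Expr.eval, ho2, hnet2.flow i hi])).seq fun M3 hs3 hF => ?_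
    rw [gsum, gred_writes] at hs3
    have hB3 : Base T M3 := hB2.mono (hs3 _ (by decide)) (hs3 _ (by decide))
    refine Runs.pmap_seq (2 ^ T) (by simp [Expr.eval, hB3.size]) hW1 ?_
    set M4 := Function.update M3 aMV _ with hM4
    have hMV : ∀ i < 2 ^ T, M4 aMV (i : ℕ) =
        min (keySum T (A.key (Net.chi T r)) A.flow (2 * i + 1))
          (keySum T (A.key (Net.chi T r)) A.flow (2 * i)) := by
      intro i hi
      simp only [hM4, Function.update_self, arr_lt hi]
      rw [eval_emin]
      rw [hF.eval_root hB3 (k := 2 * i + 1) (by simp [Expr.eval, two_mul]) (by omega),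
        hF.eval_root hB3 (k := 2 * i) (by simp [Expr.eval, two_mul]) (by omega)]
    have hB4 : Base T M4 := hB3.mono (by simp [hM4]) (by simp [hM4])
    have hY4 : M4 aY = M2 aY := by rw [← hs3 aY (by decide)]; simp [hM4]
    have hX4 : M4 aXB = M2 aXB := by rw [← hs3 aXB (by decide)]; simp [hM4]
    have hb4 : M4 aBEST = M2 aBEST := by rw [← hs3 aBEST (by decide)]; simp [hM4]
    clear_value M4
    refine (gtotal_runs hW hB4 (a := aTOT) (val := fun i =>
      min (keySum T (A.key (Net.chi T r)) A.flow (2 * i + 1))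
          (keySum T (A.key (Net.chi T r)) A.flow (2 * i))) (fun y i hi => by
        simp [Expr.eval, hMV i hi])).seq fun M5 hs5 htot => ?_
    have hB5 : Base T M5 := hB4.mono (hs5 _ (by decide)) (hs5 _ (by decide))
    have hY5 : M5 aY = M2 aY := by rw [hs5 aY (by decide), hY4]
    have hX5 : M5 aXB = M2 aXB := by rw [hs5 aXB (by decide), hX4]
    have hb5 : M5 aBEST = M2 aBEST := by rw [hs5 aBEST (by decide), hb4]
    change M5 aTOT 0 = A.gain T (Net.chi T r) at htot
    refine Runs.pmap_seq (2 ^ T) (by simp [Expr.eval, hB5.size]) hW1 ?_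
    refine Runs.pset_seq hW2 ?_
    refine Runs.pmap (2 ^ T) (by simp [Expr.eval, hB5.size]) hW1 ?_
    intro z
    have hbest' : ∀ z' z'', (Function.update (Function.update (Function.update M5 aXB z') aBEST
        (arr 1 (fun i => (emax (sc aTOT) (sc aBEST)).eval (Function.update M5 aXB z') i)
          (Function.update M5 aXB z' aBEST))) aY z'') aBEST 0 =
        max (A.gain T (Net.chi T r)) (M2 aBEST 0) := by
      intro z' z''
      rw [Function.update_of_ne (by decide), Function.update_self, arr_one_zero, eval_emax]
      simp [Expr.eval, htot, hb5]
    refine ⟨?_, ?_, .inr ?_⟩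
    · intro i hi
      simp only [Function.update_of_ne (show aY ≠ aJ by decide), Function.update_self, arr_lt hi,
        Expr.eval, Function.update_of_ne (show aY ≠ aBEST by decide),
        Function.update_of_ne (show aY ≠ aXB by decide), hY5, hY i hi]
      rw [pow_succ, ← Nat.div_div_eq_div_mul]; push_cast; rfl
    · intro j' hj'
      rw [Function.update_of_ne (by decide), hbest']
      rcases Nat.lt_succ_iff_lt_or_eq.1 hj' with h | rfl
      · exact (hle j' h).trans (le_max_right _ _)
      · exact le_max_left _ _
    · rw [Function.update_of_ne (show aBEST ≠ aJ by decide), hbest']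
      simp only [Function.update_of_ne (show aXB ≠ aJ by decide),
        Function.update_of_ne (show aXB ≠ aY by decide),
        Function.update_of_ne (show aXB ≠ aBEST by decide), Function.update_self]
      have hchi : ∀ i < 2 ^ T, chiE.eval M5 i = Net.chi T r i := fun i hi =>
        eval_chiE (by rw [hY5]; exact hY i hi)
      -- The record starts at `-1`, below every gain, so the first bipartition is always accepted
      -- and the array of the best one is never read uninitialised.
      by_cases hc : A.gain T (Net.chi T r) ≤ M2 aBEST 0
      · rcases hbest with ⟨-, hb⟩ | ⟨j, hj1, hj2⟩
        · have := hA.gain_nonneg (Net.chi T r); omega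
        · refine ⟨j, fun i hi => ?_, ?_⟩
          · rw [arr_lt hi, Expr.eval]
            simp [Expr.eval, htot, hb5, hc, hX5, hj1 i hi]
          · rw [max_eq_right hc, hj2]
      · refine ⟨r, fun i hi => ?_, ?_⟩
        · rw [arr_lt hi, Expr.eval]
          simp only [Expr.eval, htot, hb5, hc, if_false]
          exact hchi i hi
        · rw [max_eq_left (by omega)]
  · rintro M' hs ⟨-, hle, hbest⟩
    rcases hbest with ⟨h0, -⟩ | ⟨j, hj1, hj2⟩
    · omega
    · exact ⟨j, hj1, fun j' hj' => hj2 ▸ hle j' hj'⟩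

end PRAM

/-! ### One contraction on the machine. -/

namespace PRAM

/-- The position in the opposite group that has to be found. -/
def posE : Expr := .sub (.add (rd aPRE) (cur aF)) (rd aXB)

/-- The address of the edge in the next round. -/
def nextE : Expr := .add (sc aBASE) (sc aN)

/-- The entry of the array `a` for the mate. -/
def mateE (a : ℕ) : Expr := .read a (.add (sc aBASE) (rd aIDX))

/-- Starts of the new edges. -/
def newSrc : Expr :=
  .ifLE (.const 1) (rd aHAS) (.ifLE (.const 1) (rd aXB) (cur aS) (mateE aS)) (cur aS)

/-- Ends of the new edges. -/
def newDst : Expr :=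
  .ifLE (.const 1) (rd aHAS) (.ifLE (.const 1) (rd aXB) (mateE aD) (cur aD)) (cur aD)

/-- Lengths of the new edges. -/
def newLen : Expr :=
  .add (cur aL) (.ifLE (.const 1) (rd aHAS) (mateE aL) (.const 0))

/-- Flow through the new edges, before that through loops and into the source is removed. -/
def newSegment : Expr :=
  .ifLE (cur aF) (.const 0) (.const 0) <|
  .sub (.add (rd aPRE) (cur aF)) (emax (rd aPRE)
    (.ifLE (.const 1) (rd aHAS) (.read aPRE (rd aIDX)) (rootE (rd aQK))))

/-- Flow through the new edges. -/
def newFlow : Expr :=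
  ifEQ (.read aS (.add nextE .pid)) (.read aD (.add nextE .pid)) (.const 0) <|
  ifEQ (.read aD (.add nextE .pid)) (sc aSS) (.const 0) newSegment

/-- Store the edges of the next round. -/
def store : Prog :=
  .seq (pput (sc aN) aS (.add nextE .pid) newSrc) <|
  .seq (pput (sc aN) aD (.add nextE .pid) newDst) <|
  .seq (pput (sc aN) aL (.add nextE .pid) newLen) <|
  .seq (pput (sc aN) aF (.add nextE .pid) newFlow) <|
  pset aBASE nextE

/-- Find the mates. -/
def findMates : Prog :=
  .seq (gsum (keyE (rd aXB)) (cur aF)) <|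
  .seq (pmap (sc aN) aQK (oppE (rd aXB))) <|
  .seq (pmap (sc aN) aREM posE) <|
  .seq search <|
  pmap (sc aN) aHAS (.ifLE (cur aF) (.const 0) (.const 0)
    (.ifLE (.add posE (.const 1)) (rootE (rd aQK)) (.const 1) (.const 0)))

/-- Contract the flow paths of length two that are selected by the bipartition. -/
def contract : Prog := .seq findMates store

open Classical in
/-- The net after a contraction. -/
noncomputable def Net.contracted (T s : ℕ) (A : Net) (χ : ℕ → ℕ) (has : ℕ → Prop)
    (mate : ℕ → ℕ) : Net where
  src e := if has e ∧ χ e = 0 then A.src (mate e) else A.src e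
  dst e := if has e ∧ χ e = 1 then A.dst (mate e) else A.dst e
  len e := A.len e + if has e then A.len (mate e) else 0
  flow e :=
    if (if has e ∧ χ e = 0 then A.src (mate e) else A.src e) =
        (if has e ∧ χ e = 1 then A.dst (mate e) else A.dst e) ∨
      (if has e ∧ χ e = 1 then A.dst (mate e) else A.dst e) = s then 0
    else segment T (A.key χ) (A.opp χ) A.flow has mate e

theorem Net.contraction_contracted {T s : ℕ} {A : Net} {χ : ℕ → ℕ} {has : ℕ → Prop} {mate : ℕ → ℕ}
    (h : Overlay T (A.key χ) (A.opp χ) (fun e => χ e) A.flow has mate) :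
    A.Contraction T s χ (A.contracted T s χ has mate) has mate :=
  ⟨h, fun _ _ => rfl, fun _ _ => rfl, fun _ _ => rfl, fun _ _ => rfl⟩

/-- The mates have been found. -/
structure HasMates (T : ℕ) (A : Net) (χ : ℕ → ℕ) (has : ℕ → Prop) (mate : ℕ → ℕ) (M : Mem) : Prop
    where
  forest : SumForest T (A.key χ) A.flow M
  opp : ∀ i < 2 ^ T, M aQK (i : ℕ) = A.opp χ i
  has_iff : ∀ i < 2 ^ T, 1 ≤ M aHAS (i : ℕ) ↔ has i
  mate : ∀ i < 2 ^ T, has i → M aIDX (i : ℕ) = mate i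

section

variable {W T : ℕ} {M : Mem} {s : ℕ} {o : ℤ} {A : Net} {χ : ℕ → ℕ}

theorem findMates_runs (hW : 2 * 2 ^ T + 1 ≤ W) (hB : Base T M)
    (hA : A.Good T s) (hnet : HasNet T o A M) (ho : M aBASE 0 = o)
    (hχ : ∀ e, χ e < 2) (hX : ∀ i < 2 ^ T, M aXB (i : ℕ) = χ i) :
    Runs W findMates M (15 * T + 21) fun M' => ∃ has mate,
      Overlay T (A.key χ) (A.opp χ) (fun e => χ e) A.flow has mate ∧
      HasMates T A χ has mate M' := by
  obtain ⟨hW1, hW2⟩ := two_pow_succ_le hW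
  refine Runs.le (T := (10 * T + 13) + (1 + (1 + ((5 * T + 5) + 1)))) ?_ (by omega)
  refine (gsum_runs hW hB (key := A.key χ) (val := A.flow)
    (fun i hi => hnet.eval_keyE ho hχ hi (by simp [Expr.eval, hX i hi]))
    (fun i hi => (hA.key_lt hχ hi).1)
    (fun y i hi => by simp [Expr.eval, ho, hnet.flow i hi])).seq fun M1 hs1 hF => ?_
  rw [gsum, gred_writes] at hs1
  have hB1 : Base T M1 := hB.mono (hs1 _ (by decide)) (hs1 _ (by decide))
  have hnet1 : HasNet T o A M1 := hnet.mono (hs1 _ (by decide)) (hs1 _ (by decide))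
      (hs1 _ (by decide)) (hs1 _ (by decide))
  have ho1 : M1 aBASE 0 = o := by rw [hs1 _ (by decide), ho]
  have hX1 : ∀ i < 2 ^ T, M1 aXB (i : ℕ) = χ i := by rw [hs1 _ (by decide)]; exact hX
  refine Runs.pmap_seq (2 ^ T) (by simp [Expr.eval, hB1.size]) hW1 ?_
  refine Runs.pmap_seq (2 ^ T) (by simp [Expr.eval, hB1.size]) hW1 ?_
  set M2 := Function.update (Function.update M1 aQK _) aREM _ with hM2
  have hB2 : Base T M2 := hB1.mono (by simp [hM2]) (by simp [hM2])
  have hF2 : SumForest T (A.key χ) A.flow M2 :=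
    ⟨by simpa [hM2] using hF.nodes, by simpa [hM2] using Forest.pre hF⟩
  have hQK2 : ∀ i < 2 ^ T, M2 aQK (i : ℕ) = A.opp χ i := by
    intro i hi
    have := hnet1.eval_oppE ho1 hχ hi (x := rd aXB) (by simp [Expr.eval, hX1 i hi])
    simp [hM2, hi, this]
  have hREM2 : ∀ i < 2 ^ T, M2 aREM (i : ℕ) = preSum (A.key χ) A.flow i + A.flow i - χ i := by
    intro i hi
    simp [hM2, hi, posE, Expr.eval, ho1, hnet1.flow i hi, hX1 i hi, hF.pre hi]
  have hnet2 : HasNet T o A M2 :=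
    hnet1.mono (by simp [hM2]) (by simp [hM2]) (by simp [hM2]) (by simp [hM2])
  have ho2 : M2 aBASE 0 = o := by simp [hM2, ho1]
  have hX2 : ∀ i < 2 ^ T, M2 aXB (i : ℕ) = χ i := by simpa [hM2] using hX1
  clear_value M2
  refine (search_runs hW hB2 hF2 hQK2 (fun i hi => (hA.key_lt hχ hi).2) hREM2).seq
    fun M3 hs3 hsearch => ?_
  have hB3 : Base T M3 := hB2.mono (hs3 _ (by decide)) (hs3 _ (by decide))
  have hF3 : SumForest T (A.key χ) A.flow M3 :=
    ⟨by rw [hs3 _ (by decide)]; exact hF2.nodes,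
      by rw [hs3 _ (by decide)]; exact Forest.pre hF2⟩
  have hQK3 : ∀ i < 2 ^ T, M3 aQK (i : ℕ) = A.opp χ i := by rw [hs3 _ (by decide)]; exact hQK2
  have hnet3 : HasNet T o A M3 := hnet2.mono (hs3 _ (by decide)) (hs3 _ (by decide))
      (hs3 _ (by decide)) (hs3 _ (by decide))
  have ho3 : M3 aBASE 0 = o := by rw [hs3 _ (by decide), ho2]
  have hX3 : ∀ i < 2 ^ T, M3 aXB (i : ℕ) = χ i := by rw [hs3 _ (by decide)]; exact hX2
  refine Runs.pmap (2 ^ T) (by simp [Expr.eval, hB3.size]) hW1 ?_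
  set has : ℕ → Prop := fun i => 0 < A.flow i ∧
    preSum (A.key χ) A.flow i + A.flow i - χ i < keySum T (A.key χ) A.flow (A.opp χ i) with hhas
  -- Integrality puts the searched position in range: the flow is at least one and `χ i` at most
  -- one.
  have hfound : ∀ i < 2 ^ T, has i → _ := fun i hi hh => hsearch i hi (by
    have := preSum_nonneg (key := A.key χ) hA.flow_nonneg hi
    have := hh.1
    have := hχ i
    omega) hh.2
  refine ⟨has, fun i => (M3 aIDX (i : ℕ)).toNat, Net.overlay_of hχ hA.flow_nonneg
    (fun _ _ => Iff.rfl) ?_, ⟨?_, ?_⟩, by simpa using hQK3, ?_, ?_⟩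
  · intro i hi hh
    obtain ⟨e, he, h1, h2, h3, h4⟩ := hfound i hi hh
    rw [h1, Int.toNat_natCast]
    exact ⟨he, h2, h3, h4⟩
  · simpa using hF3.nodes
  · simpa using Forest.pre hF3
  · intro i hi
    have hroot := hF3.eval_root hB3 (e := rd aQK) (i := i) (by simp [Expr.eval, hQK3 i hi])
      (hA.key_lt hχ hi).2
    rw [Function.update_self, arr_lt hi]
    simp only [Expr.eval, posE, ho3, hnet3.flow i hi, hF3.pre hi, hX3 i hi] at hroot ⊢
    simp only [hroot, hhas]
    split_ifs <;> omega
  · intro i hi hh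
    obtain ⟨e, he, h1, h2, h3, h4⟩ := hfound i hi hh
    simp [h1]

/-- The edges stored below the address `o` are the same. -/
def SameBelow (o : ℤ) (M M' : Mem) : Prop := ∀ a ∈ [aS, aD, aL, aF], ∀ y < o, M' a y = M a y

/-- The new net is written directly behind the old one, so that the old entries stay available for
the later writes and for unwinding. The flow is stored last because it reads the new endpoints. -/
theorem store_runs (hW : 2 * 2 ^ T + 1 ≤ W) (hB : Base T M) (hs : M aSS 0 = s)
    (hnet : HasNet T o A M) (ho : M aBASE 0 = o)
    (hχ : ∀ e, χ e < 2) (hX : ∀ i < 2 ^ T, M aXB (i : ℕ) = χ i)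
    (hA : A.Good T s) {has : ℕ → Prop} {mate : ℕ → ℕ}
    (hov : Overlay T (A.key χ) (A.opp χ) (fun e => χ e) A.flow has mate)
    (hm : HasMates T A χ has mate M) :
    Runs W store M 5 fun M' => HasNet T (o + 2 ^ T) (A.contracted T s χ has mate) M' ∧
      M' aBASE 0 = o + 2 ^ T ∧ SameBelow (o + 2 ^ T) M M' := by
  classical
  obtain ⟨hW1, hW2⟩ := two_pow_succ_le hW
  refine Runs.le (T := 1 + (1 + (1 + (1 + 1)))) ?_ le_rfl
  have hmate : ∀ i < 2 ^ T, has i → M aIDX (i : ℕ) = mate i ∧ mate i < 2 ^ T := fun i hi hh =>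
    ⟨hm.mate i hi hh, hov.mate_lt i hi hh⟩
  have hpos : (0 : ℤ) < 2 ^ T := by positivity
  refine Runs.pput_seq (2 ^ T) (by simp [Expr.eval, hB.size]) hW1 ?_
  set M1 := Function.update M aS _ with hM1
  have hS1 : ∀ i < 2 ^ T, M1 aS (o + 2 ^ T + (i : ℕ)) = (A.contracted T s χ has mate).src i := by
    intro i hi
    rw [hM1, Function.update_self, Mem.step_offset _ _ _ _ _ (o + 2 ^ T)
      (fun j _ => by simp [nextE, Expr.eval, ho, hB.size]) i hi]
    have h1 := hm.has_iff i hi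
    have := hχ i
    by_cases hh : has i
    · obtain ⟨h2, h3⟩ := hmate i hi hh
      simp only [newSrc, mateE, Expr.eval, h1, hh, if_true, hX i hi, ho, hnet.src i hi, h2,
        hnet.src _ h3, Net.contracted, true_and]
      rcases (show χ i = 0 ∨ χ i = 1 by omega) with hc | hc <;> simp [hc]
    · simp only [newSrc, mateE, Expr.eval, h1, hh, if_false, ho, hnet.src i hi,
        Net.contracted, false_and]
  have hS1' : ∀ y < o + 2 ^ T, M1 aS y = M aS y := by
    intro y hy
    rw [hM1, Function.update_self, Mem.step_offset_lt _ _ _ _ _ (o + 2 ^ T)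
      (fun j _ => by simp [nextE, Expr.eval, ho, hB.size]) y hy]
  have hne1 : ∀ a, a ≠ aS → M1 a = M a := fun a ha => by rw [hM1, Function.update_of_ne ha]
  clear_value M1
  refine Runs.pput_seq (2 ^ T) (by simp [Expr.eval, hne1, hB.size]) hW1 ?_
  set M2 := Function.update M1 aD _ with hM2
  have hD2 : ∀ i < 2 ^ T, M2 aD (o + 2 ^ T + (i : ℕ)) = (A.contracted T s χ has mate).dst i := by
    intro i hi
    rw [hM2, Function.update_self, Mem.step_offset _ _ _ _ _ (o + 2 ^ T)
      (fun j _ => by simp [nextE, Expr.eval, hne1, ho, hB.size]) i hi]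
    have h1 := hm.has_iff i hi
    have := hχ i
    by_cases hh : has i
    · obtain ⟨h2, h3⟩ := hmate i hi hh
      simp only [newDst, mateE, Expr.eval, hne1 aHAS (by decide), hne1 aXB (by decide),
        hne1 aBASE (by decide), hne1 aIDX (by decide), hne1 aD (by decide), h1, hh, if_true,
        hX i hi, ho, hnet.dst i hi, h2, hnet.dst _ h3, Net.contracted, true_and]
      rcases (show χ i = 0 ∨ χ i = 1 by omega) with hc | hc <;> simp [hc]
    · simp only [newDst, mateE, Expr.eval, hne1 aHAS (by decide),
        hne1 aBASE (by decide), hne1 aD (by decide), h1, hh, if_false, ho,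
        hnet.dst i hi, Net.contracted, false_and]
  have hD2' : ∀ y < o + 2 ^ T, M2 aD y = M aD y := by
    intro y hy
    rw [hM2, Function.update_self, Mem.step_offset_lt _ _ _ _ _ (o + 2 ^ T)
      (fun j _ => by simp [nextE, Expr.eval, hne1, ho, hB.size]) y hy, hne1 aD (by decide)]
  have hS2 : M2 aS = M1 aS := by rw [hM2, Function.update_of_ne (by decide)]
  have hne2 : ∀ a, a ≠ aS → a ≠ aD → M2 a = M a := fun a h1 h2 => by
    rw [hM2, Function.update_of_ne h2, hne1 a h1]
  clear_value M2
  refine Runs.pput_seq (2 ^ T) (by simp [Expr.eval, hne2, hB.size]) hW1 ?_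
  set M3 := Function.update M2 aL _ with hM3
  have hL3 : ∀ i < 2 ^ T, M3 aL (o + 2 ^ T + (i : ℕ)) = (A.contracted T s χ has mate).len i := by
    intro i hi
    rw [hM3, Function.update_self, Mem.step_offset _ _ _ _ _ (o + 2 ^ T)
      (fun j _ => by simp [nextE, Expr.eval, hne2, ho, hB.size]) i hi]
    have h1 := hm.has_iff i hi
    by_cases hh : has i
    · obtain ⟨h2, h3⟩ := hmate i hi hh
      simp only [newLen, mateE, Expr.eval, hne2 aHAS (by decide) (by decide),
        hne2 aBASE (by decide) (by decide), hne2 aIDX (by decide) (by decide),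
        hne2 aL (by decide) (by decide), h1, hh, if_true, ho, hnet.len i hi, h2, hnet.len _ h3,
        Net.contracted]
    · simp only [newLen, mateE, Expr.eval, hne2 aHAS (by decide) (by decide),
        hne2 aBASE (by decide) (by decide),
        hne2 aL (by decide) (by decide), h1, hh, if_false, ho, hnet.len i hi,
        Net.contracted]
  have hL3' : ∀ y < o + 2 ^ T, M3 aL y = M aL y := by
    intro y hy
    rw [hM3, Function.update_self, Mem.step_offset_lt _ _ _ _ _ (o + 2 ^ T)
      (fun j _ => by simp [nextE, Expr.eval, hne2, ho, hB.size]) y hy,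
      hne2 aL (by decide) (by decide)]
  have hS3 : M3 aS = M1 aS := by rw [hM3, Function.update_of_ne (by decide), hS2]
  have hD3 : M3 aD = M2 aD := by rw [hM3, Function.update_of_ne (by decide)]
  have hne3 : ∀ a, a ≠ aS → a ≠ aD → a ≠ aL → M3 a = M a := fun a h1 h2 h3 => by
    rw [hM3, Function.update_of_ne h3, hne2 a h1 h2]
  clear_value M3
  refine Runs.pput_seq (2 ^ T) (by simp [Expr.eval, hne3, hB.size]) hW1 ?_
  set M4 := Function.update M3 aF _ with hM4
  have hF4 : ∀ i < 2 ^ T, M4 aF (o + 2 ^ T + (i : ℕ)) = (A.contracted T s χ has mate).flow i := by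
    intro i hi
    rw [hM4, Function.update_self, Mem.step_offset _ _ _ _ _ (o + 2 ^ T)
      (fun j _ => by simp [nextE, Expr.eval, hne3, ho, hB.size]) i hi]
    have h1 := hm.has_iff i hi
    have hsrc : (Expr.read aS (.add nextE .pid)).eval M3 i =
        (A.contracted T s χ has mate).src i := by
      rw [← hS1 i hi]
      simp [nextE, Expr.eval, hne3, ho, hB.size, hS3]
    have hdst : (Expr.read aD (.add nextE .pid)).eval M3 i =
        (A.contracted T s χ has mate).dst i := by
      rw [← hD2 i hi]
      simp [nextE, Expr.eval, hne3, ho, hB.size, hD3]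
    have hsc : (sc aSS).eval M3 i = s := by simp [Expr.eval, hne3, hs]
    have hseg : newSegment.eval M3 i = segment T (A.key χ) (A.opp χ) A.flow has mate i := by
      have e1 : (cur aF).eval M3 i = A.flow i := by simp [Expr.eval, hne3, ho, hnet.flow i hi]
      have e2 : (rd aPRE).eval M3 i = preSum (A.key χ) A.flow i := by
        simp [Expr.eval, hne3, hm.forest.pre hi]
      have e3 : (rd aHAS).eval M3 i = M aHAS i := by simp [Expr.eval, hne3]
      have e4 : (rootE (rd aQK)).eval M3 i = keySum T (A.key χ) A.flow (A.opp χ i) := by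
        rw [← hm.forest.eval_root hB (e := rd aQK) (i := i) (by simp [Expr.eval, hm.opp i hi])
          (hA.key_lt hχ hi).2]
        simp [Expr.eval, hne3]
      have e5 : has i → (Expr.read aPRE (rd aIDX)).eval M3 i =
          preSum (A.key χ) A.flow (mate i) := by
        intro hh
        obtain ⟨h2, h3⟩ := hmate i hi hh
        simp [Expr.eval, hne3, h2, hm.forest.pre h3]
      have e6 : (Expr.ifLE (.const 1) (rd aHAS) (.read aPRE (rd aIDX)) (rootE (rd aQK))).eval M3 i =
          if has i then preSum (A.key χ) A.flow (mate i)
          else keySum T (A.key χ) A.flow (A.opp χ i) := by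
        rw [Expr.eval, e3]
        by_cases hh : has i
        · rw [if_pos hh, ← e5 hh, if_pos (show Expr.eval M3 i (.const 1) ≤ M aHAS i from h1.2 hh)]
        · rw [if_neg hh, ← e4,
            if_neg (show ¬ Expr.eval M3 i (.const 1) ≤ M aHAS i from fun hc => hh (h1.1 hc))]
      have e7 : newSegment.eval M3 i = if (cur aF).eval M3 i ≤ 0 then 0 else
          (rd aPRE).eval M3 i + (cur aF).eval M3 i - (emax (rd aPRE)
            (.ifLE (.const 1) (rd aHAS) (.read aPRE (rd aIDX)) (rootE (rd aQK)))).eval M3 i := rfl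
      rw [e7, eval_emax, e6, e1, e2, segment]
    rw [newFlow, eval_ifEQ, hsrc, hdst, eval_ifEQ, hdst, hsc, hseg]
    have hflow : (A.contracted T s χ has mate).flow i =
        if (A.contracted T s χ has mate).src i = (A.contracted T s χ has mate).dst i ∨
          (A.contracted T s χ has mate).dst i = s then 0 else
        segment T (A.key χ) (A.opp χ) A.flow has mate i := rfl
    rw [hflow]
    simp only [Nat.cast_inj, Expr.eval]
    split_ifs <;> first | rfl | tauto
  have hF4' : ∀ y < o + 2 ^ T, M4 aF y = M aF y := by
    intro y hy
    rw [hM4, Function.update_self, Mem.step_offset_lt _ _ _ _ _ (o + 2 ^ T)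
      (fun j _ => by simp [nextE, Expr.eval, hne3, ho, hB.size]) y hy,
      hne3 aF (by decide) (by decide) (by decide)]
  have hS4 : M4 aS = M1 aS := by rw [hM4, Function.update_of_ne (by decide), hS3]
  have hD4 : M4 aD = M2 aD := by rw [hM4, Function.update_of_ne (by decide), hD3]
  have hL4 : M4 aL = M3 aL := by rw [hM4, Function.update_of_ne (by decide)]
  have hne4 : ∀ a, a ≠ aS → a ≠ aD → a ≠ aL → a ≠ aF → M4 a = M a := fun a h1 h2 h3 h4 => by
    rw [hM4, Function.update_of_ne h4, hne3 a h1 h2 h3]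
  clear_value M4
  refine Runs.pset hW2 ⟨⟨?_, ?_, ?_, ?_⟩, ?_, ?_⟩
  · rw [Function.update_of_ne (by decide), hS4]; exact hS1
  · rw [Function.update_of_ne (by decide), hD4]; exact hD2
  · rw [Function.update_of_ne (by decide), hL4]; exact hL3
  · rw [Function.update_of_ne (by decide)]; exact hF4
  · simp [nextE, Expr.eval, hne4, ho, hB.size]
  · intro a ha y hy
    simp only [List.mem_cons, List.not_mem_nil, or_false] at ha
    rcases ha with rfl | rfl | rfl | rfl
    · rw [Function.update_of_ne (by decide), hS4]; exact hS1' y hy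
    · rw [Function.update_of_ne (by decide), hD4]; exact hD2' y hy
    · rw [Function.update_of_ne (by decide), hL4]; exact hL3' y hy
    · rw [Function.update_of_ne (by decide)]; exact hF4' y hy

theorem contract_runs (hW : 2 * 2 ^ T + 1 ≤ W) (hB : Base T M) (hs : M aSS 0 = s)
    (hA : A.Good T s) (hnet : HasNet T o A M) (ho : M aBASE 0 = o)
    (hχ : ∀ e, χ e < 2) (hX : ∀ i < 2 ^ T, M aXB (i : ℕ) = χ i) :
    Runs W contract M (15 * T + 26) fun M' => ∃ A' has mate, A.Contraction T s χ A' has mate ∧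
      HasNet T (o + 2 ^ T) A' M' ∧ M' aBASE 0 = o + 2 ^ T ∧ SameBelow (o + 2 ^ T) M M' := by
  refine Runs.le (T := (15 * T + 21) + 5) ?_ le_rfl
  refine (findMates_runs hW hB hA hnet ho hχ hX).seq fun M1 hs1 ⟨has, mate, hov, hm⟩ => ?_
  refine (store_runs hW (hB.mono (hs1 _ (by decide)) (hs1 _ (by decide)))
    (by rw [hs1 _ (by decide), hs]) (hnet.mono (hs1 _ (by decide)) (hs1 _ (by decide))
      (hs1 _ (by decide)) (hs1 _ (by decide))) (by rw [hs1 _ (by decide), ho]) hχ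
    (by rw [hs1 _ (by decide)]; exact hX) hA hov hm).mono le_rfl fun M' _ ⟨h1, h2, h3⟩ => ?_
  refine ⟨_, has, mate, Net.contraction_contracted hov, h1, h2, fun a ha y hy => ?_⟩
  rw [h3 a ha y hy]
  simp only [List.mem_cons, List.not_mem_nil, or_false] at ha
  rcases ha with rfl | rfl | rfl | rfl <;> rw [hs1 _ (by decide)]

end

end PRAM

/-! ### Chains of contractions and the geometric decrease of the potential. -/

namespace PRAM

namespace Net

variable {T s : ℕ}

/-- Each of the nets `st 1, …, st R` arises from the preceding one by a contraction. -/
def Chain (T s : ℕ) (st : ℕ → Net) (R : ℕ) : Prop :=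
  ∀ k < R, ∃ χ has mate, (∀ e, χ e < 2) ∧ (st k).Contraction T s χ (st (k + 1)) has mate

variable {st : ℕ → Net} {R : ℕ}

theorem Chain.good (h : Chain T s st R) (h0 : (st 0).Good T s) :
    ∀ k ≤ R, (st k).Good T s := by
  intro k
  induction k with
  | zero => exact fun _ => h0
  | succ k ih =>
    intro hk
    obtain ⟨χ, has, mate, -, hc⟩ := h k hk
    exact hc.good (ih (by omega))

theorem Chain.excess_le (h : Chain T s st R) {v : ℕ} (hv : v ≠ s) :
    ∀ k ≤ R, (st 0).excess T v ≤ (st k).excess T v := by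
  intro k
  induction k with
  | zero => exact fun _ => le_rfl
  | succ k ih =>
    intro hk
    obtain ⟨χ, has, mate, hχ, hc⟩ := h k hk
    exact (ih (by omega)).trans (hc.excess_le hχ hv)

theorem Chain.cost_le (h : Chain T s st R) (h0 : (st 0).Good T s) :
    ∀ k ≤ R, (st k).cost T ≤ (st 0).cost T := by
  intro k
  induction k with
  | zero => exact fun _ => le_rfl
  | succ k ih =>
    intro hk
    obtain ⟨χ, has, mate, -, hc⟩ := h k hk
    exact (hc.cost_le (h.good h0 k (by omega))).trans (ih (by omega))

theorem Chain.extend (h : Chain T s st R) {A' : Net} {χ : ℕ → ℕ} {has : ℕ → Prop} {mate : ℕ → ℕ}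
    (hχ : ∀ e, χ e < 2) (hc : (st R).Contraction T s χ A' has mate) :
    Chain T s (Function.update st (R + 1) A') (R + 1) := by
  intro k hk
  rw [Function.update_of_ne (by omega)]
  rcases Nat.lt_succ_iff_lt_or_eq.1 hk with hk | rfl
  · rw [Function.update_of_ne (by omega)]
    exact h k hk
  · rw [Function.update_self]
    exact ⟨χ, has, mate, hχ, hc⟩

theorem Good.pot_nonneg {A : Net} (hA : A.Good T s) : 0 ≤ A.pot T s := by
  refine Finset.sum_nonneg fun e he => mul_nonneg (hA.flow_nonneg e (Finset.mem_range.1 he)) ?_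
  split_ifs <;> norm_num

/-- A bipartition of maximum gain reduces the potential by a constant factor. -/
theorem Contraction.pot_decrease {A A' : Net} {χ : ℕ → ℕ} {has : ℕ → Prop} {mate : ℕ → ℕ}
    (hc : A.Contraction T s χ A' has mate) (hχ : ∀ e, χ e < 2) (hA : A.Good T s)
    (hs : ∀ v < 2 ^ T, v ≠ s → 0 ≤ A.excess T v)
    (hbest : ∀ j < 2 * T, A.gain T (chi T j) ≤ A.gain T χ) :
    2 * T * A'.pot T s ≤ (2 * T - 1) * A.pot T s := by
  have h1 := hc.pot_le hχ hA
  have h2 : A.pot T s ≤ 2 * T * A.gain T χ := by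
    refine (pot_le_sum_gain hA hs).trans ?_
    refine (Finset.sum_le_sum fun j hj => hbest j (Finset.mem_range.1 hj)).trans ?_
    simp
  nlinarith

end Net

/-- That is, `(1 - 1 / (a + 1)) ^ (a + 1) ≤ 1 / 2`, from the first two terms of the binomial
expansion of `(a + 1) ^ (a + 1)`. -/
theorem two_mul_pow_le (a : ℕ) : 2 * a ^ (a + 1) ≤ (a + 1) ^ (a + 1) := by
  have key : ∀ n : ℕ, a ^ (n + 1) + (n + 1) * a ^ n ≤ (a + 1) ^ (n + 1) := by
    intro n
    induction n with
    | zero => simp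
    | succ n ih =>
      calc a ^ (n + 1 + 1) + (n + 1 + 1) * a ^ (n + 1)
          ≤ (a ^ (n + 1) + (n + 1) * a ^ n) * (a + 1) := by ring_nf; nlinarith [Nat.zero_le (a ^ n)]
        _ ≤ _ := by rw [pow_succ (a + 1)]; exact Nat.mul_le_mul_right _ ih
  have := key a
  rw [pow_succ] at this ⊢
  nlinarith [Nat.zero_le (a ^ a)]

/-- A nonnegative integer is less than one after sufficiently many reductions by the factor
`1 - 1 / k`. -/
theorem lt_of_geometric {k L r : ℕ} (hk : 2 ≤ k) {P P0 : ℤ} (hP : 0 < P) (hP0 : P0 < 2 ^ L)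
    (h : (k : ℤ) ^ r * P ≤ (k - 1) ^ r * P0) : r < k * L := by
  by_contra hr
  obtain ⟨a, rfl⟩ : ∃ a, k = a + 1 := ⟨k - 1, by omega⟩
  obtain ⟨d, rfl⟩ : ∃ d, r = (a + 1) * L + d := ⟨r - (a + 1) * L, by omega⟩
  have ha : (1 : ℤ) ≤ a := by omega
  have h1 : (2 : ℤ) ^ L * a ^ ((a + 1) * L + d) ≤ (a + 1) ^ ((a + 1) * L + d) := by
    have h2 : (2 * (a : ℤ) ^ (a + 1)) ^ L ≤ ((a + 1) ^ (a + 1)) ^ L :=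
      pow_le_pow_left₀ (by positivity) (by exact_mod_cast two_mul_pow_le a) L
    have h3 : (a : ℤ) ^ d ≤ (a + 1) ^ d := pow_le_pow_left₀ (by positivity) (by omega) d
    calc (2 : ℤ) ^ L * a ^ ((a + 1) * L + d) = (2 * (a : ℤ) ^ (a + 1)) ^ L * a ^ d := by
          rw [mul_pow, pow_add, pow_mul]; ring
      _ ≤ ((a + 1) ^ (a + 1)) ^ L * (a + 1) ^ d := by gcongr
      _ = _ := by rw [pow_add _ ((a + 1) * L), pow_mul]
  have hpos : (0 : ℤ) < a ^ ((a + 1) * L + d) := by positivity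
  have hpos' : (0 : ℤ) < (a + 1) ^ ((a + 1) * L + d) := by positivity
  push_cast at h
  rw [add_sub_cancel_right] at h
  have h4 : (a : ℤ) ^ ((a + 1) * L + d) * P0 < a ^ ((a + 1) * L + d) * 2 ^ L :=
    mul_lt_mul_of_pos_left hP0 hpos
  nlinarith

/-- Compute the potential. -/
def potential : Prog := gtotal aPP (ifEQ (cur aS) (sc aSS) (.const 0) (cur aF))

/-- One round. -/
def round : Prog := .seq bestChi (.seq contract potential)

/-- Contract until all flow goes through edges that start at the source. -/
def rounds : Prog := .seq (pset aBASE (.const 0)) (.seq potential (.loop (sc aPP) round))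

theorem potential_writes : potential.writes = gredArrays ++ [aPP] := rfl

section

variable {W T s : ℕ} {M : Mem} {A : Net}

theorem potential_runs (hW : 2 * 2 ^ T + 1 ≤ W) (hB : Base T M) (hs : M aSS 0 = s) {o : ℤ}
    (hnet : HasNet T o A M) (ho : M aBASE 0 = o) :
    Runs W potential M (10 * T + 14) fun M' => M' aPP 0 = A.pot T s := by
  refine gtotal_runs hW hB (val := fun e => A.flow e * if A.src e = s then 0 else 1) fun y i hi => ?_
  rw [eval_ifEQ]
  simp [Expr.eval, ho, hs, hnet.src i hi, hnet.flow i hi]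

/-- The `k`-th net stays at the address `k * 2 ^ T`, which is what makes unwinding possible. While
the potential is positive, its geometric decrease forces the round number below `2 * T * L`. -/
theorem rounds_runs (hW : 2 * 2 ^ T + 1 ≤ W) (hB : Base T M) (hss : M aSS 0 = s)
    (hA : A.Good T s) (hnet : HasNet T 0 A M)
    (hcode : ∀ i < 2 ^ T, M aCODE (i : ℕ) = (Net.code T i : ℕ))
    (hs : ∀ v < 2 ^ T, v ≠ s → 0 ≤ A.excess T v) {L : ℕ} (hL : A.pot T s < 2 ^ L) :
    Runs W rounds M (2 * T * L * (40 * T ^ 2 + 91 * T + 45) + 10 * T + 16) fun M' => ∃ st R,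
      st 0 = A ∧ Net.Chain T s st R ∧ (st R).pot T s = 0 ∧ M' aBASE 0 = R * 2 ^ T ∧
      (∀ k ≤ R, HasNet T (k * 2 ^ T) (st k) M') ∧ R ≤ 2 * T * L := by
  obtain ⟨hW1, hW2⟩ := two_pow_succ_le hW
  refine Runs.le (T := 1 + ((10 * T + 14) +
    (2 * T * L * ((2 * T * (20 * T + 33) + 4 + ((15 * T + 26) + (10 * T + 14))) + 1) + 1))) ?_
    (by ring_nf; omega)
  refine Runs.pset_seq hW2 ?_
  set M0 := Function.update M aBASE _ with hM0
  have hB0 : Base T M0 := hB.mono (by simp [hM0]) (by simp [hM0])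
  have hnet0 : HasNet T 0 A M0 := hnet.mono (by simp [hM0]) (by simp [hM0]) (by simp [hM0])
    (by simp [hM0])
  have hss0 : M0 aSS 0 = s := by simp [hM0, hss]
  have hcode0 : ∀ i < 2 ^ T, M0 aCODE (i : ℕ) = (Net.code T i : ℕ) := by simpa [hM0] using hcode
  have ho0 : M0 aBASE 0 = 0 := by simp [hM0, Expr.eval]
  clear_value M0
  refine (potential_runs hW hB0 hss0 hnet0 ho0).seq fun M1 hs1 hP1 => ?_
  rw [potential_writes] at hs1
  have main : ∀ (r : ℕ) (M' : Mem), (∃ st : ℕ → Net, st 0 = A ∧ Net.Chain T s st r ∧ M' aBASE 0 = r * 2 ^ T ∧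
      (∀ k ≤ r, HasNet T (k * 2 ^ T) (st k) M') ∧ M' aPP 0 = (st r).pot T s ∧
      ((2 * T : ℕ) : ℤ) ^ r * (st r).pot T s ≤ ((2 * T : ℕ) - 1) ^ r * A.pot T s) →
      M' aPP 0 ≠ 0 → 0 < T ∧ r < 2 * T * L := by
    rintro r M' ⟨st, h0, hch, ho, hnets, hP, hgeo⟩ hc
    have hg := hch.good (by rw [h0]; exact hA) r le_rfl
    have hpos : 0 < (st r).pot T s := lt_of_le_of_ne hg.pot_nonneg (by rw [← hP]; exact hc.symm)
    -- For `T = 0` there are no bipartitions, and the bound by the sum of their gains makes the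
    -- potential vanish.
    have hT : 0 < T := by
      rcases Nat.eq_zero_or_pos T with rfl | h
      · have := Net.pot_le_sum_gain hg fun v hv hvs =>
          (hs v hv hvs).trans (h0 ▸ hch.excess_le hvs r le_rfl)
        simp at this
        omega
      · exact h
    exact ⟨hT, lt_of_geometric (by omega) hpos hL hgeo⟩
  refine (Runs.loop (by omega) (fun r M' => r ≤ 2 * T * L ∧
      ∃ st : ℕ → Net, st 0 = A ∧ Net.Chain T s st r ∧ M' aBASE 0 = r * 2 ^ T ∧
      (∀ k ≤ r, HasNet T (k * 2 ^ T) (st k) M') ∧ M' aPP 0 = (st r).pot T s ∧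
      ((2 * T : ℕ) : ℤ) ^ r * (st r).pot T s ≤ ((2 * T : ℕ) - 1) ^ r * A.pot T s) (2 * T * L)
      ?_ ?_).mono le_rfl ?_
  · refine ⟨Nat.zero_le _, fun _ => A, rfl, fun k hk => by omega, ?_, fun k hk => ?_, hP1, by simp⟩
    · rw [hs1 _ (by decide), ho0]; simp
    · obtain rfl : k = 0 := by omega
      simpa using hnet0.mono (hs1 _ (by decide)) (hs1 _ (by decide)) (hs1 _ (by decide))
        (hs1 _ (by decide))
  · rintro r M2 hs2 ⟨-, st, h0, hch, ho, hnets, hP, hgeo⟩ hc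
    obtain ⟨hT, hr⟩ := main r M2 ⟨st, h0, hch, ho, hnets, hP, hgeo⟩ hc
    refine ⟨hr, ?_⟩
    have hB2 : Base T M2 := (hB0.mono (hs1 _ (by decide)) (hs1 _ (by decide))).mono
      (hs2 _ (by decide)) (hs2 _ (by decide))
    have hg := hch.good (by rw [h0]; exact hA) r le_rfl
    refine (bestChi_runs hW hT hB2 hg (hnets r le_rfl) ho (by
      rw [hs2 _ (by decide), hs1 _ (by decide)]; exact hcode0)).seq
      fun M3 hs3 ⟨j, hj, hbest⟩ => ?_
    have hB3 := hB2.mono (hs3 _ (by decide)) (hs3 _ (by decide))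
    refine (contract_runs hW hB3 (s := s) (by
      rw [hs3 _ (by decide), hs2 _ (by decide), hs1 _ (by decide), hss0]) hg
      ((hnets r le_rfl).mono (hs3 _ (by decide)) (hs3 _ (by decide)) (hs3 _ (by decide))
      (hs3 _ (by decide))) (by rw [hs3 _ (by decide), ho]) (Net.chi_lt T j) hj).seq
      fun M4 hs4 ⟨A', has, mate, hcon, hnet4, ho4, hbelow⟩ => ?_
    have hB4 := hB3.mono (hs4 _ (by decide)) (hs4 _ (by decide))
    refine (potential_runs hW hB4 (s := s) (by
      rw [hs4 _ (by decide), hs3 _ (by decide), hs2 _ (by decide), hs1 _ (by decide), hss0])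
      hnet4 ho4).mono le_rfl fun M5 hs5 hP5 => ?_
    rw [potential_writes] at hs5
    refine ⟨hr, Function.update st (r + 1) A', ?_, hch.extend (Net.chi_lt T j) hcon, ?_, ?_, ?_, ?_⟩
    · rw [Function.update_of_ne (by omega), h0]
    · rw [hs5 _ (by decide), ho4]; push_cast; ring
    · intro k hk
      refine HasNet.mono (M := M4) ?_ (hs5 _ (by decide)) (hs5 _ (by decide))
        (hs5 _ (by decide)) (hs5 _ (by decide))
      rcases Nat.lt_or_ge r k with h | h
      · obtain rfl : k = r + 1 := by omega
        rw [Function.update_self]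
        have : ((r + 1 : ℕ) : ℤ) * 2 ^ T = r * 2 ^ T + 2 ^ T := by push_cast; ring
        rw [this]; exact hnet4
      · rw [Function.update_of_ne (by omega)]
        -- Older nets lie entirely below the region that this round writes.
        have hadd : ∀ i < 2 ^ T, (k : ℤ) * 2 ^ T + (i : ℕ) < r * 2 ^ T + 2 ^ T := by
          intro i hi
          have h1 : (k : ℤ) * 2 ^ T ≤ r * 2 ^ T := by gcongr
          have h2 : (i : ℤ) < 2 ^ T := by exact_mod_cast hi
          omega
        have hn := hnets k h
        refine ⟨fun i hi => ?_, fun i hi => ?_, fun i hi => ?_, fun i hi => ?_⟩ <;>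
          rw [hbelow _ (by simp) _ (hadd i hi), hs3 _ (by decide)]
        · exact hn.src i hi
        · exact hn.dst i hi
        · exact hn.len i hi
        · exact hn.flow i hi
    · rw [Function.update_self, hP5]
    · rw [Function.update_self]
      have hd := hcon.pot_decrease (Net.chi_lt T j) hg (fun v hv hvs =>
          (hs v hv hvs).trans (h0 ▸ hch.excess_le hvs r le_rfl)) hbest
      have hk1 : (0 : ℤ) ≤ ((2 * T : ℕ) : ℤ) - 1 := by omega
      calc ((2 * T : ℕ) : ℤ) ^ (r + 1) * A'.pot T s
          = ((2 * T : ℕ) : ℤ) ^ r * (2 * T * A'.pot T s) := by push_cast; ring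
        _ ≤ ((2 * T : ℕ) : ℤ) ^ r * ((2 * T - 1) * (st r).pot T s) := by gcongr
        _ = ((2 * T : ℕ) - 1) * (((2 * T : ℕ) : ℤ) ^ r * (st r).pot T s) := by push_cast; ring
        _ ≤ ((2 * T : ℕ) - 1) * (((2 * T : ℕ) - 1) ^ r * A.pot T s) := by gcongr
        _ = _ := by ring
  · rintro M2 - ⟨hc, r, hr, st, h0, hch, ho, hnets, hP, hgeo⟩
    refine ⟨st, r, h0, hch, ?_, ho, hnets, hr⟩
    rw [← hP]; exact hc

end

end PRAM

namespace PRAM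

/-! ### Distances by undoing the contractions -/

/-- A value larger than all relevant distances. -/
abbrev aDB : ℕ := 30
/-- Distances. -/
abbrev aPHI : ℕ := 38

/-- The candidate for the distance of the end of the edge. -/
def candE : Expr :=
  .ifLE (cur aF) (.const 0) (sc aDB) (.add (.read aPHI (cur aS)) (cur aL))

/-- Undo one round. -/
def undo : Prog :=
  .seq (gred emin (sc aDB) (cur aD) candE) <|
  .seq (pmap (sc aN) aPHI (emin (rd aPHI) (rootE .pid))) <|
  pset aBASE (.sub (sc aBASE) (sc aN))

/-- Compute the distances. -/
def distances : Prog :=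
  .seq (pmap (sc aN) aPHI (ifEQ .pid (sc aSS) (.const 0) (sc aDB))) <|
  .loop (.ifLE (.const 0) (sc aBASE) (.const 1) (.const 0)) undo

theorem undo_writes : undo.writes = gredArrays ++ [aPHI, aBASE] := rfl

/-- The distances if there are no edges. -/
def Net.initial (s : ℕ) (D : ℤ) (v : ℕ) : ℤ := if v = s then 0 else D

theorem Net.weakSuper_initial {T s : ℕ} {D : ℤ} (hD : 0 ≤ D) (A : Net) :
    Net.WeakSuper T s D A (Net.initial s D) := by
  refine ⟨fun v _ => ?_, by simp [initial], fun v _ hvs hvD => ?_⟩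
  · unfold initial; split_ifs <;> omega
  · rw [initial, if_neg hvs] at hvD
    omega

section

variable {W T s : ℕ} {D : ℤ} {M : Mem} {A : Net}

theorem undo_runs (hW : 2 * 2 ^ T + 1 ≤ W) (hB : Base T M) (hA : A.Good T s) {o : ℤ}
    (hnet : HasNet T o A M) (ho : M aBASE 0 = o) (hD : M aDB 0 = D) {φ : ℕ → ℤ}
    (hφ : ∀ v < 2 ^ T, M aPHI (v : ℕ) = φ v) :
    Runs W undo M (10 * T + 15) fun M' => M' aBASE 0 = o - 2 ^ T ∧
      ∀ v < 2 ^ T, M' aPHI (v : ℕ) = A.relax T D φ v := by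
  obtain ⟨hW1, hW2⟩ := two_pow_succ_le hW
  refine Runs.le (T := (10 * T + 13) + (1 + 1)) ?_ (by omega)
  refine (gred_runs hW hB (key := A.dst) (f := min) (z := D) (val := A.cand D φ)
    (fun i hi => by simp [Expr.eval, ho, hnet.dst i hi])
    (fun i hi => by have := hA.dst_lt i hi; omega) (min_self D) (fun y i hi => ?_)
    (fun y y' => by simp [Expr.eval, hD]) eval_emin).seq fun M1 hs1 hF => ?_
  · have := hA.src_lt i hi
    simp [candE, Expr.eval, ho, hnet.flow i hi, hnet.src i hi, hnet.len i hi, hD, hφ _ this,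
      Net.cand]
  rw [gred_writes] at hs1
  have hB1 := hB.mono (hs1 _ (by decide)) (hs1 _ (by decide))
  refine Runs.pmap_seq (2 ^ T) (by simp [Expr.eval, hB1.size]) hW1 ?_
  refine Runs.pset hW2 ⟨?_, fun v hv => ?_⟩
  · simp [Expr.eval, hB1.size, hs1 aBASE (by decide), ho]
  · rw [Function.update_of_ne (by decide), Function.update_self, arr_lt hv, eval_emin,
      hF.eval_root hB1 (k := v) rfl (by omega)]
    simp [Expr.eval, hs1 aPHI (by decide), hφ v hv, Net.relax]

/-- The chain is traversed backwards, and after `i > 0` passes the values are certified in the net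
`R + 1 - i`. The first pass relaxes the last net from the trivial values; all later passes only
lower the result, which gives the final comparison. The loop stops when the base address becomes
negative, after `R + 1` passes. -/
theorem distances_runs (hW : 2 * 2 ^ T + 1 ≤ W) (hB : Base T M) (hss : M aSS 0 = s)
    (hD0 : 0 ≤ D) (hD : M aDB 0 = D) {st : ℕ → Net} {R : ℕ} (hch : Net.Chain T s st R)
    (hA : (st 0).Good T s) (ho : M aBASE 0 = R * 2 ^ T)
    (hnets : ∀ k ≤ R, HasNet T (k * 2 ^ T) (st k) M) :
    Runs W distances M ((R + 1) * (10 * T + 16) + 2) fun M' => ∃ φ : ℕ → ℤ,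
      (∀ v < 2 ^ T, M' aPHI (v : ℕ) = φ v) ∧ Net.Super T s D (st 0) φ ∧
      ∀ v, φ v ≤ (st R).relax T D (Net.initial s D) v := by
  obtain ⟨hW1, hW2⟩ := two_pow_succ_le hW
  refine Runs.le (T := 1 + ((R + 1) * (10 * T + 15 + 1) + 1)) ?_ (by ring_nf; omega)
  refine Runs.pmap_seq (2 ^ T) (by simp [Expr.eval, hB.size]) hW1 ?_
  set M0 := Function.update M aPHI _ with hM0
  have hB0 : Base T M0 := hB.mono (by simp [hM0]) (by simp [hM0])
  have ho0 : M0 aBASE 0 = R * 2 ^ T := by simp [hM0, ho]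
  have hD1 : M0 aDB 0 = D := by simp [hM0, hD]
  have hnets0 : ∀ k ≤ R, HasNet T (k * 2 ^ T) (st k) M0 := fun k hk =>
    (hnets k hk).mono (by simp [hM0]) (by simp [hM0]) (by simp [hM0]) (by simp [hM0])
  have hφ0 : ∀ v < 2 ^ T, M0 aPHI (v : ℕ) = Net.initial s D v := by
    intro v hv
    rw [hM0, Function.update_self, arr_lt hv, eval_ifEQ]
    simp [Expr.eval, hss, hD, Net.initial]
  clear_value M0
  refine (Runs.loop (by omega) (fun i M' => i ≤ R + 1 ∧ M' aBASE 0 = ((R : ℤ) - i) * 2 ^ T ∧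
    ∃ φ : ℕ → ℤ, (∀ v < 2 ^ T, M' aPHI (v : ℕ) = φ v) ∧ (i = 0 → φ = Net.initial s D) ∧
    (0 < i → Net.Super T s D (st (R + 1 - i)) φ ∧
      ∀ v, φ v ≤ (st R).relax T D (Net.initial s D) v)) (R + 1) ?_ ?_).mono le_rfl ?_
  · exact ⟨by omega, by simp [ho0], _, hφ0, fun _ => rfl, fun h => by omega⟩
  · rintro i M1 hs1 ⟨hi, ho1, φ, hφ, hφi, hsup⟩ hc
    rw [undo_writes] at hs1
    have hpos : (0 : ℤ) < 2 ^ T := by positivity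
    have hiR : i ≤ R := by
      by_contra h
      apply hc
      have : M1 aBASE 0 < 0 := by
        rw [ho1]; exact mul_neg_of_neg_of_pos (by omega) hpos
      exact if_neg (not_le.2 this)
    refine ⟨by omega, ?_⟩
    have hg := hch.good hA (R - i) (by omega)
    have hnet : HasNet T (((R : ℤ) - i) * 2 ^ T) (st (R - i)) M1 := by
      have := (hnets0 (R - i) (by omega)).mono (hs1 _ (by decide)) (hs1 _ (by decide))
        (hs1 _ (by decide)) (hs1 _ (by decide))
      rwa [Nat.cast_sub hiR] at this
    refine (undo_runs (D := D) hW (hB0.mono (hs1 _ (by decide)) (hs1 _ (by decide))) hg hnet ho1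
      (by rw [hs1 _ (by decide), hD1]) hφ).mono le_rfl fun M2 _ ⟨h1, h2⟩ => ?_
    refine ⟨by omega, by rw [h1]; push_cast; ring, _, h2, fun h => by omega, fun _ => ?_⟩
    rw [show R + 1 - (i + 1) = R - i by omega]
    rcases Nat.eq_zero_or_pos i with rfl | hi0
    · rw [hφi rfl]
      exact ⟨(Net.weakSuper_initial hD0 _).relax hg hD0, fun v => le_rfl⟩
    · obtain ⟨h3, h4⟩ := hsup hi0
      obtain ⟨χ, has, mate, hχ, hcon⟩ := hch (R - i) (by omega)
      rw [show R - i + 1 = R + 1 - i by omega] at hcon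
      exact ⟨(h3.weak hcon hχ).relax hg hD0, fun v => (Net.relax_le v).trans (h4 v)⟩
  · rintro M1 - ⟨hc, i, hi, ho1, φ, hφ, hφi, hsup⟩
    have hiR : i = R + 1 := by
      by_contra h
      have : 0 ≤ M1 aBASE 0 := by
        rw [ho1]; exact mul_nonneg (by omega) (by positivity)
      simp [Expr.eval, this] at hc
    subst hiR
    obtain ⟨h3, h4⟩ := hsup (by omega)
    rw [Nat.sub_self] at h3
    exact ⟨φ, hφ, h3, h4⟩

end

namespace Net

variable {T s : ℕ} {D : ℤ} {st : ℕ → Net} {R : ℕ} {φ : ℕ → ℤ} {b : ℕ → ℤ}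

/-- The distances that are found satisfy the demand at a cost that is not larger than before. -/
theorem Chain.demand_le (hch : Chain T s st R) (hA : (st 0).Good T s) (hpot : (st R).pot T s = 0)
    (hφ : Super T s D (st 0) φ) (hle : ∀ v, φ v ≤ (st R).relax T D (initial s D) v)
    (hb : ∀ v < 2 ^ T, v ≠ s → b v ≤ (st 0).excess T v) (hD : (st 0).cost T < D) :
    ∑ v ∈ Finset.range (2 ^ T), b v * φ v ≤ (st 0).cost T ∧
      ∀ v < 2 ^ T, v ≠ s → 0 < b v → φ v < D := by
  have hg := hch.good hA R le_rfl
  have hb' : ∀ v < 2 ^ T, v ≠ s → b v ≤ (st R).excess T v := fun v hv hvs =>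
    (hb v hv hvs).trans (hch.excess_le hvs R le_rfl)
  have hlen : ∀ e < 2 ^ T, 0 < (st R).flow e → φ ((st R).dst e) ≤ (st R).len e := by
    intro e he hf
    refine (hle _).trans ((relax_le_cand he hf).trans ?_)
    rw [src_eq_of_pot hg hpot he hf, initial, if_pos rfl, zero_add]
  have hcost := hch.cost_le hA R le_rfl
  exact ⟨(sum_demand_le hg hpot hb' hφ.nonneg hφ.source hlen).trans hcost, fun v hv hvs hbv =>
    ((reached_of_demand hg hb' hlen hv hvs hbv).trans hcost).trans_lt hD⟩

end Net

end PRAM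

namespace PRAM

/-! ### Routing the demand along the tree -/

/-- Parent edges. -/
abbrev aPE : ℕ := 39
/-- Ancestors. -/
abbrev aPAR : ℕ := 40
/-- Sums of the demand over subtrees. -/
abbrev aSUM : ℕ := 41

/-- Whether the edge is a candidate for a parent edge. -/
def tightE : Expr :=
  .ifLE (rd aF) (.const 0) (.const 0) <|
  .ifLE (.add (.read aPHI (rd aS)) (rd aL)) (.read aPHI (rd aD))
    (.ifLE (sc aDB) (.read aPHI (rd aD)) (.const 0) (.const 1)) (.const 0)

/-- Choose the parent edges. -/
def parents : Prog :=
  .seq (pmap (sc aN) aPE (.const (-1))) <|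
  .seq (.pardo (sc aN) tightE aPE (rd aD) .pid) <|
  .seq (pmap (dbl (sc aN)) aPAR (sc aN)) <|
  pmap (sc aN) aPAR (.ifLE (.const 0) (rd aPE) (.read aS (rd aPE)) (sc aN))

/-- Sums over subtrees by pointer doubling. -/
def subtreeSums : Prog :=
  .seq (pmap (sc aN) aSUM (rd aBV)) <|
  pfor aJ (sc aN) <|
    .seq (gsum (rd aPAR) (rd aSUM)) <|
    .seq (pmap (sc aN) aSUM (.add (rd aSUM) (rootE .pid))) <|
    pmap (sc aN) aPAR (.read aPAR (rd aPAR))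

/-- Write the flow. -/
def writeFlow : Prog :=
  pmap (sc aN) 5 (ifEQ (.read aPE (rd aD)) .pid
    (.ifLE (.const 0) (rd 4) (.read aSUM (rd aD)) (.sub (.const 0) (.read aSUM (rd aD))))
    (.const 0))

/-- Route the demand along a tree of shortest paths. -/
def route : Prog := .seq parents (.seq subtreeSums writeFlow)

theorem subtreeSums_writes :
    subtreeSums.writes = [aSUM, aJ] ++ (gredArrays ++ [aSUM, aPAR]) ++ [aJ] := rfl

section

variable {W T s : ℕ} {D : ℤ} {M : Mem} {A : Net} {φ : ℕ → ℤ}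

/-- Every tight edge is an acceptable parent, so the competition between candidates is harmless;
`Super.parent` supplies at least one for each reached vertex other than `s`. -/
theorem parents_runs (hW : 2 * 2 ^ T + 1 ≤ W) (hB : Base T M) (hA : A.Good T s)
    (hnet : HasNet T 0 A M) (hD : M aDB 0 = D) (hφ : ∀ v < 2 ^ T, M aPHI (v : ℕ) = φ v)
    (hsup : Net.Super T s D A φ) :
    Runs W parents M 4 fun M' => ∃ par pe, Net.ParentEdges T s D A φ par pe ∧
      (∀ v < 2 ^ T, ∀ e : ℕ, M' aPE (v : ℕ) = e ↔ par v ∧ pe v = e) ∧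
      ∀ v ≤ 2 ^ T, M' aPAR (v : ℕ) = A.parentOf T par pe v := by
  obtain ⟨hW1, hW2⟩ := two_pow_succ_le hW
  have hS : ∀ i < 2 ^ T, M aS (i : ℕ) = A.src i := by simpa using hnet.src
  have hDst : ∀ i < 2 ^ T, M aD (i : ℕ) = A.dst i := by simpa using hnet.dst
  have hL : ∀ i < 2 ^ T, M aL (i : ℕ) = A.len i := by simpa using hnet.len
  have hF : ∀ i < 2 ^ T, M aF (i : ℕ) = A.flow i := by simpa using hnet.flow
  refine Runs.le (T := 1 + ((1 + (1 + 1)))) ?_ le_rfl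
  refine Runs.pmap_seq (2 ^ T) (by simp [Expr.eval, hB.size]) hW1 ?_
  set M0 := Function.update M aPE _ with hM0
  have hne0 : ∀ a, a ≠ aPE → M0 a = M a := fun a h => by rw [hM0, Function.update_of_ne h]
  have hpe0 : ∀ v < 2 ^ T, M0 aPE (v : ℕ) = -1 := by
    intro v hv; simp [hM0, hv, Expr.eval]
  clear_value M0
  have hg : ∀ i < 2 ^ T, tightE.eval M0 i ≠ 0 ↔
      0 < A.flow i ∧ φ (A.src i) + A.len i ≤ φ (A.dst i) ∧ φ (A.dst i) < D := by
    intro i hi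
    simp only [tightE, Expr.eval, hne0 aF (by decide), hne0 aS (by decide), hne0 aL (by decide),
      hne0 aD (by decide), hne0 aPHI (by decide), hne0 aDB (by decide), hS i hi, hDst i hi,
      hL i hi, hF i hi, hD, hφ _ (hA.src_lt i hi), hφ _ (hA.dst_lt i hi)]
    split_ifs <;> simp <;> omega
  refine (Runs.pardo (Q := fun M' => M' = _) (2 ^ T) (by simp [Expr.eval, hne0, hB.size]) hW1
    rfl).seq fun M1 hs1 h1 => ?_
  have hne1 : ∀ a, a ≠ aPE → M1 a = M a := fun a h => by
    rw [h1, Function.update_of_ne h, hne0 a h]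
  have hcase : ∀ v < 2 ^ T,
      (∃ j < 2 ^ T, 0 < A.flow j ∧ A.dst j = v ∧ φ (A.src j) + A.len j ≤ φ v ∧ φ v < D ∧
        M1 aPE (v : ℕ) = j) ∨
      ((∀ j < 2 ^ T, 0 < A.flow j → A.dst j = v → φ (A.src j) + A.len j ≤ φ v → ¬ φ v < D) ∧
        M1 aPE (v : ℕ) = -1) := by
    intro v hv
    rw [h1, Function.update_self]
    have hx : ∀ j < 2 ^ T, (rd aD).eval M0 j = A.dst j := fun j hj => by
      simp [Expr.eval, hne0, hDst j hj]
    rcases Mem.step_cases (M := M0) (k := 2 ^ T) (g := tightE) (a := aPE) (x := rd aD) (v := .pid)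
      (y := (v : ℤ)) with ⟨j, hj, hgj, hxj, hvj⟩ | ⟨hno, hvj⟩
    · left
      obtain ⟨g1, g2, g3⟩ := (hg j hj).1 hgj
      rw [hx j hj] at hxj
      obtain rfl : A.dst j = v := by exact_mod_cast hxj
      exact ⟨j, hj, g1, rfl, g2, g3, hvj⟩
    · right
      refine ⟨fun j hj g1 hd g2 g3 => ?_, by rw [hvj, hpe0 v hv]⟩
      subst hd
      exact hno j hj ((hg j hj).2 ⟨g1, g2, g3⟩) (hx j hj)
  clear h1
  have hpar : Net.ParentEdges T s D A φ (fun v => 0 ≤ M1 aPE (v : ℕ))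
      (fun v => (M1 aPE (v : ℕ)).toNat) := by
    have hget : ∀ v < 2 ^ T, 0 ≤ M1 aPE (v : ℕ) → ∃ j < 2 ^ T, 0 < A.flow j ∧ A.dst j = v ∧
        φ (A.src j) + A.len j ≤ φ v ∧ φ v < D ∧ (M1 aPE (v : ℕ)).toNat = j := by
      intro v hv h
      rcases hcase v hv with ⟨j, hj, g1, g2, g3, g4, g5⟩ | ⟨-, g⟩
      · exact ⟨j, hj, g1, g2, g3, g4, by rw [g5]; simp⟩
      · omega
    refine ⟨fun v hv => ⟨fun h => ?_, fun ⟨hvs, hvD⟩ => ?_⟩, fun v hv h => ?_, fun v hv h => ?_,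
      fun v hv h => ?_, fun v hv h => ?_⟩
    · obtain ⟨j, hj, g1, g2, g3, g4, g5⟩ := hget v hv h
      exact ⟨fun hc => hA.dst_ne j hj g1 (g2.trans hc), g4⟩
    · rcases hcase v hv with ⟨j, hj, g1, g2, g3, g4, g5⟩ | ⟨g, -⟩
      · simp only [g5]; omega
      · obtain ⟨e, he, hf, hd, hle⟩ := hsup.parent v hv hvs hvD
        exact absurd hvD (g e he hf hd hle)
    all_goals obtain ⟨j, hj, g1, g2, g3, g4, g5⟩ := hget v hv h
    all_goals simp only [g5]
    · exact hj
    · exact g1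
    · exact g2
    · exact g3
  -- The default must also be written at the index `2 ^ T`, the artificial top, which has to point
  -- to itself.
  refine Runs.pmap_seq (2 * 2 ^ T) (by simp [Expr.eval, hne1, hB.size, two_mul]) hW ?_
  refine Runs.pmap (2 ^ T) (by simp [Expr.eval, hne1, hB.size]) hW1 ?_
  refine ⟨_, _, hpar, fun v hv e => ?_, fun v hv => ?_⟩
  · rw [Function.update_of_ne (by decide), Function.update_of_ne (by decide)]
    constructor
    · intro h; rw [h]; simp
    · rintro ⟨h, h'⟩; rw [← h']; exact (Int.toNat_of_nonneg h).symm
  · rw [Function.update_self]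
    rcases hv.lt_or_eq with hv | rfl
    · rw [arr_lt hv]
      simp only [Expr.eval, Function.update_of_ne (show aPE ≠ aPAR by decide),
        Function.update_of_ne (show aS ≠ aPAR by decide),
        Function.update_of_ne (show aN ≠ aPAR by decide), hne1 aS (by decide), hne1 aN (by decide),
        hB.size]
      unfold Net.parentOf
      by_cases h : 0 ≤ M1 aPE (v : ℕ)
      · rw [if_pos h, if_pos ⟨hv, h⟩, ← hS _ (hpar.pe_lt v hv h), Int.toNat_of_nonneg h]
      · rw [if_neg h, if_neg (fun hc => h hc.2)]; simp
    · have h2 : 2 ^ T < 2 * 2 ^ T := by have := Nat.one_le_two_pow (n := T); omega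
      rw [arr_ge le_rfl, Function.update_self, arr_lt h2, Net.parentOf_top]
      simp [Expr.eval, hne1, hB.size]

/-- After `r` rounds the pointers make `2 ^ r` steps and the sums cover fewer than `2 ^ r` steps.
Grouping by the pointers uses the key `2 ^ T` too, which is admissible because there are `2 * 2 ^ T`
trees. -/
theorem subtreeSums_runs (hW : 2 * 2 ^ T + 1 ≤ W) (hB : Base T M) {q : ℕ → ℕ}
    (hq : ∀ v ≤ 2 ^ T, q v ≤ 2 ^ T) (hq' : q (2 ^ T) = 2 ^ T)
    (hpar : ∀ v ≤ 2 ^ T, M aPAR (v : ℕ) = q v) {b : ℕ → ℤ}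
    (hb : ∀ v < 2 ^ T, M aBV (v : ℕ) = b v) :
    Runs W subtreeSums M (T * (10 * T + 17) + 3) fun M' =>
      ∀ v < 2 ^ T, M' aSUM (v : ℕ) = Net.subtreeSum (2 ^ T) q b (2 ^ T) v := by
  obtain ⟨hW1, hW2⟩ := two_pow_succ_le hW
  refine Runs.le (T := 1 + (T * ((10 * T + 13) + (1 + 1) + 2) + 2)) ?_ (by ring_nf; omega)
  refine Runs.pmap_seq (2 ^ T) (by simp [Expr.eval, hB.size]) hW1 ?_
  set M0 := Function.update M aSUM _ with hM0
  have hB0 : Base T M0 := hB.mono (by simp [hM0]) (by simp [hM0])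
  have hpar0 : ∀ v ≤ 2 ^ T, M0 aPAR (v : ℕ) = q v := by simpa [hM0] using hpar
  have hsum0 : ∀ v < 2 ^ T, M0 aSUM (v : ℕ) = b v := by
    intro v hv; simp [hM0, hv, Expr.eval, hb v hv]
  clear_value M0
  refine (Runs.pfor hW2 (K := T) (I := fun r M' =>
    (∀ v ≤ 2 ^ T, M' aPAR (v : ℕ) = (q^[2 ^ r] v : ℕ)) ∧
    ∀ v < 2 ^ T, M' aSUM (v : ℕ) = Net.subtreeSum (2 ^ T) q b (2 ^ r) v)
    (by simp [Expr.eval, hB0.size]) (by decide) ?_ ?_).mono le_rfl fun M' _ h => h.2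
  · intro z
    refine ⟨fun v hv => ?_, fun v hv => ?_⟩
    · simp [hpar0 v hv]
    · rw [pow_zero, Net.subtreeSum_one hv]; simp [hsum0 v hv]
  · rintro r hr M1 hs1 ⟨hP, hSm⟩
    have hB1 : Base T M1 := hB0.mono (hs1 _ (by decide)) (hs1 _ (by decide))
    have hle : ∀ v ≤ 2 ^ T, q^[2 ^ r] v ≤ 2 ^ T := fun v hv => Net.iterate_le hq hv _
    have hpos := Nat.one_le_two_pow (n := T)
    refine Runs.le (T := (10 * T + 13) + (1 + 1)) ?_ (by omega)
    refine (gsum_runs hW hB1 (key := q^[2 ^ r]) (val := Net.subtreeSum (2 ^ T) q b (2 ^ r))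
      (fun i hi => by simp [Expr.eval, hP i hi.le])
      (fun i hi => by have := hle i hi.le; omega)
      (fun y i hi => by simp [Expr.eval, hSm i hi])).seq fun M2 hs2 hF => ?_
    rw [gsum, gred_writes] at hs2
    have hB2 := hB1.mono (hs2 _ (by decide)) (hs2 _ (by decide))
    refine Runs.pmap_seq (2 ^ T) (by simp [Expr.eval, hB2.size]) hW1 ?_
    refine Runs.pmap (2 ^ T) (by simp [Expr.eval, hB2.size]) hW1 fun z => ⟨fun v hv => ?_,
      fun v hv => ?_⟩
    · rw [Function.update_of_ne (by decide), Function.update_self,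
        show 2 ^ (r + 1) = 2 ^ r + 2 ^ r by ring, Function.iterate_add_apply]
      rcases hv.lt_or_eq with hv | rfl
      · rw [arr_lt hv]
        simp [Expr.eval, hs2 aPAR (by decide), hP v hv.le, hP _ (hle v hv.le)]
      · rw [arr_ge le_rfl, Net.iterate_fix hq', Net.iterate_fix hq',
          Function.update_of_ne (by decide), hs2 aPAR (by decide), hP _ le_rfl,
          Net.iterate_fix hq']
    · rw [Function.update_of_ne (by decide), Function.update_of_ne (by decide),
        Function.update_self, arr_lt hv, show 2 ^ (r + 1) = 2 ^ r + 2 ^ r by ring,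
        Net.subtreeSum_add hq hq' _ _ hv]
      have h1 : (rootE .pid).eval M2 v = _ := hF.eval_root hB2 (e := .pid) (k := v) rfl (by omega)
      have h2 : (Expr.add (rd aSUM) (rootE .pid)).eval M2 v =
        (rd aSUM).eval M2 v + (rootE .pid).eval M2 v := rfl
      rw [h2, h1]
      simp [Expr.eval, hs2 aSUM (by decide), hSm v hv, keySum, keySet]

theorem route_runs (hW : 2 * 2 ^ T + 1 ≤ W) (hB : Base T M) (hA : A.Good T s)
    (hnet : HasNet T 0 A M) (hD : M aDB 0 = D) (hφ : ∀ v < 2 ^ T, M aPHI (v : ℕ) = φ v)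
    (hsup : Net.Super T s D A φ) {b : ℕ → ℤ} (hb : ∀ v < 2 ^ T, M aBV (v : ℕ) = b v) :
    Runs W route M (T * (10 * T + 17) + 8) fun M' => ∃ par pe, Net.ParentEdges T s D A φ par pe ∧
      ∀ e < 2 ^ T, M' 5 (e : ℕ) =
        if 0 ≤ M 4 (e : ℕ) then A.treeFlow T par pe b e else -A.treeFlow T par pe b e := by
  obtain ⟨hW1, hW2⟩ := two_pow_succ_le hW
  refine Runs.le (T := 4 + ((T * (10 * T + 17) + 3) + 1)) ?_ (by omega)
  refine (parents_runs hW hB hA hnet hD hφ hsup).seq fun M1 hs1 ⟨par, pe, hpar, h1, h2⟩ => ?_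
  have hB1 := hB.mono (hs1 _ (by decide)) (hs1 _ (by decide))
  refine (subtreeSums_runs hW hB1 (Net.parentOf_le hA hpar) Net.parentOf_top h2 (b := b) (by
    rw [hs1 _ (by decide)]; exact hb)).seq fun M2 hs2 h3 => ?_
  rw [subtreeSums_writes] at hs2
  have hB2 := hB1.mono (hs2 _ (by decide)) (hs2 _ (by decide))
  refine Runs.pmap (2 ^ T) (by simp [Expr.eval, hB2.size]) hW1 ⟨par, pe, hpar, fun e he => ?_⟩
  have hdst : M2 aD (e : ℕ) = A.dst e := by
    rw [hs2 _ (by decide), hs1 _ (by decide)]; simpa using hnet.dst e he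
  have h4 : M2 4 = M 4 := by rw [hs2 _ (by decide), hs1 _ (by decide)]
  have hpe : M2 aPE = M1 aPE := hs2 _ (by decide)
  have hiff : (Expr.read aPE (rd aD)).eval M2 e = Expr.pid.eval M2 e ↔
      par (A.dst e) ∧ pe (A.dst e) = e := by
    rw [← h1 _ (hA.dst_lt e he), ← hpe, ← hdst]; rfl
  have hval : (Expr.ifLE (.const 0) (rd 4) (.read aSUM (rd aD))
      (.sub (.const 0) (.read aSUM (rd aD)))).eval M2 e =
      if 0 ≤ M 4 (e : ℕ) then Net.subtreeSum (2 ^ T) (A.parentOf T par pe) b (2 ^ T) (A.dst e)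
      else -Net.subtreeSum (2 ^ T) (A.parentOf T par pe) b (2 ^ T) (A.dst e) := by
    simp [Expr.eval, hdst, h4, h3 _ (hA.dst_lt e he)]
  rw [Function.update_self, arr_lt he, eval_ifEQ, Net.treeFlow]
  by_cases hc : par (A.dst e) ∧ pe (A.dst e) = e
  · rw [if_pos (hiff.2 hc), hval, if_pos hc]
  · rw [if_neg (mt hiff.1 hc), if_neg hc]; simp [Expr.eval]

end

end PRAM

namespace PRAM

/-! ### Preparing the input -/

/-- Total flow. -/
abbrev aSF : ℕ := 28
/-- Scaling factor, a power of two. -/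
abbrev aNF : ℕ := 29

/-- Orient the edges in the direction of the flow. -/
def orient : Prog :=
  .seq (pmap (sc aN) aS (.ifLE (.const 0) (rd 4) (rd 1) (rd 2))) <|
  .seq (pmap (sc aN) aD (.ifLE (.const 0) (rd 4) (rd 2) (rd 1))) <|
  .seq (pmap (sc aN) aL (rd 3)) <|
  pmap (sc aN) aF (emax (rd 4) (.sub (.const 0) (rd 4)))

/-- Compute the demand. -/
def demand : Prog :=
  .seq (gsum (rd aD) (rd aF)) <|
  .seq (pmap (sc aN) aBV (rootE .pid)) <|
  .seq (gsum (rd aS) (rd aF)) <|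
  pmap (sc aN) aBV (.sub (rd aBV) (rootE .pid))

/-- Find the source. -/
def source : Prog :=
  .seq (pset aSS (.const 0)) <|
  .pardo (sc aN) (.ifLE (.const 0) (rd aBV) (.const 0) (.const 1)) aSS (.const 0) .pid

/-- Scale the lengths by a power of two larger than the total flow, and increase them by one. -/
def scale : Prog :=
  .seq (gtotal aSF (rd aF)) <|
  .seq (pset aNF (.const 1)) <|
  .seq (.loop (.ifLE (sc aNF) (sc aSF) (.const 1) (.const 0))
    (.seq (pset aNF (dbl (sc aNF))) (pmap (sc aN) aL (dbl (rd aL))))) <|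
  pmap (sc aN) aL (.add (rd aL) (.const 1))

/-- Compute a bound on the cost. -/
def bound : Prog :=
  .seq (gtotal aDB (rd aL)) <|
  pfor aJ (sc aNF) (pset aDB (dbl (sc aDB)))

/-- Remove the flow into the source. -/
def drop : Prog := pmap (sc aN) aF (ifEQ (rd aD) (sc aSS) (.const 0) (rd aF))

/-- Compute the codes of the edge slots. -/
def codes : Prog :=
  .seq (pmap (sc aN) aCODE (.sub (.sub (sc aN) (.const 1)) .pid)) <|
  .seq (pfor aJ (sc aN) (pmap (sc aN) aCODE (dbl (rd aCODE)))) <|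
  pmap (sc aN) aCODE (.add (rd aCODE) .pid)

/-- Prepare the input. -/
def prepare : Prog :=
  .seq orient <| .seq demand <| .seq source <| .seq scale <| .seq bound <| .seq drop codes

theorem demand_writes : demand.writes = gredArrays ++ [aBV] ++ gredArrays ++ [aBV] := rfl

theorem scale_writes : scale.writes = gredArrays ++ [aSF, aNF, aNF, aL, aL] := rfl

theorem bound_writes : bound.writes = gredArrays ++ [aDB, aJ, aDB, aJ] := rfl

/-- The input arrays. -/
structure HasInput (T : ℕ) (S D : ℕ → ℕ) (L F : ℕ → ℤ) (M : Mem) : Prop where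
  src : ∀ i < 2 ^ T, M 1 (i : ℕ) = S i
  dst : ∀ i < 2 ^ T, M 2 (i : ℕ) = D i
  len : ∀ i < 2 ^ T, M 3 (i : ℕ) = L i
  flow : ∀ i < 2 ^ T, M 4 (i : ℕ) = F i

namespace Net

/-- The net whose edges are oriented in the direction of the flow. -/
def oriented (S D : ℕ → ℕ) (L F : ℕ → ℤ) : Net where
  src i := if 0 ≤ F i then S i else D i
  dst i := if 0 ≤ F i then D i else S i
  len := L
  flow i := |F i|

/-- Scale the lengths by `2 ^ κ` and increase them by one. -/
def scaled (κ : ℕ) (A : Net) : Net := { A with len := fun e => A.len e * 2 ^ κ + 1 }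

/-- Remove the flow into `s`. -/
def dropped (s : ℕ) (A : Net) : Net := { A with flow := fun e => if A.dst e = s then 0 else A.flow e }

theorem excess_eq_keySum (T : ℕ) (A : Net) (v : ℕ) :
    A.excess T v = keySum T A.dst A.flow v - keySum T A.src A.flow v := by
  simp only [excess, keySum, keySet, mul_sub, mul_ite, mul_one, mul_zero, Finset.sum_sub_distrib,
    Finset.sum_filter]

end Net

section

variable {W T : ℕ} {M : Mem} {A : Net}

theorem orient_runs (hW : 2 * 2 ^ T + 1 ≤ W) (hB : Base T M) {S D : ℕ → ℕ} {L F : ℕ → ℤ}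
    (h : HasInput T S D L F M) :
    Runs W orient M 4 (HasNet T 0 (Net.oriented S D L F)) := by
  obtain ⟨hW1, hW2⟩ := two_pow_succ_le hW
  refine Runs.le (T := 1 + (1 + (1 + 1))) ?_ le_rfl
  refine Runs.pmap_seq (2 ^ T) (by simp [Expr.eval, hB.size]) hW1 ?_
  refine Runs.pmap_seq (2 ^ T) (by simp [Expr.eval, hB.size]) hW1 ?_
  refine Runs.pmap_seq (2 ^ T) (by simp [Expr.eval, hB.size]) hW1 ?_
  refine Runs.pmap (2 ^ T) (by simp [Expr.eval, hB.size]) hW1 ?_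
  refine ⟨fun i hi => ?_, fun i hi => ?_, fun i hi => ?_, fun i hi => ?_⟩ <;> rw [zero_add]
  · simp [hi, Expr.eval, h.src i hi, h.dst i hi, h.flow i hi, Net.oriented]
  · simp [hi, Expr.eval, h.src i hi, h.dst i hi, h.flow i hi, Net.oriented]
  · simp [hi, Expr.eval, h.len i hi, Net.oriented]
  · rw [Function.update_self, arr_lt hi, eval_emax]
    simp [Expr.eval, h.flow i hi, Net.oriented, abs]

theorem demand_runs (hW : 2 * 2 ^ T + 1 ≤ W) (hB : Base T M) (h : HasNet T 0 A M)
    (hS : ∀ e < 2 ^ T, A.src e < 2 ^ T) (hD : ∀ e < 2 ^ T, A.dst e < 2 ^ T) :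
    Runs W demand M (20 * T + 28) fun M' => ∀ v < 2 ^ T, M' aBV (v : ℕ) = A.excess T v := by
  obtain ⟨hW1, hW2⟩ := two_pow_succ_le hW
  refine Runs.le (T := (10 * T + 13) + (1 + ((10 * T + 13) + 1))) ?_ (by omega)
  refine (gsum_runs hW hB (key := A.dst) (val := A.flow)
    (fun i hi => by simpa [Expr.eval] using h.dst i hi)
    (fun i hi => by have := hD i hi; omega)
    (fun y i hi => by simpa [Expr.eval] using h.flow i hi)).seq fun M1 hs1 hF1 => ?_
  rw [gsum, gred_writes] at hs1
  have hB1 := hB.mono (hs1 _ (by decide)) (hs1 _ (by decide))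
  refine Runs.pmap_seq (2 ^ T) (by simp [Expr.eval, hB1.size]) hW1 ?_
  set M2 := Function.update M1 aBV _ with hM2
  have hB2 : Base T M2 := hB1.mono (by simp [hM2]) (by simp [hM2])
  have hbv2 : ∀ v < 2 ^ T, M2 aBV (v : ℕ) = keySum T A.dst A.flow v := by
    intro v hv
    rw [hM2, Function.update_self, arr_lt hv]
    exact hF1.eval_root hB1 (e := .pid) rfl (by omega)
  have h2 : HasNet T 0 A M2 := by
    refine h.mono ?_ ?_ ?_ ?_ <;>
    · rw [hM2, Function.update_of_ne (by decide), hs1 _ (by decide)]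
  clear_value M2
  refine (gsum_runs hW hB2 (key := A.src) (val := A.flow)
    (fun i hi => by simpa [Expr.eval] using h2.src i hi)
    (fun i hi => by have := hS i hi; omega)
    (fun y i hi => by simpa [Expr.eval] using h2.flow i hi)).seq fun M3 hs3 hF3 => ?_
  rw [gsum, gred_writes] at hs3
  have hB3 := hB2.mono (hs3 _ (by decide)) (hs3 _ (by decide))
  refine Runs.pmap (2 ^ T) (by simp [Expr.eval, hB3.size]) hW1 fun v hv => ?_
  rw [Function.update_self, arr_lt hv, Net.excess_eq_keySum, ← hbv2 v hv,
    ← hF3.eval_root hB3 (e := .pid) (i := v) (k := v) rfl (by omega), ← hs3 aBV (by decide)]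
  rfl

/-- Any vertex with negative demand is accepted; the initial value `0` survives only if there is
none. -/
theorem source_runs (hW : 2 * 2 ^ T + 1 ≤ W) (hB : Base T M) {b : ℕ → ℤ}
    (hb : ∀ v < 2 ^ T, M aBV (v : ℕ) = b v) :
    Runs W source M 2 fun M' => ∃ s : ℕ, s < 2 ^ T ∧ M' aSS 0 = s ∧
      (b s < 0 ∨ s = 0 ∧ ∀ v < 2 ^ T, 0 ≤ b v) := by
  obtain ⟨hW1, hW2⟩ := two_pow_succ_le hW
  refine Runs.le (T := 1 + 1) ?_ le_rfl
  refine Runs.pset_seq hW2 ?_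
  refine Runs.pardo (2 ^ T) (by simp [Expr.eval, hB.size]) hW1 ?_
  rw [Function.update_self]
  set M1 := Function.update M aSS _ with hM1
  have h0 : M1 aSS 0 = 0 := by simp [hM1, Expr.eval]
  have hg : ∀ v < 2 ^ T, (Expr.ifLE (.const 0) (rd aBV) (.const 0) (.const 1)).eval M1 v ≠ 0 ↔
      b v < 0 := by
    intro v hv
    simp only [Expr.eval, hM1, Function.update_of_ne (show aBV ≠ aSS by decide), hb v hv]
    split_ifs <;> simp <;> omega
  rcases Mem.step_cases (M := M1) (k := 2 ^ T)
    (g := .ifLE (.const 0) (rd aBV) (.const 0) (.const 1)) (a := aSS) (x := .const 0) (v := .pid)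
    (y := 0) with ⟨j, hj, hgj, -, hvj⟩ | ⟨hno, hvj⟩
  · exact ⟨j, hj, hvj, .inl ((hg j hj).1 hgj)⟩
  · refine ⟨0, by positivity, by rw [hvj, h0]; rfl, .inr ⟨rfl, fun v hv => ?_⟩⟩
    by_contra hc
    exact hno v hv ((hg v hv).2 (by omega)) rfl

theorem scale_runs (hW : 2 * 2 ^ T + 1 ≤ W) (hB : Base T M) (h : HasNet T 0 A M) {K : ℕ}
    (hK : ∑ e ∈ Finset.range (2 ^ T), A.flow e < 2 ^ K) :
    Runs W scale M (10 * T + 3 * K + 17) fun M' => ∃ κ : ℕ, κ ≤ K ∧ M' aNF 0 = 2 ^ κ ∧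
      ∑ e ∈ Finset.range (2 ^ T), A.flow e < 2 ^ κ ∧ HasNet T 0 (A.scaled κ) M' := by
  obtain ⟨hW1, hW2⟩ := two_pow_succ_le hW
  refine Runs.le (T := (10 * T + 14) + (1 + ((K * ((1 + 1) + 1) + 1) + 1))) ?_ (by omega)
  refine (gtotal_runs hW hB (val := A.flow)
    (fun y i hi => by simpa [Expr.eval] using h.flow i hi)).seq fun M1 hs1 hF => ?_
  rw [gtotal, gsum] at hs1
  have hB1 := hB.mono (hs1 _ (by decide)) (hs1 _ (by decide))
  refine Runs.pset_seq hW2 ?_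
  set M2 := Function.update M1 aNF _ with hM2
  have hB2 : Base T M2 := hB1.mono (by simp [hM2]) (by simp [hM2])
  have hF2 : M2 aSF 0 = ∑ e ∈ Finset.range (2 ^ T), A.flow e := by simp [hM2, hF]
  have hN2 : M2 aNF 0 = 1 := by simp [hM2, Expr.eval]
  have h2 : HasNet T 0 A M2 := by
    refine h.mono ?_ ?_ ?_ ?_ <;>
    · rw [hM2, Function.update_of_ne (by decide), hs1 _ (by decide)]
  clear_value M2
  refine (Runs.loop (by omega) (fun r M' => r ≤ K ∧ M' aNF 0 = 2 ^ r ∧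
    ∀ i < 2 ^ T, M' aL (i : ℕ) = A.len i * 2 ^ r) K ?_ ?_).seq ?_
  · exact ⟨by omega, by simp [hN2], fun i hi => by simpa using h2.len i hi⟩
  · rintro r M3 hs3 ⟨hr, hN3, hL3⟩ hc
    have hB3 : Base T M3 := hB2.mono (hs3 _ (by decide)) (hs3 _ (by decide))
    have hrK : r < K := by
      refine lt_of_le_of_ne hr ?_
      rintro rfl
      apply hc
      have : M3 aSF 0 < M3 aNF 0 := by rw [hN3, hs3 _ (by decide), hF2]; exact hK
      exact if_neg (not_le.2 this)
    refine ⟨hrK, Runs.pset_seq hW2 ?_⟩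
    refine Runs.pmap (2 ^ T) (by simp [Expr.eval, hB3.size]) hW1 ⟨by omega, ?_, fun i hi => ?_⟩
    · simp [Expr.eval, hN3]; ring
    · simp [Expr.eval, hi, hL3]; ring
  · rintro M3 hs3 ⟨hc, r, hr, hN3, hL3⟩
    have hB3 : Base T M3 := hB2.mono (hs3 _ (by decide)) (hs3 _ (by decide))
    have hlt : M3 aSF 0 < M3 aNF 0 := by
      by_contra hle
      have : (Expr.ifLE (sc aNF) (sc aSF) (.const 1) (.const 0)).eval M3 0 = 1 :=
        if_pos (not_lt.1 hle)
      omega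
    refine Runs.pmap (2 ^ T) (by simp [Expr.eval, hB3.size]) hW1 ⟨r, hr, ?_, ?_, ?_, ?_, ?_, ?_⟩
    · rw [Function.update_of_ne (by decide), hN3]
    · rw [← hN3, ← hF2, ← hs3 aSF (by decide)]; exact hlt
    · rw [Function.update_of_ne (by decide), hs3 _ (by decide)]; exact h2.src
    · rw [Function.update_of_ne (by decide), hs3 _ (by decide)]; exact h2.dst
    · intro i hi
      simp [Expr.eval, hi, hL3, Net.scaled]
    · rw [Function.update_of_ne (by decide), hs3 _ (by decide)]; exact h2.flow

theorem bound_runs (hW : 2 * 2 ^ T + 1 ≤ W) (hB : Base T M) (h : HasNet T 0 A M) {κ : ℕ}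
    (hκ : M aNF 0 = 2 ^ κ) :
    Runs W bound M (10 * T + 3 * κ + 16) fun M' =>
      M' aDB 0 = (∑ e ∈ Finset.range (2 ^ T), A.len e) * 2 ^ κ := by
  obtain ⟨hW1, hW2⟩ := two_pow_succ_le hW
  refine Runs.le (T := (10 * T + 14) + (κ * (1 + 2) + 2)) ?_ (by omega)
  refine (gtotal_runs hW hB (val := A.len)
    (fun y i hi => by simpa [Expr.eval] using h.len i hi)).seq fun M1 hs1 hF => ?_
  rw [gtotal, gsum] at hs1
  refine (Runs.pfor hW2 (K := κ) (I := fun r M' =>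
    M' aDB 0 = (∑ e ∈ Finset.range (2 ^ T), A.len e) * 2 ^ r)
    (by simp [Expr.eval, hs1 aNF (by decide), hκ]) (by decide) ?_ ?_)
  · intro z; simp [hF]
  · intro r _ M2 _ h2
    refine Runs.pset hW2 fun z => ?_
    simp [Expr.eval, h2]; ring

theorem drop_runs (hW : 2 * 2 ^ T + 1 ≤ W) (hB : Base T M) (h : HasNet T 0 A M) {s : ℕ}
    (hs : M aSS 0 = s) : Runs W drop M 1 (HasNet T 0 (A.dropped s)) := by
  obtain ⟨hW1, hW2⟩ := two_pow_succ_le hW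
  refine Runs.pmap (2 ^ T) (by simp [Expr.eval, hB.size]) hW1 ⟨?_, ?_, ?_, ?_⟩
  · rw [Function.update_of_ne (by decide)]; exact h.src
  · rw [Function.update_of_ne (by decide)]; exact h.dst
  · rw [Function.update_of_ne (by decide)]; exact h.len
  · intro i hi
    have h1 := h.dst i hi
    have h2 := h.flow i hi
    rw [zero_add] at h1 h2 ⊢
    rw [Function.update_self, arr_lt hi, eval_ifEQ]
    simp [Expr.eval, h1, h2, hs, Net.dropped]

theorem codes_runs (hW : 2 * 2 ^ T + 1 ≤ W) (hB : Base T M) :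
    Runs W codes M (3 * T + 4) fun M' =>
      ∀ i < 2 ^ T, M' aCODE (i : ℕ) = (Net.code T i : ℕ) := by
  obtain ⟨hW1, hW2⟩ := two_pow_succ_le hW
  refine Runs.le (T := 1 + ((T * (1 + 2) + 2) + 1)) ?_ (by omega)
  refine Runs.pmap_seq (2 ^ T) (by simp [Expr.eval, hB.size]) hW1 ?_
  set M1 := Function.update M aCODE _ with hM1
  have hB1 : Base T M1 := hB.mono (by simp [hM1]) (by simp [hM1])
  have h1 : ∀ i < 2 ^ T, M1 aCODE (i : ℕ) = 2 ^ T - 1 - i := by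
    intro i hi; simp [hM1, hi, Expr.eval, hB.size]
  clear_value M1
  refine (Runs.pfor hW2 (K := T) (I := fun r M' =>
    ∀ i < 2 ^ T, M' aCODE (i : ℕ) = (2 ^ T - 1 - i) * 2 ^ r)
    (by simp [Expr.eval, hB1.size]) (by decide) ?_ ?_).seq ?_
  · intro z i hi; simp [h1 i hi]
  · intro r _ M2 hs2 h2
    have hB2 : Base T M2 := hB1.mono (hs2 _ (by decide)) (hs2 _ (by decide))
    refine Runs.pmap (2 ^ T) (by simp [Expr.eval, hB2.size]) hW1 fun z i hi => ?_
    simp [Expr.eval, hi, h2]; ring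
  · intro M2 hs2 h2
    have hB2 : Base T M2 := hB1.mono (hs2 _ (by decide)) (hs2 _ (by decide))
    refine Runs.pmap (2 ^ T) (by simp [Expr.eval, hB2.size]) hW1 fun i hi => ?_
    have : ((2 ^ T - 1 - i : ℕ) : ℤ) = 2 ^ T - 1 - i := by
      rw [Nat.cast_sub (by omega), Nat.cast_sub (Nat.one_le_two_pow)]; push_cast; ring
    simp [Expr.eval, hi, h2, Net.code, this]

theorem prepare_runs (hW : 2 * 2 ^ T + 1 ≤ W) (hB : Base T M) {S D : ℕ → ℕ} {L F : ℕ → ℤ}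
    (h : HasInput T S D L F M) (hS : ∀ i < 2 ^ T, S i < 2 ^ T) (hD : ∀ i < 2 ^ T, D i < 2 ^ T)
    {K : ℕ} (hK : ∑ e ∈ Finset.range (2 ^ T), |F e| < 2 ^ K) :
    Runs W prepare M (43 * T + 6 * K + 72) fun M' => ∃ s : ℕ, s < 2 ^ T ∧ ∃ κ : ℕ, κ ≤ K ∧
      M' aSS 0 = s ∧
      ((Net.oriented S D L F).excess T s < 0 ∨
        s = 0 ∧ ∀ v < 2 ^ T, 0 ≤ (Net.oriented S D L F).excess T v) ∧
      (∀ v < 2 ^ T, M' aBV (v : ℕ) = (Net.oriented S D L F).excess T v) ∧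
      ∑ e ∈ Finset.range (2 ^ T), |F e| < 2 ^ κ ∧
      M' aDB 0 = (∑ e ∈ Finset.range (2 ^ T), (L e * 2 ^ κ + 1)) * 2 ^ κ ∧
      HasNet T 0 (((Net.oriented S D L F).scaled κ).dropped s) M' ∧
      ∀ i < 2 ^ T, M' aCODE (i : ℕ) = (Net.code T i : ℕ) := by
  refine Runs.le (T := 4 + ((20 * T + 28) + (2 + ((10 * T + 3 * K + 17) +
    ((10 * T + 3 * K + 16) + (1 + (3 * T + 4))))))) ?_ (by omega)
  refine (orient_runs hW hB h).seq fun M1 hs1 hn1 => ?_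
  have hB1 := hB.mono (hs1 _ (by decide)) (hs1 _ (by decide))
  refine (demand_runs hW hB1 hn1 (fun e he => ?_) (fun e he => ?_)).seq fun M2 hs2 hb2 => ?_
  · have := hS e he; have := hD e he
    simp only [Net.oriented]; split_ifs <;> assumption
  · have := hS e he; have := hD e he
    simp only [Net.oriented]; split_ifs <;> assumption
  rw [demand_writes] at hs2
  have hB2 := hB1.mono (hs2 _ (by decide)) (hs2 _ (by decide))
  have hn2 := hn1.mono (hs2 _ (by decide)) (hs2 _ (by decide)) (hs2 _ (by decide)) (hs2 _ (by decide))
  refine (source_runs hW hB2 hb2).seq fun M3 hs3 ⟨s, hs, hss, hbs⟩ => ?_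
  have hB3 := hB2.mono (hs3 _ (by decide)) (hs3 _ (by decide))
  have hn3 := hn2.mono (hs3 _ (by decide)) (hs3 _ (by decide)) (hs3 _ (by decide)) (hs3 _ (by decide))
  refine (scale_runs hW hB3 hn3 hK).seq fun M4 hs4 ⟨κ, hκ, hN4, hF4, hn4⟩ => ?_
  rw [scale_writes] at hs4
  have hB4 := hB3.mono (hs4 _ (by decide)) (hs4 _ (by decide))
  refine ((bound_runs hW hB4 hn4 hN4).le (T' := 10 * T + 3 * K + 16) (by omega)).seq
    fun M5 hs5 hD5 => ?_
  rw [bound_writes] at hs5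
  have hB5 := hB4.mono (hs5 _ (by decide)) (hs5 _ (by decide))
  have hn5 := hn4.mono (hs5 _ (by decide)) (hs5 _ (by decide)) (hs5 _ (by decide)) (hs5 _ (by decide))
  refine (drop_runs hW hB5 hn5 (s := s) (by
    rw [hs5 _ (by decide), hs4 _ (by decide), hss])).seq fun M6 hs6 hn6 => ?_
  have hB6 := hB5.mono (hs6 _ (by decide)) (hs6 _ (by decide))
  refine (codes_runs hW hB6).mono le_rfl fun M7 hs7 hc => ?_
  refine ⟨s, hs, κ, hκ, ?_, hbs, ?_, hF4, ?_, ?_, hc⟩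
  · rw [hs7 _ (by decide), hs6 _ (by decide), hs5 _ (by decide), hs4 _ (by decide), hss]
  · rw [hs7 _ (by decide), hs6 _ (by decide), hs5 _ (by decide), hs4 _ (by decide),
      hs3 _ (by decide)]
    exact hb2
  · rw [hs7 _ (by decide), hs6 _ (by decide), hD5]; rfl
  · exact hn6.mono (hs7 _ (by decide)) (hs7 _ (by decide)) (hs7 _ (by decide)) (hs7 _ (by decide))

end

end PRAM

namespace PRAM

/-! ### The whole algorithm -/

/-- The algorithm. -/
def solve : Prog := .seq setup <| .seq prepare <| .seq rounds <| .seq distances route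

theorem prepare_writes : prepare.writes = orient.writes ++ (demand.writes ++ (source.writes ++
    (scale.writes ++ (bound.writes ++ (drop.writes ++ codes.writes))))) := rfl

theorem rounds_writes : rounds.writes = [aBASE] ++ (potential.writes ++ round.writes) := rfl

theorem distances_writes : distances.writes = [aPHI] ++ undo.writes := rfl

namespace Net

variable {T s κ : ℕ} {S D : ℕ → ℕ} {L F : ℕ → ℤ}

/-- The net in which the tree is found. -/
abbrev start (S D : ℕ → ℕ) (L F : ℕ → ℤ) (κ s : ℕ) : Net :=
  ((oriented S D L F).scaled κ).dropped s

theorem start_flow_nonneg (e : ℕ) : 0 ≤ (start S D L F κ s).flow e := by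
  simp only [start, dropped, scaled, oriented]
  split_ifs <;> first | exact le_rfl | exact abs_nonneg _

theorem start_flow_le (e : ℕ) : (start S D L F κ s).flow e ≤ |F e| := by
  simp only [start, dropped, scaled, oriented]
  split_ifs <;> first | exact le_rfl | exact abs_nonneg _

theorem start_good (hS : ∀ i < 2 ^ T, S i < 2 ^ T) (hD : ∀ i < 2 ^ T, D i < 2 ^ T)
    (hL : ∀ i < 2 ^ T, 0 ≤ L i) (hne : ∀ i < 2 ^ T, F i ≠ 0 → S i ≠ D i) :
    (start S D L F κ s).Good T s where
  src_lt e he := by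
    have := hS e he; have := hD e he
    simp only [start, dropped, scaled, oriented]; split_ifs <;> assumption
  dst_lt e he := by
    have := hS e he; have := hD e he
    simp only [start, dropped, scaled, oriented]; split_ifs <;> assumption
  flow_nonneg e _ := start_flow_nonneg e
  len_nonneg e he := by
    have := hL e he
    simp only [start, dropped, scaled, oriented]; positivity
  ne e he hf := by
    have h1 := hne e he fun hc => by
      have := start_flow_le (S := S) (D := D) (L := L) (F := F) (κ := κ) (s := s) e
      rw [hc, abs_zero] at this; omega
    simp only [start, dropped, scaled, oriented]
    split_ifs
    · exact h1
    · exact h1.symm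
  dst_ne e _ hf hc := by
    have : (start S D L F κ s).flow e = 0 := if_pos hc
    omega

/-- Discarding flow into `s` only reduces the outflow of the other vertices. -/
theorem start_excess {v : ℕ} (hv : v ≠ s) :
    (oriented S D L F).excess T v ≤ (start S D L F κ s).excess T v := by
  refine Finset.sum_le_sum fun e _ => ?_
  have h1 : (start S D L F κ s).src = (oriented S D L F).src := rfl
  have h2 : (start S D L F κ s).dst = (oriented S D L F).dst := rfl
  have h3 : (start S D L F κ s).flow e =
    if (oriented S D L F).dst e = s then 0 else (oriented S D L F).flow e := rfl
  have h4 : 0 ≤ (oriented S D L F).flow e := abs_nonneg _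
  rw [h1, h2, h3]
  by_cases hd : (oriented S D L F).dst e = s
  · rw [if_pos hd, hd, if_neg (Ne.symm hv)]
    split_ifs <;> omega
  · rw [if_neg hd]

theorem start_sum_excess (hA : (start S D L F κ s).Good T s) :
    ∑ v ∈ Finset.range (2 ^ T), (oriented S D L F).excess T v = 0 := by
  have := sum_excess hA (fun _ => 1) (oriented S D L F).flow
  simp only [one_mul, sub_self, mul_zero, Finset.sum_const_zero] at this
  exact this

theorem start_cost (hL : ∀ i < 2 ^ T, 0 ≤ L i) : (start S D L F κ s).cost T ≤
    2 ^ κ * (∑ e ∈ Finset.range (2 ^ T), |F e| * L e) + ∑ e ∈ Finset.range (2 ^ T), |F e| := by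
  rw [Finset.mul_sum, ← Finset.sum_add_distrib]
  refine Finset.sum_le_sum fun e he => ?_
  have h0 := hL e (Finset.mem_range.1 he)
  have h1 : (start S D L F κ s).len e = L e * 2 ^ κ + 1 := rfl
  calc (start S D L F κ s).flow e * (start S D L F κ s).len e
      ≤ |F e| * (start S D L F κ s).len e :=
        mul_le_mul_of_nonneg_right (start_flow_le e) (by rw [h1]; positivity)
    _ = _ := by rw [h1]; ring

/-- No edge carries as much as `2 ^ κ`, so the right side exceeds the cost and can stand for
infinity among the distances. -/
theorem start_cost_lt (hL : ∀ i < 2 ^ T, 0 ≤ L i)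
    (hκ : ∑ e ∈ Finset.range (2 ^ T), |F e| < 2 ^ κ) : (start S D L F κ s).cost T <
    (∑ e ∈ Finset.range (2 ^ T), (L e * 2 ^ κ + 1)) * 2 ^ κ := by
  have hlen : ∀ e ∈ Finset.range (2 ^ T), 0 < L e * 2 ^ κ + 1 := fun e he => by
    have := hL e (Finset.mem_range.1 he); positivity
  have hpos : 0 < ∑ e ∈ Finset.range (2 ^ T), (L e * 2 ^ κ + 1) :=
    Finset.sum_pos hlen ⟨0, by simp⟩
  calc (start S D L F κ s).cost T
      ≤ ∑ e ∈ Finset.range (2 ^ T), (L e * 2 ^ κ + 1) * ∑ e ∈ Finset.range (2 ^ T), |F e| := by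
        refine Finset.sum_le_sum fun e he => ?_
        rw [mul_comm]
        refine mul_le_mul_of_nonneg_left ((start_flow_le e).trans ?_) (hlen e he).le
        exact Finset.single_le_sum (f := fun e => |F e|) (fun i _ => abs_nonneg _) he
    _ = (∑ e ∈ Finset.range (2 ^ T), (L e * 2 ^ κ + 1)) * ∑ e ∈ Finset.range (2 ^ T), |F e| := by
        rw [Finset.sum_mul]
    _ < _ := mul_lt_mul_of_pos_left hκ hpos

theorem start_pot : (start S D L F κ s).pot T s ≤ ∑ e ∈ Finset.range (2 ^ T), |F e| := by
  refine Finset.sum_le_sum fun e _ => ?_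
  have h1 := start_flow_nonneg (S := S) (D := D) (L := L) (F := F) (κ := κ) (s := s) e
  have h2 := start_flow_le (S := S) (D := D) (L := L) (F := F) (κ := κ) (s := s) e
  split_ifs <;> omega

/-- `g` is a cheaper flow along a tree rooted at `s` that satisfies the same demand as `F`. -/
structure Solution (T : ℕ) (S D : ℕ → ℕ) (L F g : ℕ → ℤ) (s : ℕ) (par : ℕ → Prop) (pe : ℕ → ℕ)
    (φ : ℕ → ℤ) : Prop where
  source : s = 0 ∨ (oriented S D L F).excess T s ≠ 0
  nonneg : ∀ e < 2 ^ T, 0 ≤ g e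
  excess_eq : ∀ v < 2 ^ T,
    ({ oriented S D L F with flow := g } : Net).excess T v = (oriented S D L F).excess T v
  cost_le : ∑ e ∈ Finset.range (2 ^ T), g e * L e ≤ ∑ e ∈ Finset.range (2 ^ T), |F e| * L e
  par_ne : ∀ v < 2 ^ T, par v → v ≠ s
  flow_ne : ∀ v < 2 ^ T, par v → F (pe v) ≠ 0
  dst_pe : ∀ v < 2 ^ T, par v → (oriented S D L F).dst (pe v) = v
  src_pe : ∀ v < 2 ^ T, par v →
    (oriented S D L F).src (pe v) = s ∨ par ((oriented S D L F).src (pe v))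
  lt : ∀ v < 2 ^ T, par v → φ ((oriented S D L F).src (pe v)) < φ v
  support : ∀ e < 2 ^ T, g e ≠ 0 →
    par ((oriented S D L F).dst e) ∧ pe ((oriented S D L F).dst e) = e

/-- The added unit per edge makes all lengths positive, as the tree requires; the scaling makes the
perturbation of the cost of `F` smaller than one scaled unit. -/
theorem solution_treeFlow (hS : ∀ i < 2 ^ T, S i < 2 ^ T) (hD : ∀ i < 2 ^ T, D i < 2 ^ T)
    (hL : ∀ i < 2 ^ T, 0 ≤ L i) (hne : ∀ i < 2 ^ T, F i ≠ 0 → S i ≠ D i)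
    (hs : s = 0 ∨ (oriented S D L F).excess T s ≠ 0)
    (hb : ∀ v < 2 ^ T, v ≠ s → 0 ≤ (oriented S D L F).excess T v)
    (hκ : ∑ e ∈ Finset.range (2 ^ T), |F e| < 2 ^ κ) {B : ℤ} {φ : ℕ → ℤ}
    {par : ℕ → Prop} {pe : ℕ → ℕ} (hpar : ParentEdges T s B (start S D L F κ s) φ par pe)
    (hcost : ∑ v ∈ Finset.range (2 ^ T), (oriented S D L F).excess T v * φ v ≤
      (start S D L F κ s).cost T)
    (hbB : ∀ v < 2 ^ T, v ≠ s → 0 < (oriented S D L F).excess T v → φ v < B) :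
    Solution T S D L F
      ((start S D L F κ s).treeFlow T par pe ((oriented S D L F).excess T)) s par pe φ := by
  have hA := start_good (κ := κ) (s := s) hS hD hL hne
  have hlen : ∀ e < 2 ^ T, 1 ≤ (start S D L F κ s).len e := fun e he => by
    have := hL e he
    have h1 : (start S D L F κ s).len e = L e * 2 ^ κ + 1 := rfl
    rw [h1, le_add_iff_nonneg_left]; positivity
  have hsum := start_sum_excess hA
  have htf := fun v (hv : v < 2 ^ T) => treeFlow_excess hA hlen hpar hb hbB hsum hv
  have htc := (treeFlow_cost hA hlen hpar hb hbB hsum).trans hcost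
  have hnn : ∀ e < 2 ^ T, 0 ≤ (start S D L F κ s).treeFlow T par pe _ e :=
    fun e he => treeFlow_nonneg hA hpar hb he
  set g := (start S D L F κ s).treeFlow T par pe ((oriented S D L F).excess T) with hg
  refine ⟨hs, hnn, htf, ?_, fun v hv h => ((hpar.par_iff v hv).1 h).1,
    fun v hv h hc => ?_, hpar.dst_pe, fun v hv h => par_src hA hlen hpar hv h,
    fun v hv h => ?_, fun e he h => ?_⟩
  · have h1 := htc.trans (start_cost hL)
    have h2 : ({ start S D L F κ s with flow := g } : Net).cost T =
        2 ^ κ * ∑ e ∈ Finset.range (2 ^ T), g e * L e + ∑ e ∈ Finset.range (2 ^ T), g e := by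
      rw [Finset.mul_sum, ← Finset.sum_add_distrib]
      refine Finset.sum_congr rfl fun e he => ?_
      have h1 : (start S D L F κ s).len e = L e * 2 ^ κ + 1 := rfl
      simp only [h1]; ring
    rw [h2] at h1
    have h3 : 0 ≤ ∑ e ∈ Finset.range (2 ^ T), g e :=
      Finset.sum_nonneg fun e he => hnn e (Finset.mem_range.1 he)
    -- The perturbation of the new cost is nonnegative and that of the old one is below `2 ^ κ`.
    -- Dividing by `2 ^ κ`, integrality removes the remaining `+ 1`.
    have h4 : (2 : ℤ) ^ κ * ∑ e ∈ Finset.range (2 ^ T), g e * L e <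
        2 ^ κ * (∑ e ∈ Finset.range (2 ^ T), |F e| * L e + 1) := by
      rw [mul_add, mul_one]; omega
    exact Int.lt_add_one_iff.1 (lt_of_mul_lt_mul_left h4 (by positivity))
  · have h1 := hpar.flow_pos v hv h
    have h2 := start_flow_le (S := S) (D := D) (L := L) (F := F) (κ := κ) (s := s) (pe v)
    rw [hc, abs_zero] at h2
    omega
  · have h1 := hpar.le v hv h
    have h2 := hlen _ (hpar.pe_lt v hv h)
    have h3 : (start S D L F κ s).src = (oriented S D L F).src := rfl
    rw [← h3]
    omega
  · by_contra hc
    exact h (if_neg hc)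

end Net

section

variable {W : ℕ} {M : Mem} {S D : ℕ → ℕ} {L F : ℕ → ℤ}

/-- A bound on the time. -/
def timeBound (T K : ℕ) : ℕ :=
  2 * T * K * (40 * T ^ 2 + 101 * T + 61) + 10 * T ^ 2 + 85 * T + 6 * K + 122

theorem solve_runs {k T : ℕ} (hT : T = Nat.clog 2 k) (hW : 2 * 2 ^ T + 1 ≤ W)
    (hk : M 0 0 + M 0 1 = k)
    (hin : HasInput T S D L F M) (hS : ∀ i < 2 ^ T, S i < 2 ^ T) (hD : ∀ i < 2 ^ T, D i < 2 ^ T)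
    (hL : ∀ i < 2 ^ T, 0 ≤ L i) (hne : ∀ i < 2 ^ T, F i ≠ 0 → S i ≠ D i) {s₀ : ℕ}
    (hb : ∀ v < 2 ^ T, v ≠ s₀ → 0 ≤ (Net.oriented S D L F).excess T v)
    {K : ℕ} (hK : ∑ e ∈ Finset.range (2 ^ T), |F e| < 2 ^ K) :
    Runs W solve M (timeBound T K) fun M' => ∃ g s par pe φ, Net.Solution T S D L F g s par pe φ ∧
      ∀ e < 2 ^ T, M' 5 (e : ℕ) = if 0 ≤ F e then g e else -g e := by
  refine Runs.le (T := (5 * T + 8) + ((43 * T + 6 * K + 72) +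
    ((2 * T * K * (40 * T ^ 2 + 91 * T + 45) + 10 * T + 16) + (((2 * T * K + 1) * (10 * T + 16) + 2) +
    (T * (10 * T + 17) + 8))))) ?_ (by unfold timeBound; ring_nf; omega)
  have hsetup : Runs W setup M (5 * T + 8) (Base T) := by
    subst hT; exact setup_runs hW hk
  refine hsetup.seq fun M1 hs1 hB1 => ?_
  have hin1 : HasInput T S D L F M1 := by
    refine ⟨?_, ?_, ?_, ?_⟩ <;> rw [hs1 _ (by decide)]
    · exact hin.src
    · exact hin.dst
    · exact hin.len
    · exact hin.flow
  refine (prepare_runs hW hB1 hin1 hS hD hK).seq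
    fun M2 hs2 ⟨s, hs, κ, hκ, hss2, hbs, hbv2, hF2, hD2, hn2, hc2⟩ => ?_
  rw [prepare_writes] at hs2
  have hB2 := hB1.mono (hs2 _ (by decide)) (hs2 _ (by decide))
  have hA := Net.start_good (κ := κ) (s := s) hS hD hL hne
  -- A vertex with negative balance can only be `s₀`; if there is none, nonnegativity holds
  -- everywhere and the default source is as good as any.
  have hb' : ∀ v < 2 ^ T, v ≠ s → 0 ≤ (Net.oriented S D L F).excess T v := by
    intro v hv hvs
    rcases hbs with h | h
    · refine hb v hv ?_
      rintro rfl
      exact absurd (hb s hs hvs.symm) (by omega)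
    · exact h.2 v hv
  have hex : ∀ v < 2 ^ T, v ≠ s → (Net.oriented S D L F).excess T v ≤
      (Net.start S D L F κ s).excess T v := fun v _ hvs => Net.start_excess hvs
  refine (rounds_runs hW hB2 hss2 hA hn2 hc2 (fun v hv hvs => (hb' v hv hvs).trans (hex v hv hvs))
    (Net.start_pot.trans_lt hK)).seq fun M3 hs3 ⟨st, R, h0, hch, hpot, ho3, hn3, hR⟩ => ?_
  rw [rounds_writes] at hs3
  have hB3 := hB2.mono (hs3 _ (by decide)) (hs3 _ (by decide))
  have hA0 : (st 0).Good T s := by rw [h0]; exact hA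
  set B := (∑ e ∈ Finset.range (2 ^ T), (L e * 2 ^ κ + 1)) * 2 ^ κ with hBdef
  have hlt : (st 0).cost T < B := by rw [h0]; exact Net.start_cost_lt hL hF2
  have hB0 : 0 ≤ B := by
    refine mul_nonneg (Finset.sum_nonneg fun e he => ?_) (by positivity)
    have := hL e (Finset.mem_range.1 he); positivity
  have hdist := (distances_runs hW hB3 (by rw [hs3 _ (by decide), hss2]) hB0
    (by rw [hs3 _ (by decide), hD2]) hch hA0 ho3 hn3).le
    (T' := (2 * T * K + 1) * (10 * T + 16) + 2) (by gcongr)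
  refine hdist.seq fun M4 hs4 ⟨φ, hφ, hsup, hrel⟩ => ?_
  rw [distances_writes] at hs4
  have hB4 := hB3.mono (hs4 _ (by decide)) (hs4 _ (by decide))
  rw [h0] at hsup
  have hn4 : HasNet T 0 (Net.start S D L F κ s) M4 := by
    have := hn3 0 (Nat.zero_le _)
    rw [h0, Nat.cast_zero, zero_mul] at this
    exact this.mono (hs4 _ (by decide)) (hs4 _ (by decide)) (hs4 _ (by decide)) (hs4 _ (by decide))
  refine (route_runs hW hB4 hA hn4 (D := B)
    (by rw [hs4 _ (by decide), hs3 _ (by decide), hD2]) hφ hsup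
    (b := (Net.oriented S D L F).excess T)
    (by rw [hs4 _ (by decide), hs3 _ (by decide)]; exact hbv2)).mono le_rfl
    fun M5 _ ⟨par, pe, hpar, hout⟩ => ?_
  obtain ⟨hc1, hc2⟩ := hch.demand_le hA0 hpot (by rwa [h0]) hrel
    (b := (Net.oriented S D L F).excess T) (by rw [h0]; exact hex) hlt
  rw [h0] at hc1
  refine ⟨_, s, par, pe, φ, Net.solution_treeFlow hS hD hL hne
    (hbs.elim (fun h => .inr h.ne) fun h => .inl h.1) hb' hF2 hpar hc1 hc2,
    fun e he => ?_⟩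
  rw [hout e he, hs4 _ (by decide), hs3 _ (by decide), hs2 _ (by decide), hs1 _ (by decide),
    hin.flow e he]

end

end PRAM

/-! ### Trees given by parents -/

/-- A vertex of minimal `φ` not reachable from `r` would have a reachable parent, so the graph is
connected. Sending `v ≠ r` to the edge to its parent covers all edges, so there are fewer edges than
vertices. -/
theorem SimpleGraph.isTree_of_parent {V : Type*} [Finite V] (H : SimpleGraph V) (r : V) (p : V → V)
    (φ : V → ℤ) (hlt : ∀ v, v ≠ r → φ (p v) < φ v)
    (hadj : ∀ u v, H.Adj u v ↔ (u ≠ r ∧ p u = v) ∨ (v ≠ r ∧ p v = u)) : H.IsTree := by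
  classical
  have hconn : H.Connected := by
    rw [SimpleGraph.connected_iff_exists_forall_reachable]
    refine ⟨r, ?_⟩
    by_contra! hc
    obtain ⟨v, hv, hmin⟩ := Set.exists_min_image {v | ¬ H.Reachable r v} φ (Set.toFinite _) hc
    have hvr : v ≠ r := by rintro rfl; exact hv (SimpleGraph.Reachable.refl _)
    have hp : H.Reachable r (p v) := by
      by_contra h
      exact absurd (hmin _ h) (not_le.2 (hlt v hvr))
    exact hv (hp.trans (SimpleGraph.Adj.reachable ((hadj _ _).2 (.inr ⟨hvr, rfl⟩))))
  refine SimpleGraph.isTree_iff_connected_and_card.2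
    ⟨hconn, le_antisymm ?_ hconn.card_vert_le_card_edgeSet_add_one⟩
  have h1 : Nat.card H.edgeSet ≤ Nat.card {v // v ≠ r} := by
    refine Nat.card_le_card_of_surjective
      (fun v : {v // v ≠ r} => (⟨s(v.1, p v.1), (hadj _ _).2 (.inl ⟨v.2, rfl⟩)⟩ : H.edgeSet)) ?_
    rintro ⟨e, he⟩
    induction e using Sym2.ind with
    | h u v =>
      rcases (hadj u v).1 he with ⟨h1, h2⟩ | ⟨h1, h2⟩
      · exact ⟨⟨u, h1⟩, by simp [h2]⟩
      · exact ⟨⟨v, h1⟩, by simp [h2, Sym2.eq_swap]⟩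
  have h2 : Nat.card V = Nat.card {v // v ≠ r} + 1 := by
    rw [← Finite.card_option]
    exact Nat.card_congr (Equiv.optionSubtypeNe r).symm
  omega

/-! ### Reading the input -/

theorem toArray_natCast {k : ℕ} (x : Fin k → ℤ) (i : ℕ) :
    WeightedGraph.toArray x (i : ℤ) = if h : i < k then x ⟨i, h⟩ else 0 := by
  simp [WeightedGraph.toArray]

theorem sum_range_eq_sum_fin {α : Type*} [AddCommMonoid α] {m N : ℕ} (h : m ≤ N) (g : ℕ → α)
    (hg : ∀ e, m ≤ e → e < N → g e = 0) : ∑ e ∈ Finset.range N, g e = ∑ e : Fin m, g e := by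
  rw [← Finset.sum_range, ← Finset.sum_subset (Finset.range_subset_range.2 h)]
  intro e he' he
  exact hg e (by simpa using he) (by simpa using he')

namespace WeightedGraph

variable (G : WeightedGraph)

/-- The first endpoint of the edge, as a natural number. -/
def srcNat (e : ℕ) : ℕ := if h : e < G.m then G.src ⟨e, h⟩ else 0

/-- The second endpoint of the edge, as a natural number. -/
def dstNat (e : ℕ) : ℕ := if h : e < G.m then G.dst ⟨e, h⟩ else 0

variable {G}

theorem srcNat_coe (e : Fin G.m) : G.srcNat e = G.src e := by simp [srcNat]

theorem dstNat_coe (e : Fin G.m) : G.dstNat e = G.dst e := by simp [dstNat]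

variable {f : Fin G.m → ℚ} {B : ℕ} (R : G.FixedPoint f B)

/-- The multiplier of the length of the edge. -/
def FixedPoint.lenInt (e : ℕ) : ℤ := if h : e < G.m then R.lenNum ⟨e, h⟩ else 0

/-- The multiplier of the flow through the edge. -/
def FixedPoint.flowInt (e : ℕ) : ℤ := if h : e < G.m then R.flowNum ⟨e, h⟩ else 0

theorem FixedPoint.lenInt_coe (e : Fin G.m) : R.lenInt e = R.lenNum e := by
  simp [FixedPoint.lenInt]

theorem FixedPoint.flowInt_coe (e : Fin G.m) : R.flowInt e = R.flowNum e := by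
  simp [FixedPoint.flowInt]

theorem FixedPoint.flowInt_of_le {e : ℕ} (he : G.m ≤ e) : R.flowInt e = 0 :=
  dif_neg (not_lt.2 he)

theorem FixedPoint.hasInput (T : ℕ) :
    PRAM.HasInput T G.srcNat G.dstNat R.lenInt R.flowInt R.initMem where
  src i _ := by
    simp only [FixedPoint.initMem, toArray_natCast, srcNat]
    split_ifs <;> rfl
  dst i _ := by
    simp only [FixedPoint.initMem, toArray_natCast, dstNat]
    split_ifs <;> rfl
  len i _ := by simp only [FixedPoint.initMem, toArray_natCast, FixedPoint.lenInt]
  flow i _ := by simp only [FixedPoint.initMem, toArray_natCast, FixedPoint.flowInt]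

open PRAM

/-- The net of the flow. -/
abbrev FixedPoint.net : Net := Net.oriented G.srcNat G.dstNat R.lenInt R.flowInt

/-- The flow with the absolute values `g` and with the same directions as the given flow. -/
def FixedPoint.signed (g : ℕ → ℤ) (e : ℕ) : ℤ := if 0 ≤ R.flowInt e then g e else -g e

theorem FixedPoint.signed_abs (e : ℕ) : R.signed (fun e => |R.flowInt e|) e = R.flowInt e := by
  unfold FixedPoint.signed
  split_ifs with h
  · exact abs_of_nonneg h
  · change -|R.flowInt e| = _
    rw [abs_of_neg (not_le.1 h), neg_neg]

/-- Reversing an edge and negating the flow through it have the same effect on the balances; this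
translates between the oriented net and the input list. -/
theorem FixedPoint.excess_eq {T : ℕ} (hT : G.m ≤ 2 ^ T) {g : ℕ → ℤ}
    (hg : ∀ e, G.m ≤ e → e < 2 ^ T → g e = 0) (v : ℕ) :
    ({ R.net with flow := g } : Net).excess T v = ∑ e : Fin G.m, R.signed g e *
      ((if (G.dst e : ℕ) = v then 1 else 0) - if (G.src e : ℕ) = v then 1 else 0) := by
  rw [Net.excess, sum_range_eq_sum_fin hT _ fun e he he' => by simp only [hg e he he', zero_mul]]
  refine Finset.sum_congr rfl fun e _ => ?_
  simp only [Net.oriented, FixedPoint.signed, srcNat_coe, dstNat_coe]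
  by_cases h : 0 ≤ R.flowInt e
  · simp only [if_pos h]
  · simp only [if_neg h]; ring

theorem netInflow_div (x : Fin G.m → ℤ) (q : ℕ) (v : Fin G.n) :
    G.netInflow (fun e => (x e : ℚ) / q) v = ((∑ e, x e *
      ((if (G.dst e : ℕ) = v then 1 else 0) - if (G.src e : ℕ) = v then 1 else 0) : ℤ) : ℚ) / q := by
  simp only [netInflow, Finset.sum_filter, ← Finset.sum_sub_distrib]
  push_cast
  rw [Finset.sum_div]
  refine Finset.sum_congr rfl fun e _ => ?_
  simp only [Fin.ext_iff]
  split_ifs <;> simp [neg_div]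

theorem FixedPoint.netInflow_eq {T : ℕ} (hT : G.m ≤ 2 ^ T) {g : ℕ → ℤ}
    (hg : ∀ e, G.m ≤ e → e < 2 ^ T → g e = 0) (v : Fin G.n) :
    G.netInflow (fun e => (R.signed g e : ℚ) / R.flowDen) v =
      (({ R.net with flow := g } : Net).excess T v : ℚ) / R.flowDen := by
  rw [netInflow_div (fun e => R.signed g e), R.excess_eq hT hg]

theorem FixedPoint.netInflow_flow {T : ℕ} (hT : G.m ≤ 2 ^ T) (v : Fin G.n) :
    G.netInflow f v = (R.net.excess T v : ℚ) / R.flowDen := by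
  have := R.netInflow_eq hT (g := fun e => |R.flowInt e|)
    (fun e he _ => by rw [R.flowInt_of_le he, abs_zero]) v
  simp only [R.signed_abs] at this
  rw [← show f = fun e : Fin G.m => (R.flowInt e : ℚ) / R.flowDen by
    funext e; rw [R.flowInt_coe, R.flow_eq]] at this
  exact this

theorem FixedPoint.excess_of_le {T : ℕ} (hT : G.m ≤ 2 ^ T) {v : ℕ} (hv : G.n ≤ v) :
    R.net.excess T v = 0 := by
  have := R.excess_eq hT (g := fun e => |R.flowInt e|)
    (fun e he _ => by rw [R.flowInt_of_le he, abs_zero]) v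
  refine Eq.trans this (Finset.sum_eq_zero fun e _ => ?_)
  have h1 := (G.dst e).2
  have h2 := (G.src e).2
  rw [if_neg (by omega), if_neg (by omega), sub_self, mul_zero]

theorem FixedPoint.cost_eq {T : ℕ} (hT : G.m ≤ 2 ^ T) {g : ℕ → ℤ}
    (hg : ∀ e, G.m ≤ e → e < 2 ^ T → g e = 0) (hg' : ∀ e < G.m, 0 ≤ g e) :
    G.cost (fun e => (R.signed g e : ℚ) / R.flowDen) =
      ((∑ e ∈ Finset.range (2 ^ T), g e * R.lenInt e : ℤ) : ℚ) / (R.lenDen * R.flowDen) := by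
  rw [sum_range_eq_sum_fin hT _ fun e he he' => by rw [hg e he he', zero_mul]]
  push_cast
  rw [Finset.sum_div]
  refine Finset.sum_congr rfl fun e _ => ?_
  have h1 : |(R.signed g e : ℚ)| = g e := by
    have h2 : |R.signed g e| = g e := by
      unfold FixedPoint.signed
      split_ifs
      · exact abs_of_nonneg (hg' e e.2)
      · rw [abs_neg]; exact abs_of_nonneg (hg' e e.2)
    exact_mod_cast h2
  rw [R.len_eq, abs_div, h1, Nat.abs_cast, R.lenInt_coe]
  push_cast
  ring

theorem FixedPoint.cost_flow {T : ℕ} (hT : G.m ≤ 2 ^ T) : G.cost f =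
    ((∑ e ∈ Finset.range (2 ^ T), |R.flowInt e| * R.lenInt e : ℤ) : ℚ) /
      (R.lenDen * R.flowDen) := by
  rw [← R.cost_eq hT (g := fun e => |R.flowInt e|)
    (fun e he _ => by rw [R.flowInt_of_le he, abs_zero]) (fun e _ => abs_nonneg _)]
  simp only [R.signed_abs]
  congr 1
  funext e
  rw [R.flowInt_coe, R.flow_eq]

section Solution

variable {T : ℕ} {g : ℕ → ℤ} {s : ℕ} {par : ℕ → Prop} {pe : ℕ → ℕ} {φ : ℕ → ℤ}

theorem FixedPoint.pe_lt (h : Net.Solution T G.srcNat G.dstNat R.lenInt R.flowInt g s par pe φ)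
    {v : ℕ} (hv : v < 2 ^ T) (hp : par v) : pe v < G.m := by
  by_contra hc
  exact h.flow_ne v hv hp (R.flowInt_of_le (not_lt.1 hc))

theorem FixedPoint.endpoints_lt {e : ℕ} (he : e < G.m) :
    R.net.src e < G.n ∧ R.net.dst e < G.n := by
  have h1 : G.srcNat e < G.n := by simp [srcNat, he]
  have h2 : G.dstNat e < G.n := by simp [dstNat, he]
  simp only [FixedPoint.net, Net.oriented]
  split_ifs <;> exact ⟨by assumption, by assumption⟩

theorem FixedPoint.endpoints_eq (e : Fin G.m) {u v : Fin G.n} (hu : R.net.src e = u)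
    (hv : R.net.dst e = v) : s(u, v) = s(G.src e, G.dst e) := by
  simp only [FixedPoint.net, Net.oriented, srcNat_coe, dstNat_coe] at hu hv
  split_ifs at hu hv
  · rw [Fin.ext hu, Fin.ext hv]
  · rw [Fin.ext hu, Fin.ext hv, Sym2.eq_swap]

/-- Parent edges carry original flow, so they are true edges and never padding. -/
theorem FixedPoint.eq_zero_of_le
    (h : Net.Solution T G.srcNat G.dstNat R.lenInt R.flowInt g s par pe φ)
    (hd : ∀ e < 2 ^ T, R.net.dst e < 2 ^ T) {e : ℕ} (he : G.m ≤ e) (heT : e < 2 ^ T) :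
    g e = 0 := by
  by_contra hc
  obtain ⟨h1, h2⟩ := h.support e heT hc
  exact absurd (h2.symm.le.trans_lt (R.pe_lt h (hd e heT) h1)) (not_lt.2 he)

/-- The tree of the parent edges. -/
def FixedPoint.tree (h : Net.Solution T G.srcNat G.dstNat R.lenInt R.flowInt g s par pe φ)
    (hn : G.n ≤ 2 ^ T) : G.graph.Subgraph where
  verts := {v | (v : ℕ) = s ∨ par v}
  Adj u v := (par v ∧ R.net.src (pe v) = u) ∨ (par u ∧ R.net.src (pe u) = v)
  adj_sub := by
    have key : ∀ {u v : Fin G.n}, par v → R.net.src (pe v) = u → G.graph.Adj u v := by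
      intro u v hp hu
      have hvT : (v : ℕ) < 2 ^ T := by omega
      have he := R.pe_lt h hvT hp
      refine (SimpleGraph.fromEdgeSet_adj _).2
        ⟨⟨⟨pe v, he⟩, (R.endpoints_eq ⟨pe v, he⟩ hu (h.dst_pe v hvT hp)).symm⟩, ?_⟩
      rintro rfl
      have := h.lt u hvT hp
      rw [hu] at this
      exact lt_irrefl _ this
    rintro u v (⟨h1, h2⟩ | ⟨h1, h2⟩)
    · exact key h1 h2
    · exact (key h1 h2).symm
  edge_vert := by
    rintro u v (⟨h1, h2⟩ | ⟨h1, -⟩)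
    · have := h.src_pe v (by omega) h1
      rw [h2] at this
      exact this
    · exact .inr h1
  symm := ⟨fun _ _ h => h.symm⟩

open Classical in
theorem FixedPoint.isTree_tree
    (h : Net.Solution T G.srcNat G.dstNat R.lenInt R.flowInt g s par pe φ)
    (hn : G.n ≤ 2 ^ T) (hs : s < G.n) : (R.tree h hn).coe.IsTree := by
  set r : (R.tree h hn).verts := ⟨⟨s, hs⟩, .inl rfl⟩ with hr
  have hpar : ∀ v : (R.tree h hn).verts, v ≠ r ↔ par (v : Fin G.n) := by
    rintro ⟨v, hv⟩
    constructor
    · intro hne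
      rcases hv with hv | hv
      · exact absurd (Subtype.ext (Fin.ext hv)) hne
      · exact hv
    · intro hp hc
      have : (v : ℕ) = s := congrArg (fun v : (R.tree h hn).verts => (v.1 : ℕ)) hc
      exact h.par_ne v (by omega) hp this
  have hlt : ∀ v : Fin G.n, par v → R.net.src (pe v) < G.n := fun v hp =>
    (R.endpoints_lt (R.pe_lt h (by omega) hp)).1
  set p : (R.tree h hn).verts → (R.tree h hn).verts := fun v =>
    if hp : par (v : Fin G.n) then
      ⟨⟨R.net.src (pe (v : Fin G.n)), hlt v hp⟩, h.src_pe _ (by omega) hp⟩ else r with hp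
  have hpv : ∀ v : (R.tree h hn).verts, par (v : Fin G.n) →
      ((p v : Fin G.n) : ℕ) = R.net.src (pe (v : Fin G.n)) := by
    intro v hv
    simp only [hp, dif_pos hv]
  have hiff : ∀ u v : (R.tree h hn).verts, (u ≠ r ∧ p u = v) ↔
      (par (u : Fin G.n) ∧ R.net.src (pe (u : Fin G.n)) = (v : Fin G.n)) := by
    intro u v
    rw [hpar]
    refine and_congr_right fun hu => ?_
    rw [← hpv u hu, ← Fin.ext_iff, Subtype.ext_iff]
  refine SimpleGraph.isTree_of_parent _ r p (fun v => φ (v : Fin G.n)) (fun v hv => ?_)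
    fun u v => ?_
  · rw [hpar] at hv
    rw [hpv v hv]
    exact h.lt _ (by omega) hv
  · rw [hiff, hiff, or_comm]
    rfl

theorem FixedPoint.supportedOnTree
    (h : Net.Solution T G.srcNat G.dstNat R.lenInt R.flowInt g s par pe φ)
    (hn : G.n ≤ 2 ^ T) (hm : G.m ≤ 2 ^ T) (hs : s < G.n) :
    G.SupportedOnTree fun e => (R.signed g e : ℚ) / R.flowDen := by
  refine ⟨R.tree h hn, R.isTree_tree h hn hs, fun e he => ?_⟩
  have hge : g e ≠ 0 := by
    rintro hc
    apply he
    simp [FixedPoint.signed, hc]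
  obtain ⟨h1, h2⟩ := h.support e (by omega) hge
  obtain ⟨h3, h4⟩ := R.endpoints_lt e.2
  rw [← R.endpoints_eq e (u := ⟨_, h3⟩) (v := ⟨_, h4⟩) rfl rfl, SimpleGraph.Subgraph.mem_edgeSet]
  exact .inl ⟨h1, by simp only [h2]⟩

end Solution

end WeightedGraph

/-! ### Numerical bounds and the theorem. -/

namespace PRAM

theorem timeBound_le {T l : ℕ} (hT : T ≤ l) (hl : 1 ≤ l) :
    timeBound T (2 * l) ≤ 1037 * l ^ 4 := by
  have h1 : l ≤ l ^ 4 := Nat.le_self_pow (by norm_num) l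
  have h2 : l ^ 2 ≤ l ^ 4 := Nat.pow_le_pow_right hl (by norm_num)
  have h3 : l ^ 3 ≤ l ^ 4 := Nat.pow_le_pow_right hl (by norm_num)
  have h4 : 1 ≤ l ^ 4 := Nat.one_le_pow _ _ hl
  -- All powers of `l` are at most `l ^ 4`, and `1037 = 160 + 404 + 254 + 97 + 122`.
  calc timeBound T (2 * l)
      ≤ 2 * l * (2 * l) * (40 * l ^ 2 + 101 * l + 61) + 10 * l ^ 2 + 85 * l + 6 * (2 * l) + 122 := by
        unfold timeBound; gcongr
    _ = 160 * l ^ 4 + 404 * l ^ 3 + 254 * l ^ 2 + 97 * l + 122 := by ring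
    _ ≤ 1037 * l ^ 4 := by omega

theorem two_pow_clog_le {k : ℕ} (hk : 1 ≤ k) : 2 ^ Nat.clog 2 k ≤ 2 * k := by
  rcases hk.eq_or_lt with rfl | h
  · simp
  · have h1 := Nat.pow_pred_clog_lt_self (b := 2) (by norm_num) h
    have h2 : 0 < Nat.clog 2 k := Nat.clog_pos (by norm_num) h
    obtain ⟨c, hc⟩ : ∃ c, Nat.clog 2 k = c + 1 := ⟨_, (Nat.succ_pred_eq_of_pos h2).symm⟩
    rw [hc] at h1 ⊢
    rw [Nat.pred_succ] at h1
    rw [pow_succ]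
    omega

end PRAM

/-- The total is at most `m * B`, and each factor has logarithmically many bits; this is the source
of the doubled exponent. -/
theorem WeightedGraph.FixedPoint.sum_flow_lt {G : WeightedGraph} {f : Fin G.m → ℚ} {B : ℕ}
    (R : G.FixedPoint f B) {T : ℕ} (hT : G.m ≤ 2 ^ T) (hn : 0 < G.n) :
    ∑ e ∈ Finset.range (2 ^ T), |R.flowInt e| < 2 ^ (2 * (Nat.log 2 (G.n + G.m + B) + 1)) := by
  rw [sum_range_eq_sum_fin hT _ fun e he _ => by rw [R.flowInt_of_le he, abs_zero]]
  have h1 : ∑ e : Fin G.m, |R.flowInt e| ≤ ∑ _e : Fin G.m, (B : ℤ) :=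
    Finset.sum_le_sum fun e _ => by rw [R.flowInt_coe]; exact R.flowNum_le e
  rw [Finset.sum_const, Finset.card_univ, Fintype.card_fin, nsmul_eq_mul] at h1
  have h2 := Nat.lt_pow_succ_log_self (b := 2) (by norm_num) (G.n + G.m + B)
  rw [Nat.succ_eq_add_one] at h2
  refine h1.trans_lt ?_
  rw [mul_comm 2, pow_mul, sq]
  have h3 : G.m * B < 2 ^ (Nat.log 2 (G.n + G.m + B) + 1) * 2 ^ (Nat.log 2 (G.n + G.m + B) + 1) :=
    Nat.mul_lt_mul_of_lt_of_le (by omega) (by omega) (by positivity)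
  exact_mod_cast h3

theorem theorem3 :
    ∃ (P : PRAM.Prog) (C c : ℕ),
      ∀ (G : WeightedGraph) (f : Fin G.m → ℚ) (b : Fin G.n → ℚ),
        G.IsSingleSourceDemand b → G.Routes f b →
        ∀ (B : ℕ) (R : G.FixedPoint f B),
          ∃ (M : PRAM.Mem) (work time : ℕ),
            PRAM.Exec P R.initMem M work time ∧
            work ≤ C * (G.n + G.m) * (Nat.log 2 (G.n + G.m + B) + 1) ^ c ∧
            time ≤ C * (Nat.log 2 (G.n + G.m + B) + 1) ^ c ∧
            G.Routes (R.output M) b ∧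
            G.cost (R.output M) ≤ G.cost f ∧
            G.SupportedOnTree (R.output M) := by
  -- The time is at most `1037 * l ^ 4` by `timeBound_le`. The factor `5` comes from `2 * 2 ^ T + 1
  -- ≤ 4 * (n + m) + 1` and `1 ≤ n + m`.
  refine ⟨PRAM.solve, 5 * 1037, 4, ?_⟩
  rintro G f b ⟨-, s₀, hb⟩ hf B R
  set l := Nat.log 2 (G.n + G.m + B) + 1 with hl
  obtain ⟨T, hT⟩ : ∃ T, T = Nat.clog 2 (G.n + G.m) := ⟨_, rfl⟩
  have hn0 : 0 < G.n := s₀.pos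
  have hk : G.n + G.m ≤ 2 ^ T := hT ▸ Nat.le_pow_clog (by norm_num) _
  have hn : G.n ≤ 2 ^ T := by omega
  have hm : G.m ≤ 2 ^ T := by omega
  have hq : (0 : ℚ) < R.flowDen := by exact_mod_cast R.flowDen_pos
  have hp : (0 : ℚ) < R.lenDen := by exact_mod_cast R.lenDen_pos
  have hS : ∀ i < 2 ^ T, G.srcNat i < 2 ^ T := by
    intro i hi
    unfold WeightedGraph.srcNat
    split_ifs
    · exact (Fin.is_lt _).trans_le hn
    · omega
  have hD : ∀ i < 2 ^ T, G.dstNat i < 2 ^ T := by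
    intro i hi
    unfold WeightedGraph.dstNat
    split_ifs
    · exact (Fin.is_lt _).trans_le hn
    · omega
  have hL : ∀ i < 2 ^ T, 0 ≤ R.lenInt i := by
    intro i _
    unfold WeightedGraph.FixedPoint.lenInt
    split_ifs <;> positivity
  have hne : ∀ i < 2 ^ T, R.flowInt i ≠ 0 → G.srcNat i ≠ G.dstNat i := by
    intro i _ hF
    have hi : i < G.m := by
      by_contra hc
      exact hF (R.flowInt_of_le (not_lt.1 hc))
    simp only [WeightedGraph.srcNat, WeightedGraph.dstNat, dif_pos hi]
    exact fun hc => G.loopless ⟨i, hi⟩ (Fin.ext hc)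
  have hex : ∀ v < 2 ^ T, v ≠ (s₀ : ℕ) → 0 ≤ R.net.excess T v := by
    intro v _ hvs
    rcases Nat.lt_or_ge v G.n with hv | hv
    · have h1 := hb ⟨v, hv⟩ fun hc => hvs (congrArg Fin.val hc)
      rw [← hf, R.netInflow_flow hm] at h1
      have h2 := mul_nonneg h1 hq.le
      rw [div_mul_cancel₀ _ hq.ne'] at h2
      exact_mod_cast h2
    · exact (R.excess_of_le hm hv).ge
  obtain ⟨M, w, t, hexec, hw, ht, g, s, par, pe, φ, hsol, hout⟩ := PRAM.solve_runs (M := R.initMem)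
    hT le_rfl (by simp [WeightedGraph.FixedPoint.initMem, WeightedGraph.toArray]) (R.hasInput T)
    hS hD hL hne hex (R.sum_flow_lt hm hn0)
  -- The source is a true vertex: `0` is one because `s₀` exists, and a padding vertex has balance
  -- zero.
  have hsn : s < G.n := by
    rcases hsol.source with h | h
    · omega
    · by_contra hc
      exact h (R.excess_of_le hm (not_lt.1 hc))
  have hd : ∀ e < 2 ^ T, R.net.dst e < 2 ^ T := by
    intro e he
    have := hS e he; have := hD e he
    simp only [WeightedGraph.FixedPoint.net, PRAM.Net.oriented]; split_ifs <;> assumption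
  have hg0 : ∀ e, G.m ≤ e → e < 2 ^ T → g e = 0 := fun e he he' => R.eq_zero_of_le hsol hd he he'
  have hM : R.output M = fun e : Fin G.m => (R.signed g e : ℚ) / R.flowDen := by
    funext e
    rw [WeightedGraph.FixedPoint.output, hout e (by omega), WeightedGraph.FixedPoint.signed]
  have hTl : T ≤ l := by
    rw [hT]
    refine Nat.clog_le_of_le_pow ?_
    have := Nat.lt_pow_succ_log_self (b := 2) (by norm_num) (G.n + G.m + B)
    rw [Nat.succ_eq_add_one, ← hl] at this
    omega
  have htime : t ≤ 1037 * l ^ 4 := ht.trans (PRAM.timeBound_le hTl (by omega))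
  refine ⟨M, w, t, hexec, ?_, htime.trans (by gcongr; norm_num), ?_, ?_, ?_⟩
  · have h1 : 2 * 2 ^ T + 1 ≤ 5 * (G.n + G.m) := by
      have := PRAM.two_pow_clog_le (k := G.n + G.m) (by omega)
      rw [← hT] at this
      omega
    calc w ≤ (2 * 2 ^ T + 1) * t := hw
      _ ≤ 5 * (G.n + G.m) * (1037 * l ^ 4) := Nat.mul_le_mul h1 htime
      _ = 5 * 1037 * (G.n + G.m) * l ^ 4 := by ring
  · intro v
    rw [hM, R.netInflow_eq hm hg0, hsol.excess_eq v (by omega), ← R.netInflow_flow hm, hf]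
  · rw [hM, R.cost_eq hm hg0 fun e he => hsol.nonneg e (by omega), R.cost_flow hm]
    exact div_le_div_of_nonneg_right (by exact_mod_cast hsol.cost_le) (by positivity)
  · rw [hM]
    exact R.supportedOnTree hsol hn hm hsn
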